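/- All manifolds are smooth, finite-dimensional, Hausdorff, second countable and without boundary. Products in groupoids are written from left to right. Let $(\mathcal B;\mathcal V,\mathcal H;\mathcal P)$ be a double Lie groupoid, that is, a double groupoid of boxes $A$ with top and bottom sides $t(A),b(A)\in\mathcal H$ and left and right sides $l(A),r(A)\in\mathcal V$ (where $t,b:\mathcal V\to\mathcal P$ and $l,r:\mathcal H\to\mathcal P$ are the source and target maps of the Lie groupoids $\mathcal V$, $\mathcal H$ over $\mathcal P$), such that all four groupoids involved are Lie groupoids and the double source map $\mathcal B\to\mathcal H\times_{l,t}\mathcal V$, $A\mapsto(t(A),l(A))$, is a surjective submersion. Assume that it is slim: a box is determined by its four sides. Let $\mathbf E(\mathcal B)=\{E\in\mathcal B: t(E)\text{ and }r(E)\text{ are identities}\}$ be the core groupoid (the source of $E$ is its bottom left vertex, the target its top right vertex), which acts on $\mathcal V\times_{b,l}\mathcal H$ by the core action $E\rhd(f,x)=(f\,l(E),\,b(E)\,x)$, defined when $b(f)=l(x)$ is the target of $E$. Assume that the core action is proper: the map $(E,z)\mapsto(E\rhd z,z)$, from the set of pairs for which $E\rhd z$ is defined to $(\mathcal V\times_{b,l}\mathcal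 H)\times(\mathcal V\times_{b,l}\mathcal H)$, is proper. Let $\mathcal D(\mathcal B)=(\mathcal V\circledast\mathcal H)/J$ be the diagonal groupoid, where $\mathcal V\circledast\mathcal H$ is the free product over $\mathcal P$ of the groupoids $\mathcal V$ and $\mathcal H$, and $J$ is its subgroupoid generated by the arrows $t(A)\,r(A)\,b(A)^{-1}\,l(A)^{-1}$, $A\in\mathcal B$; let $j:\mathcal V\to\mathcal D(\mathcal B)$ and $i:\mathcal H\to\mathcal D(\mathcal B)$ be the canonical morphisms. Then $\mathcal D(\mathcal B)$ is a Lie groupoid over $\mathcal P$: its set of arrows carries the structure of a smooth manifold for which $\mathcal D(\mathcal B)$ is a Lie groupoid over the manifold $\mathcal P$ and such that, moreover, $(f,x)\mapsto j(f)\,i(x)$ induces a homeomorphism $(\mathcal V\times_{b,l}\mathcal H)/\mathbf E(\mathcal B)\to\mathcal D(\mathcal B)$ from the quotient of the core action (with the quotient topology), and the resulting projection $\mathcal V\times_{b,l}\mathcal H\to(\mathcal V\times_{b,l}\mathcal H)/\mathbf E(\mathcal B)\cong\mathcal D(\mathcal B)$ is a surjective submersion. -/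

import Mathlib

open scoped Manifold ContDiff Topology

set_option linter.unusedSectionVars false

noncomputable section

/-- The fibre product `M ×_{f,g} N`, with the topology of a subspace of `M × N`. -/
abbrev FiberProduct {M N P : Type*} (f : M → P) (g : N → P) : Type _ :=
  {z : M × N // f z.1 = g z.2}

namespace FiberProduct

open Manifold Set

variable {EM EN EP : Type*}
  [NormedAddCommGroup EM] [NormedSpace ℝ EM] [NormedAddCommGroup EN] [NormedSpace ℝ EN]
  [NormedAddCommGroup EP] [NormedSpace ℝ EP]
  {M N P : Type*} [TopologicalSpace M] [ChartedSpace EM M]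
  [TopologicalSpace N] [ChartedSpace EN N] [TopologicalSpace P] [ChartedSpace EP P]
  {f : M → P} {g : N → P}

section Chart

variable {F : Type*} [NormedAddCommGroup F] [NormedSpace ℝ F] {x : M}

/-- The ambient point `(φ⁻¹ (e⁻¹ (ψ (g (χ⁻¹ y)), c)), χ⁻¹ y)` that has coordinates `(y, c)`, where
`φ`, `ψ` are charts in which `f` becomes the first projection of `e : EM ≃ EP × F`. -/
def point (h : IsSubmersionAtOfComplement F 𝓘(ℝ, EM) 𝓘(ℝ, EP) ∞ f x) (g : N → P) (n : N)
    (w : EN × F) : M × N :=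
  (h.domChart.symm (h.equiv.symm (h.codChart (g ((chartAt EN n).symm w.1)), w.2)),
    (chartAt EN n).symm w.1)

/-- The open set of coordinates `(y, c)` for which `point` makes sense. -/
def coords (h : IsSubmersionAtOfComplement F 𝓘(ℝ, EM) 𝓘(ℝ, EP) ∞ f x) (g : N → P) (n : N) :
    Set (EN × F) :=
  {w | w.1 ∈ (chartAt EN n).target ∧ g ((chartAt EN n).symm w.1) ∈ h.codChart.source ∧
    h.equiv.symm (h.codChart (g ((chartAt EN n).symm w.1)), w.2) ∈ h.domChart.target}

theorem codChart_apply (h : IsSubmersionAtOfComplement F 𝓘(ℝ, EM) 𝓘(ℝ, EP) ∞ f x) {m : M}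
    (hm : m ∈ h.domChart.source) : h.codChart (f m) = (h.equiv (h.domChart m)).1 := by
  have hm' : h.domChart m ∈ (h.domChart.extend 𝓘(ℝ, EM)).target := by
    simpa using h.domChart.map_source hm
  have := h.writtenInCharts hm'
  simpa [h.domChart.left_inv hm] using this

theorem point_mem (h : IsSubmersionAtOfComplement F 𝓘(ℝ, EM) 𝓘(ℝ, EP) ∞ f x) {n : N}
    {w : EN × F} (hw : w ∈ coords h g n) : f (point h g n w).1 = g (point h g n w).2 := by
  obtain ⟨h1, h2, h3⟩ := hw
  have hs := h.domChart.map_target h3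
  refine h.codChart.injOn (h.source_subset_preimage_source hs) h2 ?_
  simp only [point]
  rw [codChart_apply h hs, h.domChart.right_inv h3]
  simp

theorem continuousOn_point (h : IsSubmersionAtOfComplement F 𝓘(ℝ, EM) 𝓘(ℝ, EP) ∞ f x)
    (hg : Continuous g) (n : N) :
    ContinuousOn (point (EN := EN) h g n) (coords h g n) := by
  have c1 : ContinuousOn (fun w : EN × F => (chartAt EN n).symm w.1) (coords h g n) :=
    (chartAt EN n).symm.continuousOn.comp continuousOn_fst (fun w hw => hw.1)
  have c2 : ContinuousOn (fun w : EN × F => h.codChart (g ((chartAt EN n).symm w.1)))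
      (coords h g n) :=
    h.codChart.continuousOn.comp (hg.comp_continuousOn c1) (fun w hw => hw.2.1)
  refine ContinuousOn.prodMk (h.domChart.symm.continuousOn.comp
    (h.equiv.symm.continuous.comp_continuousOn (c2.prodMk continuousOn_snd))
    (fun w hw => hw.2.2)) c1

theorem isOpen_coords (h : IsSubmersionAtOfComplement F 𝓘(ℝ, EM) 𝓘(ℝ, EP) ∞ f x)
    (hg : Continuous g) (n : N) :
    IsOpen (coords (EN := EN) h g n) := by
  have o1 : IsOpen {w : EN × F | w.1 ∈ (chartAt EN n).target} :=
    (chartAt EN n).open_target.preimage continuous_fst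
  have c1 : ContinuousOn (fun w : EN × F => g ((chartAt EN n).symm w.1))
      {w : EN × F | w.1 ∈ (chartAt EN n).target} :=
    hg.comp_continuousOn
      ((chartAt EN n).symm.continuousOn.comp continuousOn_fst (fun w hw => hw))
  have o2 := c1.isOpen_inter_preimage o1 h.codChart.open_source
  have c2 : ContinuousOn (fun w : EN × F =>
      h.equiv.symm (h.codChart (g ((chartAt EN n).symm w.1)), w.2))
      ({w : EN × F | w.1 ∈ (chartAt EN n).target} ∩
        (fun w : EN × F => g ((chartAt EN n).symm w.1)) ⁻¹' h.codChart.source) :=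
    h.equiv.symm.continuous.comp_continuousOn
      ((h.codChart.continuousOn.comp (c1.mono inter_subset_left) (fun w hw => hw.2)).prodMk
        continuousOn_snd)
  have o3 := c2.isOpen_inter_preimage o2 h.domChart.open_target
  convert o3 using 1
  ext w
  simp [coords, and_assoc]

open Classical in
/-- The chart of the fibre product around `z`: if in charts `φ`, `ψ` the submersion `f` is the
first projection of `e : EM ≃ EP × F`, and `χ` is a chart of `N`, then the coordinates of a point
`(m, n)` of the fibre product are `χ n` and the `F`-component of `e (φ m)`. -/
def chart (hf : IsSubmersionOfComplement F 𝓘(ℝ, EM) 𝓘(ℝ, EP) ∞ f) (hg : Continuous g)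
    (z : FiberProduct f g) : OpenPartialHomeomorph (FiberProduct f g) (EN × F) where
  toFun w := (chartAt EN z.1.2 w.1.2, ((hf.isSubmersionAt z.1.1).equiv ((hf.isSubmersionAt z.1.1).domChart w.1.1)).2)
  invFun w := if hw : w ∈ coords (hf.isSubmersionAt z.1.1) g z.1.2 then ⟨point (hf.isSubmersionAt z.1.1) g z.1.2 w,
    point_mem _ hw⟩ else z
  source := {w | w.1.1 ∈ (hf.isSubmersionAt z.1.1).domChart.source ∧ w.1.2 ∈ (chartAt EN z.1.2).source}
  target := coords (hf.isSubmersionAt z.1.1) g z.1.2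
  map_source' := by
    rintro ⟨⟨m, n⟩, hmn⟩ ⟨hm, hn⟩
    simp only at hm hn hmn
    refine ⟨(chartAt EN z.1.2).map_source hn, ?_, ?_⟩
    · simpa [(chartAt EN z.1.2).left_inv hn, ← hmn] using
        (hf.isSubmersionAt z.1.1).source_subset_preimage_source hm
    · simp only [(chartAt EN z.1.2).left_inv hn, ← hmn, codChart_apply (hf.isSubmersionAt z.1.1) hm]
      simpa using (hf.isSubmersionAt z.1.1).domChart.map_source hm
  map_target' := by
    intro w hw
    simp only [hw, dif_pos]
    exact ⟨(hf.isSubmersionAt z.1.1).domChart.map_target hw.2.2, (chartAt EN z.1.2).map_target hw.1⟩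
  left_inv' := by
    rintro ⟨⟨m, n⟩, hmn⟩ ⟨hm, hn⟩
    simp only at hm hn hmn
    have key : point (hf.isSubmersionAt z.1.1) g z.1.2
        (chartAt EN z.1.2 n, ((hf.isSubmersionAt z.1.1).equiv ((hf.isSubmersionAt z.1.1).domChart m)).2) = (m, n) := by
      simp [point, (chartAt EN z.1.2).left_inv hn, ← hmn, codChart_apply (hf.isSubmersionAt z.1.1) hm,
        (hf.isSubmersionAt z.1.1).domChart.left_inv hm]
    rw [dif_pos]
    · exact Subtype.ext key
    · refine ⟨(chartAt EN z.1.2).map_source hn, ?_, ?_⟩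
      · simpa [(chartAt EN z.1.2).left_inv hn, ← hmn] using
          (hf.isSubmersionAt z.1.1).source_subset_preimage_source hm
      · simp only [(chartAt EN z.1.2).left_inv hn, ← hmn, codChart_apply (hf.isSubmersionAt z.1.1) hm]
        simpa using (hf.isSubmersionAt z.1.1).domChart.map_source hm
  right_inv' := by
    intro w hw
    simp only [hw, dif_pos]
    simp [point, (chartAt EN z.1.2).right_inv hw.1, (hf.isSubmersionAt z.1.1).domChart.right_inv hw.2.2]
  open_source := by
    refine IsOpen.inter ?_ ?_
    · exact (hf.isSubmersionAt z.1.1).domChart.open_source.preimage (by fun_prop)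
    · exact (chartAt EN z.1.2).open_source.preimage (by fun_prop)
  open_target := isOpen_coords _ hg _
  continuousOn_toFun := by
    refine ContinuousOn.prodMk ?_ ?_
    · exact (chartAt EN z.1.2).continuousOn.comp (by fun_prop) (fun w hw => hw.2)
    · refine continuous_snd.comp_continuousOn
        ((hf.isSubmersionAt z.1.1).equiv.continuous.comp_continuousOn ?_)
      exact (hf.isSubmersionAt z.1.1).domChart.continuousOn.comp (by fun_prop) (fun w hw => hw.1)
  continuousOn_invFun := by
    refine Topology.IsInducing.subtypeVal.continuousOn_iff.2 ?_
    refine (continuousOn_point (hf.isSubmersionAt z.1.1) hg z.1.2).congr ?_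
    intro w hw
    simp [hw]

end Chart

/-- The smooth structure of the fibre product of a submersion `f` and a smooth map `g`. -/
@[reducible] def chartedSpace (hf : IsSubmersion 𝓘(ℝ, EM) 𝓘(ℝ, EP) ∞ f)
    (hg : ContMDiff 𝓘(ℝ, EN) 𝓘(ℝ, EP) ∞ g) :
    ChartedSpace (EN × hf.complement) (FiberProduct f g) where
  atlas := range (chart hf.isSubmersionOfComplement_complement hg.continuous)
  chartAt := chart hf.isSubmersionOfComplement_complement hg.continuous
  mem_chart_source z := ⟨(hf.isSubmersionOfComplement_complement z.1.1).mem_domChart_source,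
    mem_chart_source EN z.1.2⟩
  chart_mem_atlas z := mem_range_self z

section Smooth
variable {F : Type*} [NormedAddCommGroup F] [NormedSpace ℝ F]

theorem contMDiffOn_point [IsManifold 𝓘(ℝ, EM) ∞ M] [IsManifold 𝓘(ℝ, EN) ∞ N]
    [IsManifold 𝓘(ℝ, EP) ∞ P] {x : M}
    (h : IsSubmersionAtOfComplement F 𝓘(ℝ, EM) 𝓘(ℝ, EP) ∞ f x)
    (hg : ContMDiff 𝓘(ℝ, EN) 𝓘(ℝ, EP) ∞ g) (n : N) :
    ContMDiffOn 𝓘(ℝ, EN × F) (𝓘(ℝ, EM).prod 𝓘(ℝ, EN)) ∞ (point (EN := EN) h g n) (coords h g n) := by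
  have c1 : ContMDiffOn 𝓘(ℝ, EN × F) 𝓘(ℝ, EN) ∞
      (fun w : EN × F => (chartAt EN n).symm w.1) (coords h g n) :=
    (contMDiffOn_symm_of_mem_maximalAtlas
      (IsManifold.chart_mem_maximalAtlas (I := 𝓘(ℝ, EN)) (n := ∞) n)).comp
      contDiff_fst.contMDiff.contMDiffOn (fun w hw => hw.1)
  have c2 : ContMDiffOn 𝓘(ℝ, EN × F) 𝓘(ℝ, EP) ∞
      (fun w : EN × F => h.codChart (g ((chartAt EN n).symm w.1))) (coords h g n) :=
    (contMDiffOn_of_mem_maximalAtlas h.codChart_mem_maximalAtlas).comp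
      (hg.comp_contMDiffOn c1) (fun w hw => hw.2.1)
  have c3 : ContMDiffOn 𝓘(ℝ, EN × F) 𝓘(ℝ, EM) ∞ (fun w : EN × F =>
      h.equiv.symm (h.codChart (g ((chartAt EN n).symm w.1)), w.2)) (coords h g n) := by
    have : ContMDiffOn 𝓘(ℝ, EN × F) 𝓘(ℝ, EP × F) ∞ (fun w : EN × F =>
      (h.codChart (g ((chartAt EN n).symm w.1)), w.2)) (coords h g n) :=
      c2.prodMk_space contDiff_snd.contMDiff.contMDiffOn
    exact h.equiv.symm.contDiff.contMDiff.comp_contMDiffOn this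
  exact ((contMDiffOn_symm_of_mem_maximalAtlas h.domChart_mem_maximalAtlas).comp c3
    (fun w hw => hw.2.2)).prodMk c1

variable {EW HW W : Type*} [NormedAddCommGroup EW] [NormedSpace ℝ EW] [TopologicalSpace HW]
  {IW : ModelWithCorners ℝ EW HW} [TopologicalSpace W] [ChartedSpace HW W]

theorem contMDiffOn_chart_comp [IsManifold 𝓘(ℝ, EM) ∞ M] [IsManifold 𝓘(ℝ, EN) ∞ N]
    (hf : IsSubmersionOfComplement F 𝓘(ℝ, EM) 𝓘(ℝ, EP) ∞ f) (hg : Continuous g)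
    (z : FiberProduct f g) {u : W → FiberProduct f g} {s : Set W}
    (hu : ContMDiffOn IW (𝓘(ℝ, EM).prod 𝓘(ℝ, EN)) ∞ (fun w => (u w).1) s)
    (hs : MapsTo u s (chart (EN := EN) hf hg z).source) :
    ContMDiffOn IW 𝓘(ℝ, EN × F) ∞ (fun w => chart (EN := EN) hf hg z (u w)) s := by
  have c1 := (contMDiffOn_of_mem_maximalAtlas
      (IsManifold.chart_mem_maximalAtlas (I := 𝓘(ℝ, EN)) (n := ∞) z.1.2)).comp
      (contMDiff_snd.comp_contMDiffOn hu) (fun w hw => (hs hw).2)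
  have c2 := (contMDiffOn_of_mem_maximalAtlas (hf.isSubmersionAt z.1.1).domChart_mem_maximalAtlas).comp
      (contMDiff_fst.comp_contMDiffOn hu) (fun w hw => (hs hw).1)
  have c3 := (contDiff_snd.comp (hf.isSubmersionAt z.1.1).equiv.contDiff (n := ∞)).contMDiff.comp_contMDiffOn c2
  exact c1.prodMk_space c3

theorem contMDiffOn_chart_symm [IsManifold 𝓘(ℝ, EM) ∞ M] [IsManifold 𝓘(ℝ, EN) ∞ N]
    [IsManifold 𝓘(ℝ, EP) ∞ P]
    (hf : IsSubmersionOfComplement F 𝓘(ℝ, EM) 𝓘(ℝ, EP) ∞ f)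
    (hg : ContMDiff 𝓘(ℝ, EN) 𝓘(ℝ, EP) ∞ g) (z : FiberProduct f g) :
    ContMDiffOn 𝓘(ℝ, EN × F) (𝓘(ℝ, EM).prod 𝓘(ℝ, EN)) ∞
      (fun w => ((chart (EN := EN) hf hg.continuous z).symm w).1)
      (chart (EN := EN) hf hg.continuous z).target := by
  refine (contMDiffOn_point (hf.isSubmersionAt z.1.1) hg z.1.2).congr ?_
  intro w hw
  exact congrArg Subtype.val (dif_pos (show w ∈ coords (hf.isSubmersionAt z.1.1) g z.1.2 from hw))

end Smooth

/-- The fibre product is a smooth manifold. -/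
theorem isManifold [IsManifold 𝓘(ℝ, EM) ∞ M] [IsManifold 𝓘(ℝ, EN) ∞ N]
    [IsManifold 𝓘(ℝ, EP) ∞ P] (hf : IsSubmersion 𝓘(ℝ, EM) 𝓘(ℝ, EP) ∞ f)
    (hg : ContMDiff 𝓘(ℝ, EN) 𝓘(ℝ, EP) ∞ g) :
    letI := chartedSpace hf hg
    IsManifold 𝓘(ℝ, EN × hf.complement) ∞ (FiberProduct f g) := by
  let _ := chartedSpace hf hg
  refine isManifold_of_contDiffOn _ _ _ ?_
  rintro _ _ ⟨z, rfl⟩ ⟨z', rfl⟩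
  rw [← contMDiffOn_iff_contDiffOn]
  have h1 := contMDiffOn_chart_symm hf.isSubmersionOfComplement_complement hg z
  have := contMDiffOn_chart_comp hf.isSubmersionOfComplement_complement hg.continuous z'
    (h1.mono (inter_subset_left (t :=
      (chart (EN := EN) hf.isSubmersionOfComplement_complement hg.continuous z).symm ⁻¹'
      (chart (EN := EN) hf.isSubmersionOfComplement_complement hg.continuous z').source)))
    (fun w hw => hw.2)
  refine this.mono ?_
  intro w hw
  simpa using hw

/-- The universal property, which characterizes the smooth structure: a map into the fibre product
is smooth exactly when it is smooth as a map into `M × N`. -/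
theorem contMDiff_iff [IsManifold 𝓘(ℝ, EM) ∞ M] [IsManifold 𝓘(ℝ, EN) ∞ N]
    [IsManifold 𝓘(ℝ, EP) ∞ P] (hf : IsSubmersion 𝓘(ℝ, EM) 𝓘(ℝ, EP) ∞ f)
    (hg : ContMDiff 𝓘(ℝ, EN) 𝓘(ℝ, EP) ∞ g)
    {EW HW W : Type*} [NormedAddCommGroup EW] [NormedSpace ℝ EW] [TopologicalSpace HW]
    {IW : ModelWithCorners ℝ EW HW} [TopologicalSpace W] [ChartedSpace HW W]
    (u : W → FiberProduct f g) :
    letI := chartedSpace hf hg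
    ContMDiff IW 𝓘(ℝ, EN × hf.complement) ∞ u ↔
      ContMDiff IW (𝓘(ℝ, EM).prod 𝓘(ℝ, EN)) ∞ (fun w => (u w).1) := by
  let _ := chartedSpace hf hg
  have := isManifold hf hg
  constructor
  · intro hu
    have hval : ContMDiff 𝓘(ℝ, EN × hf.complement) (𝓘(ℝ, EM).prod 𝓘(ℝ, EN)) ∞
        (Subtype.val : FiberProduct f g → M × N) := by
      intro z
      have h1 := contMDiffOn_chart_symm hf.isSubmersionOfComplement_complement hg z
      have h2 := contMDiffOn_of_mem_maximalAtlas
        (IsManifold.chart_mem_maximalAtlas (I := 𝓘(ℝ, EN × hf.complement)) (n := ∞) z)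
      have h3 := h1.comp h2 (fun w hw => (chartAt (EN × hf.complement) z).map_source hw)
      refine (h3.congr ?_).contMDiffAt
        ((chartAt (EN × hf.complement) z).open_source.mem_nhds (mem_chart_source _ z))
      intro w hw
      exact congrArg Subtype.val ((chartAt (EN × hf.complement) z).left_inv hw).symm
    exact hval.comp hu
  · intro hu
    have hcont : Continuous u := continuous_induced_rng.2 hu.continuous
    intro w
    let c := chartAt (EN × hf.complement) (u w)
    have ho : IsOpen (u ⁻¹' c.source) := c.open_source.preimage hcont
    have h1 : ContMDiffOn IW 𝓘(ℝ, EN × hf.complement) ∞ (fun w => c (u w)) (u ⁻¹' c.source) :=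
      contMDiffOn_chart_comp hf.isSubmersionOfComplement_complement hg.continuous (u w)
        hu.contMDiffOn (fun _ h => h)
    have h2 := (contMDiffOn_symm_of_mem_maximalAtlas
      (IsManifold.chart_mem_maximalAtlas (I := 𝓘(ℝ, EN × hf.complement)) (n := ∞) (u w))).comp h1
      (fun w hw => c.map_source hw)
    refine (h2.congr ?_).contMDiffAt (ho.mem_nhds (mem_chart_source (EN × hf.complement) (u w)))
    intro w' hw'
    exact (c.left_inv hw').symm

end FiberProduct

/-- A (small) groupoid with set of objects `P` and set of arrows `G`. The product `mul g h`, written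
`gh`, is defined when the target of `g` is the source of `h`. -/
structure ArrowGroupoid (P G : Type*) where
  src : G → P
  tgt : G → P
  one : P → G
  inv : G → G
  mul : ∀ g h : G, tgt g = src h → G
  src_one : ∀ p, src (one p) = p
  tgt_one : ∀ p, tgt (one p) = p
  src_inv : ∀ g, src (inv g) = tgt g
  tgt_inv : ∀ g, tgt (inv g) = src g
  src_mul : ∀ g h e, src (mul g h e) = src g
  tgt_mul : ∀ g h e, tgt (mul g h e) = tgt h
  one_mul : ∀ g, mul (one (src g)) g (tgt_one _) = g
  mul_one : ∀ g, mul g (one (tgt g)) (src_one _).symm = g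
  mul_assoc : ∀ g h k (e : tgt g = src h) (e' : tgt h = src k),
    mul (mul g h e) k ((tgt_mul g h e).trans e') = mul g (mul h k e') (e.trans (src_mul h k e').symm)
  inv_mul : ∀ g, mul (inv g) g (tgt_inv g) = one (tgt g)
  mul_inv : ∀ g, mul g (inv g) (src_inv g).symm = one (src g)

namespace ArrowGroupoid

open Manifold

theorem mul_congr {P G : Type*} (𝒢 : ArrowGroupoid P G) {g g' h h' : G} (hg : g = g') (hh : h = h')
    (e : 𝒢.tgt g = 𝒢.src h) (e' : 𝒢.tgt g' = 𝒢.src h') : 𝒢.mul g h e = 𝒢.mul g' h' e' := by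
  subst hg hh; rfl

theorem one_mul' {P G : Type*} (𝒢 : ArrowGroupoid P G) (p : P) (g : G)
    (e : 𝒢.tgt (𝒢.one p) = 𝒢.src g) : 𝒢.mul (𝒢.one p) g e = g := by
  obtain rfl : p = 𝒢.src g := (𝒢.tgt_one p).symm.trans e
  exact 𝒢.one_mul g

theorem mul_one' {P G : Type*} (𝒢 : ArrowGroupoid P G) (p : P) (g : G)
    (e : 𝒢.tgt g = 𝒢.src (𝒢.one p)) : 𝒢.mul g (𝒢.one p) e = g := by
  obtain rfl : 𝒢.tgt g = p := e.trans (𝒢.src_one p)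
  exact 𝒢.mul_one g

theorem eq_inv_of_mul_eq_one {P G : Type*} (𝒢 : ArrowGroupoid P G) {g h : G} {p : P}
    (e : 𝒢.tgt g = 𝒢.src h) (hgh : 𝒢.mul g h e = 𝒢.one p) : g = 𝒢.inv h := by
  have h1 : 𝒢.mul (𝒢.mul g h e) (𝒢.inv h) ((𝒢.tgt_mul g h e).trans (𝒢.src_inv h).symm) = g := by
    rw [𝒢.mul_assoc g h (𝒢.inv h) e (𝒢.src_inv h).symm,
      𝒢.mul_congr rfl (𝒢.mul_inv h) _ (e.trans (𝒢.src_one _).symm), 𝒢.mul_one']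
  rw [← h1, 𝒢.mul_congr hgh rfl _ (by rw [← hgh, 𝒢.tgt_mul, 𝒢.src_inv]), 𝒢.one_mul']

theorem inv_one {P G : Type*} (𝒢 : ArrowGroupoid P G) (p : P) : 𝒢.inv (𝒢.one p) = 𝒢.one p :=
  (𝒢.eq_inv_of_mul_eq_one (by rw [𝒢.tgt_one, 𝒢.src_one]) (𝒢.one_mul' p _ _)).symm

/-- `𝒢` is a Lie groupoid, for manifolds `P` and `G` modelled on `EP` and `EG`: source and target are surjective submersions and the other structure
maps are smooth, the product being defined on the manifold of composable pairs. -/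
structure IsLie {P G : Type*} (𝒢 : ArrowGroupoid P G) (EP EG : Type*)
    [NormedAddCommGroup EP] [NormedSpace ℝ EP] [NormedAddCommGroup EG] [NormedSpace ℝ EG]
    [TopologicalSpace P] [ChartedSpace EP P] [TopologicalSpace G] [ChartedSpace EG G] :
    Prop where
  src_surjective : Function.Surjective 𝒢.src
  src_submersion : IsSubmersion 𝓘(ℝ, EG) 𝓘(ℝ, EP) ∞ 𝒢.src
  tgt_surjective : Function.Surjective 𝒢.tgt
  tgt_submersion : IsSubmersion 𝓘(ℝ, EG) 𝓘(ℝ, EP) ∞ 𝒢.tgt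
  one_smooth : ContMDiff 𝓘(ℝ, EP) 𝓘(ℝ, EG) ∞ 𝒢.one
  inv_smooth : ContMDiff 𝓘(ℝ, EG) 𝓘(ℝ, EG) ∞ 𝒢.inv
  mul_smooth :
    letI := FiberProduct.chartedSpace tgt_submersion src_submersion.contMDiff
    ContMDiff 𝓘(ℝ, EG × tgt_submersion.complement) 𝓘(ℝ, EG) ∞
      (fun z : FiberProduct 𝒢.tgt 𝒢.src => 𝒢.mul z.1.1 z.1.2 z.2)

open CategoryTheory in
/-- The groupoid over `P` whose arrows from `p` to `q` are the arrows from `o p` to `o q` in a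
groupoid `C` in the categorical sense. -/
def ofGroupoid {C P : Type*} [Groupoid C] (o : P → C) :
    ArrowGroupoid P (Σ p q : P, o p ⟶ o q) where
  src g := g.1
  tgt g := g.2.1
  one p := ⟨p, p, 𝟙 _⟩
  inv g := ⟨g.2.1, g.1, Groupoid.inv g.2.2⟩
  mul g h e := ⟨g.1, h.2.1, g.2.2 ≫ eqToHom (congrArg o e) ≫ h.2.2⟩
  src_one _ := rfl
  tgt_one _ := rfl
  src_inv _ := rfl
  tgt_inv _ := rfl
  src_mul _ _ _ := rfl
  tgt_mul _ _ _ := rfl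
  one_mul := by rintro ⟨p, q, g⟩; simp
  mul_one := by rintro ⟨p, q, g⟩; simp
  mul_assoc := by
    rintro ⟨p, q, g⟩ ⟨p', q', h⟩ ⟨p'', q'', k⟩ e e'
    simp
  inv_mul := by rintro ⟨p, q, g⟩; simp
  mul_inv := by rintro ⟨p, q, g⟩; simp

end ArrowGroupoid

/-- A double groupoid with boxes `B`, vertical groupoid `𝒱` (arrows `V`), horizontal groupoid `ℋ`
(arrows `H`), both over `P`. The source and target of `vert` are the top and bottom vertex of a
vertical arrow; those of `horiz` are the left and right vertex of a horizontal arrow. The groupoid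
`boxH` over `V` has the left and right side of a box as source and target, its product is the
horizontal one; the groupoid `boxV` over `H` has the top and bottom side as source and target, its
product is the vertical one. The axioms say that the structure maps of each of the two groupoid
structures on boxes are morphisms for the other one. -/
structure DoubleGroupoid (P V H B : Type*) where
  vert : ArrowGroupoid P V
  horiz : ArrowGroupoid P H
  boxH : ArrowGroupoid V B
  boxV : ArrowGroupoid H B
  /-- the four corners of a box -/
  top_left : ∀ A, vert.src (boxH.src A) = horiz.src (boxV.src A)
  bot_left : ∀ A, vert.tgt (boxH.src A) = horiz.src (boxV.tgt A)
  top_right : ∀ A, vert.src (boxH.tgt A) = horiz.tgt (boxV.src A)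
  bot_right : ∀ A, vert.tgt (boxH.tgt A) = horiz.tgt (boxV.tgt A)
  /-- left and right sides are morphisms from the vertical structure to `𝒱` -/
  left_one : ∀ x, boxH.src (boxV.one x) = vert.one (horiz.src x)
  right_one : ∀ x, boxH.tgt (boxV.one x) = vert.one (horiz.tgt x)
  left_mul : ∀ A C (e : boxV.tgt A = boxV.src C), boxH.src (boxV.mul A C e) =
    vert.mul (boxH.src A) (boxH.src C) (by rw [bot_left, e, top_left])
  right_mul : ∀ A C (e : boxV.tgt A = boxV.src C), boxH.tgt (boxV.mul A C e) =
    vert.mul (boxH.tgt A) (boxH.tgt C) (by rw [bot_right, e, top_right])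
  /-- top and bottom sides are morphisms from the horizontal structure to `ℋ` -/
  top_one : ∀ f, boxV.src (boxH.one f) = horiz.one (vert.src f)
  bot_one : ∀ f, boxV.tgt (boxH.one f) = horiz.one (vert.tgt f)
  top_mul : ∀ A C (e : boxH.tgt A = boxH.src C), boxV.src (boxH.mul A C e) =
    horiz.mul (boxV.src A) (boxV.src C) (by rw [← top_right, e, top_left])
  bot_mul : ∀ A C (e : boxH.tgt A = boxH.src C), boxV.tgt (boxH.mul A C e) =
    horiz.mul (boxV.tgt A) (boxV.tgt C) (by rw [← bot_right, e, bot_left])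
  /-- the identity maps are morphisms -/
  one_one : ∀ p, boxH.one (vert.one p) = boxV.one (horiz.one p)
  boxH_one_mul : ∀ f g (e : vert.tgt f = vert.src g), boxH.one (vert.mul f g e) =
    boxV.mul (boxH.one f) (boxH.one g) (by rw [bot_one, top_one, e])
  boxV_one_mul : ∀ x y (e : horiz.tgt x = horiz.src y), boxV.one (horiz.mul x y e) =
    boxH.mul (boxV.one x) (boxV.one y) (by rw [left_one, right_one, e])
  /-- the products are morphisms: the interchange law for `A A'` on top of `C C'` -/
  interchange : ∀ A A' C C' (e : boxH.tgt A = boxH.src A') (e' : boxH.tgt C = boxH.src C')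
    (d : boxV.tgt A = boxV.src C) (d' : boxV.tgt A' = boxV.src C'),
    boxV.mul (boxH.mul A A' e) (boxH.mul C C' e')
        (by rw [bot_mul, top_mul]; exact horiz.mul_congr d d' _ _) =
      boxH.mul (boxV.mul A C d) (boxV.mul A' C' d')
        (by rw [left_mul, right_mul]; exact vert.mul_congr e e' _ _)

namespace DoubleGroupoid

open Manifold

variable {P V H B : Type*} (D : DoubleGroupoid P V H B)

/-- The top side `t(A)`. -/
abbrev top (A : B) : H := D.boxV.src A
/-- The bottom side `b(A)`. -/
abbrev bot (A : B) : H := D.boxV.tgt A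
/-- The left side `l(A)`. -/
abbrev left (A : B) : V := D.boxH.src A
/-- The right side `r(A)`. -/
abbrev right (A : B) : V := D.boxH.tgt A

/-- A double groupoid is slim if a box is determined by its four sides. -/
def IsSlim : Prop :=
  Function.Injective fun A => (D.top A, D.bot A, D.left A, D.right A)

/-- The double source map `A ↦ (t(A), l(A))` into `ℋ ×_{l,t} 𝒱`. -/
def doubleSource (A : B) : FiberProduct D.horiz.src D.vert.src :=
  ⟨(D.top A, D.left A), (D.top_left A).symm⟩

/-- `D` is a double Lie groupoid: the four groupoids are Lie groupoids and the double source map is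
a surjective submersion. -/
structure IsLie (EP EV EH EB : Type*) [NormedAddCommGroup EP] [NormedSpace ℝ EP]
    [NormedAddCommGroup EV] [NormedSpace ℝ EV] [NormedAddCommGroup EH] [NormedSpace ℝ EH]
    [NormedAddCommGroup EB] [NormedSpace ℝ EB]
    [TopologicalSpace P] [ChartedSpace EP P] [TopologicalSpace V] [ChartedSpace EV V]
    [TopologicalSpace H] [ChartedSpace EH H] [TopologicalSpace B] [ChartedSpace EB B] :
    Prop where
  vert_lie : D.vert.IsLie EP EV
  horiz_lie : D.horiz.IsLie EP EH
  boxH_lie : D.boxH.IsLie EV EB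
  boxV_lie : D.boxV.IsLie EH EB
  doubleSource_surjective : Function.Surjective D.doubleSource
  doubleSource_submersion :
    letI := FiberProduct.chartedSpace horiz_lie.src_submersion vert_lie.src_submersion.contMDiff
    IsSubmersion 𝓘(ℝ, EB) 𝓘(ℝ, EV × horiz_lie.src_submersion.complement) ∞ D.doubleSource

/-! ### The core groupoid and the core action -/

/-- The core `𝐄(B)`: the boxes whose top and right sides are identities. -/
def Core : Set B :=
  {E | (∃ p, D.top E = D.horiz.one p) ∧ ∃ q, D.right E = D.vert.one q}

/-- The source of a core element: the bottom left vertex. -/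
def coreSrc (E : D.Core) : P := D.vert.tgt (D.left E)

/-- The target of a core element: the top right vertex. -/
def coreTgt (E : D.Core) : P := D.vert.src (D.right E)

variable {D}

theorem top_core (E : D.Core) : D.top E = D.horiz.one (D.coreTgt E) := by
  obtain ⟨p, hp⟩ := E.2.1
  have : D.coreTgt E = p := by rw [coreTgt, top_right, ← top, hp, D.horiz.tgt_one]
  rw [this, hp]

theorem right_core (E : D.Core) : D.right E = D.vert.one (D.coreTgt E) := by
  obtain ⟨q, hq⟩ := E.2.2
  have : D.coreTgt E = q := by rw [coreTgt, hq, D.vert.src_one]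
  rw [this, hq]

theorem src_left_core (E : D.Core) : D.vert.src (D.left E) = D.coreTgt E := by
  rw [top_left, ← top, top_core, D.horiz.src_one]

theorem tgt_bot_core (E : D.Core) : D.horiz.tgt (D.bot E) = D.coreTgt E := by
  rw [← bot_right, ← right, right_core, D.vert.tgt_one]

theorem src_bot_core (E : D.Core) : D.horiz.src (D.bot E) = D.coreSrc E := by
  rw [← bot_left, coreSrc]

theorem left_inv (A : B) : D.left (D.boxV.inv A) = D.vert.inv (D.left A) := by
  refine D.vert.eq_inv_of_mul_eq_one (p := D.horiz.src (D.bot A)) ?_ ?_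
  · rw [bot_left, D.boxV.tgt_inv, top_left]
  · rw [← D.left_mul _ _ (D.boxV.tgt_inv A), D.boxV.inv_mul, left_one]

theorem right_inv (A : B) : D.right (D.boxV.inv A) = D.vert.inv (D.right A) := by
  refine D.vert.eq_inv_of_mul_eq_one (p := D.horiz.tgt (D.bot A)) ?_ ?_
  · rw [bot_right, D.boxV.tgt_inv, top_right]
  · rw [← D.right_mul _ _ (D.boxV.tgt_inv A), D.boxV.inv_mul, right_one]

variable (D)

/-- The identity `Θ_p` of the core groupoid. -/
def coreOne (p : P) : D.Core :=
  ⟨D.boxH.one (D.vert.one p), ⟨p, by rw [top, top_one, D.vert.src_one]⟩,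
    ⟨p, by rw [right, D.boxH.tgt_one]⟩⟩

theorem left_coreOne (p : P) : D.left (D.coreOne p) = D.vert.one p := D.boxH.src_one _

theorem bot_coreOne (p : P) : D.bot (D.coreOne p) = D.horiz.one p := by
  rw [bot, coreOne, D.bot_one, D.vert.tgt_one]

theorem coreTgt_coreOne (p : P) : D.coreTgt (D.coreOne p) = p := by
  rw [← src_left_core, left_coreOne, D.vert.src_one]

/-- The upper half of the product `E ∘ F`: the horizontal product of the identity box on `l(F)`
and `F`. -/
def coreMulTop (F : D.Core) : B := D.boxH.mul (D.boxH.one (D.left F)) F (D.boxH.tgt_one _)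

/-- The lower half of the product `E ∘ F`: the horizontal product of `E` and the identity box on
`b(F)`. -/
def coreMulBot (E F : D.Core) (e : D.coreTgt E = D.coreSrc F) : B :=
  D.boxH.mul E (D.boxV.one (D.bot F))
    (by rw [← right, right_core, D.left_one, src_bot_core, e])

theorem coreMul_aux (E F : D.Core) (e : D.coreTgt E = D.coreSrc F) :
    D.bot (D.coreMulTop F) = D.top (D.coreMulBot E F e) := by
  rw [bot, coreMulTop, D.bot_mul, top, coreMulBot, D.top_mul]
  refine D.horiz.mul_congr ?_ ?_ _ _
  · rw [D.bot_one, ← top, top_core, e, coreSrc]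
  · rw [D.boxV.src_one]

/-- The product `E ∘ F` of the core groupoid. -/
def coreMul (E F : D.Core) (e : D.coreTgt E = D.coreSrc F) : D.Core :=
  ⟨D.boxV.mul (D.coreMulTop F) (D.coreMulBot E F e) (D.coreMul_aux E F e), by
    refine ⟨D.coreTgt F, ?_⟩
    rw [top, D.boxV.src_mul, coreMulTop, D.top_mul, ← top_core F,
      D.horiz.mul_congr (D.top_one _) rfl _ (by rw [D.horiz.tgt_one, D.top_left]),
      D.horiz.one_mul'], by
    refine ⟨D.coreTgt F, ?_⟩
    have h1 : D.right (D.coreMulTop F) = D.vert.one (D.coreTgt F) := by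
      rw [coreMulTop, right, D.boxH.tgt_mul, ← right, right_core]
    have h2 : D.right (D.coreMulBot E F e) = D.vert.one (D.coreTgt F) := by
      rw [coreMulBot, right, D.boxH.tgt_mul, D.right_one, tgt_bot_core]
    rw [right, D.right_mul, D.vert.mul_congr h1 h2 _ (by rw [D.vert.tgt_one, D.vert.src_one]),
      D.vert.one_mul']⟩

theorem left_coreMul (E F : D.Core) (e : D.coreTgt E = D.coreSrc F) :
    D.left (D.coreMul E F e) = D.vert.mul (D.left F) (D.left E)
      (by rw [src_left_core, e, coreSrc]) := by
  rw [left, coreMul, D.left_mul]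
  refine D.vert.mul_congr ?_ ?_ _ _
  · rw [coreMulTop, D.boxH.src_mul, D.boxH.src_one]
  · rw [coreMulBot, D.boxH.src_mul]

theorem bot_coreMul (E F : D.Core) (e : D.coreTgt E = D.coreSrc F) :
    D.bot (D.coreMul E F e) = D.horiz.mul (D.bot E) (D.bot F)
      (by rw [tgt_bot_core, e, src_bot_core]) := by
  rw [bot, coreMul, D.boxV.tgt_mul, coreMulBot, D.bot_mul]
  exact D.horiz.mul_congr rfl (D.boxV.tgt_one _) _ _

theorem coreTgt_coreMul (E F : D.Core) (e : D.coreTgt E = D.coreSrc F) :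
    D.coreTgt (D.coreMul E F e) = D.coreTgt F := by
  rw [← src_left_core, left_coreMul, D.vert.src_mul, src_left_core]

/-- The horizontal product of `E` and the identity box on `b(E)⁻¹`. -/
def coreInvAux (E : D.Core) : B :=
  D.boxH.mul E (D.boxV.one (D.horiz.inv (D.bot E)))
    (by rw [← right, right_core, D.left_one, D.horiz.src_inv, tgt_bot_core])

/-- The inverse of `E` in the core groupoid: the vertical inverse of the horizontal product of `E`
and the identity box on `b(E)⁻¹`. -/
def coreInv (E : D.Core) : D.Core :=
  ⟨D.boxV.inv (D.coreInvAux E), by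
    refine ⟨D.coreSrc E, ?_⟩
    rw [top, D.boxV.src_inv, coreInvAux, D.bot_mul,
      D.horiz.mul_congr rfl (D.boxV.tgt_one _) _ (D.horiz.src_inv _).symm, D.horiz.mul_inv,
      src_bot_core], by
    refine ⟨D.coreSrc E, ?_⟩
    rw [right_inv, coreInvAux, right, D.boxH.tgt_mul, D.right_one, D.horiz.tgt_inv, src_bot_core,
      D.vert.inv_one]⟩

theorem left_coreInv (E : D.Core) : D.left (D.coreInv E) = D.vert.inv (D.left E) := by
  rw [coreInv, left_inv, coreInvAux, left, D.boxH.src_mul]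

theorem bot_coreInv (E : D.Core) : D.bot (D.coreInv E) = D.horiz.inv (D.bot E) := by
  rw [coreInv, bot, D.boxV.tgt_inv, coreInvAux, D.top_mul,
    D.horiz.mul_congr (top_core E) (D.boxV.src_one _) _
      (by rw [D.horiz.tgt_one, D.horiz.src_inv, tgt_bot_core]), D.horiz.one_mul']

theorem coreTgt_coreInv (E : D.Core) : D.coreTgt (D.coreInv E) = D.coreSrc E := by
  rw [← src_left_core, left_coreInv, D.vert.src_inv, coreSrc]

/-- The fibre product `𝒱 ×_{b,l} ℋ` of pairs `(f, x)` with `b(f) = l(x)`. -/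
abbrev CornerSpace : Type _ := FiberProduct D.vert.tgt D.horiz.src

/-- The map `η(f, x) = b(f) = l(x)` along which the core groupoid acts. -/
def moment (z : D.CornerSpace) : P := D.vert.tgt z.1.1

/-- The core action `E ▷ (f, x) = (f l(E), b(E) x)`, defined when `η(f, x)` is the target of `E`. -/
def coreAct (E : D.Core) (z : D.CornerSpace) (e : D.coreTgt E = D.moment z) : D.CornerSpace :=
  ⟨(D.vert.mul z.1.1 (D.left E) (by rw [src_left_core, e, moment]),
    D.horiz.mul (D.bot E) z.1.2 (by rw [tgt_bot_core, e, moment, z.2])),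
    by rw [D.vert.tgt_mul, D.horiz.src_mul, D.bot_left]⟩

/-- The anchor map of the action groupoid `𝐄(B) ⋉ (𝒱 ×_{b,l} ℋ)`: an arrow `(E, z)` has source
`E ▷ z` and target `z`. -/
def coreAnchor (a : FiberProduct D.coreTgt D.moment) : D.CornerSpace × D.CornerSpace :=
  (D.coreAct a.1.1 a.1.2 a.2, a.1.2)

/-- The core action is proper: the anchor map of its action groupoid is a proper map. -/
def IsCoreProper [TopologicalSpace V] [TopologicalSpace H] [TopologicalSpace B] : Prop :=
  IsProperMap D.coreAnchor

theorem moment_coreAct (E : D.Core) (z : D.CornerSpace) (e : D.coreTgt E = D.moment z) :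
    D.moment (D.coreAct E z e) = D.coreSrc E := D.vert.tgt_mul _ _ _

/-- Two points are related if they lie in the same orbit of the core action. -/
def coreOrbit : Setoid D.CornerSpace where
  r w z := ∃ (E : D.Core) (e : D.coreTgt E = D.moment z), w = D.coreAct E z e
  iseqv := by
    refine ⟨fun z => ⟨D.coreOne (D.moment z), D.coreTgt_coreOne _, ?_⟩, ?_, ?_⟩
    · refine Subtype.ext (Prod.ext ?_ ?_)
      · exact ((D.vert.mul_congr rfl (D.left_coreOne _) _ (D.vert.src_one _).symm).trans
          (D.vert.mul_one' _ _ _)).symm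
      · exact ((D.horiz.mul_congr (D.bot_coreOne _) rfl _ ((D.horiz.tgt_one _).trans z.2)).trans
          (D.horiz.one_mul' _ _ _)).symm
    · rintro w z ⟨E, e, rfl⟩
      refine ⟨D.coreInv E, (D.coreTgt_coreInv E).trans (D.moment_coreAct E z e).symm, ?_⟩
      refine Subtype.ext (Prod.ext ?_ ?_)
      · simp only [coreAct]
        rw [D.vert.mul_congr rfl (D.left_coreInv E) _
          (by rw [D.vert.tgt_mul, D.vert.src_inv]), D.vert.mul_assoc _ _ _ _ (D.vert.src_inv _).symm,
          D.vert.mul_congr rfl (D.vert.mul_inv _) _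
            (by rw [D.vert.src_one, src_left_core, e, moment]), D.vert.mul_one']
      · simp only [coreAct]
        rw [D.horiz.mul_congr (D.bot_coreInv E) rfl _
          (by rw [D.horiz.src_mul, D.horiz.tgt_inv]), ← D.horiz.mul_assoc _ _ _ (D.horiz.tgt_inv _)
            (by rw [tgt_bot_core, e, moment, z.2]),
          D.horiz.mul_congr (D.horiz.inv_mul _) rfl _
            (by rw [D.horiz.tgt_one, tgt_bot_core, e, moment, z.2]), D.horiz.one_mul']
    · rintro w z u ⟨E, e, rfl⟩ ⟨F, e', rfl⟩
      have hEF : D.coreTgt E = D.coreSrc F := e.trans (D.moment_coreAct F u e')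
      refine ⟨D.coreMul E F hEF, (D.coreTgt_coreMul E F hEF).trans e', ?_⟩
      refine Subtype.ext (Prod.ext ?_ ?_)
      · simp only [coreAct]
        rw [D.vert.mul_assoc _ _ _ (by rw [src_left_core, e', moment])
          (by rw [src_left_core, hEF, coreSrc])]
        exact D.vert.mul_congr rfl (D.left_coreMul E F hEF).symm _ _
      · simp only [coreAct]
        rw [← D.horiz.mul_assoc _ _ _ (by rw [tgt_bot_core, hEF, src_bot_core])
          (by rw [tgt_bot_core, e', moment, u.2])]
        exact D.horiz.mul_congr (D.bot_coreMul E F hEF).symm rfl _ _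

/-- The quotient `(𝒱 ×_{b,l} ℋ) / 𝐄(B)` of the core action (with the quotient topology). -/
abbrev CoreQuotient : Type _ := Quotient D.coreOrbit

end DoubleGroupoid

/-! ### The free product of two groupoids over the same base -/

section FreeProduct

open CategoryTheory

variable {P V H : Type*}

/-- The set `P`, as the set of vertices of the quiver whose edges are the arrows of `𝒱` and of `ℋ`. -/
def FreeProductVertex (_𝒱 : ArrowGroupoid P V) (_ℋ : ArrowGroupoid P H) : Type _ := P

instance (𝒱 : ArrowGroupoid P V) (ℋ : ArrowGroupoid P H) :
    Quiver (FreeProductVertex 𝒱 ℋ) where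
  Hom p q := {f : V // 𝒱.src f = p ∧ 𝒱.tgt f = q} ⊕ {x : H // ℋ.src x = p ∧ ℋ.tgt x = q}

/-- The arrow of the free groupoid on the above quiver that is given by an arrow `f : p → q` of
`𝒱`. -/
def freeV (𝒱 : ArrowGroupoid P V) (ℋ : ArrowGroupoid P H) {p q : FreeProductVertex 𝒱 ℋ} (f : V)
    (hp : 𝒱.src f = p) (hq : 𝒱.tgt f = q) :
    (Quiver.FreeGroupoid.of (FreeProductVertex 𝒱 ℋ)).obj p ⟶
      (Quiver.FreeGroupoid.of (FreeProductVertex 𝒱 ℋ)).obj q :=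
  (Quiver.FreeGroupoid.of (FreeProductVertex 𝒱 ℋ)).map (Sum.inl ⟨f, hp, hq⟩)

/-- The arrow of the free groupoid on the above quiver that is given by an arrow `x : p → q` of
`ℋ`. -/
def freeH (𝒱 : ArrowGroupoid P V) (ℋ : ArrowGroupoid P H) {p q : FreeProductVertex 𝒱 ℋ} (x : H)
    (hp : ℋ.src x = p) (hq : ℋ.tgt x = q) :
    (Quiver.FreeGroupoid.of (FreeProductVertex 𝒱 ℋ)).obj p ⟶
      (Quiver.FreeGroupoid.of (FreeProductVertex 𝒱 ℋ)).obj q :=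
  (Quiver.FreeGroupoid.of (FreeProductVertex 𝒱 ℋ)).map (Sum.inr ⟨x, hp, hq⟩)

/-- The relations of the free product: products of composable arrows of `𝒱`, and of `ℋ`, are the
given ones. -/
inductive FreeProductRel (𝒱 : ArrowGroupoid P V) (ℋ : ArrowGroupoid P H) :
    HomRel (Quiver.FreeGroupoid (FreeProductVertex 𝒱 ℋ))
  | vert (f g : V) (e : 𝒱.tgt f = 𝒱.src g) : FreeProductRel 𝒱 ℋ
      (freeV 𝒱 ℋ f rfl e ≫ freeV 𝒱 ℋ g rfl rfl)
      (freeV 𝒱 ℋ (𝒱.mul f g e) (𝒱.src_mul f g e) (𝒱.tgt_mul f g e))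
  | horiz (x y : H) (e : ℋ.tgt x = ℋ.src y) : FreeProductRel 𝒱 ℋ
      (freeH 𝒱 ℋ x rfl e ≫ freeH 𝒱 ℋ y rfl rfl)
      (freeH 𝒱 ℋ (ℋ.mul x y e) (ℋ.src_mul x y e) (ℋ.tgt_mul x y e))

/-- The free product `𝒱 ⊛ ℋ` over `P` (a groupoid with the objects `P`): the free groupoid on the
arrows of `𝒱` and `ℋ`, modulo the relations that hold in `𝒱` and in `ℋ`. -/
abbrev FreeProduct (𝒱 : ArrowGroupoid P V) (ℋ : ArrowGroupoid P H) : Type _ :=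
  CategoryTheory.Quotient (FreeProductRel 𝒱 ℋ)

namespace FreeProduct

variable (𝒱 : ArrowGroupoid P V) (ℋ : ArrowGroupoid P H)

/-- The object of `𝒱 ⊛ ℋ` given by `p`. -/
def obj (p : P) : FreeProduct 𝒱 ℋ :=
  (CategoryTheory.Quotient.functor (FreeProductRel 𝒱 ℋ)).obj
    ((Quiver.FreeGroupoid.of (FreeProductVertex 𝒱 ℋ)).obj p)

/-- The inclusion of `𝒱` in the free product, on arrows `f : p → q`. -/
def inV {p q : P} (f : V) (hp : 𝒱.src f = p) (hq : 𝒱.tgt f = q) : obj 𝒱 ℋ p ⟶ obj 𝒱 ℋ q :=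
  (CategoryTheory.Quotient.functor (FreeProductRel 𝒱 ℋ)).map (freeV 𝒱 ℋ f hp hq)

/-- The inclusion of `ℋ` in the free product, on arrows `x : p → q`. -/
def inH {p q : P} (x : H) (hp : ℋ.src x = p) (hq : ℋ.tgt x = q) : obj 𝒱 ℋ p ⟶ obj 𝒱 ℋ q :=
  (CategoryTheory.Quotient.functor (FreeProductRel 𝒱 ℋ)).map (freeH 𝒱 ℋ x hp hq)

end FreeProduct

end FreeProduct

/-! ### The diagonal groupoid -/

namespace DoubleGroupoid

open CategoryTheory

variable {P V H B : Type*} (D : DoubleGroupoid P V H B)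

/-- The arrow `[A] = x g y⁻¹ h⁻¹` of `𝒱 ⊛ ℋ`, for a box `A` with top `x`, right side `g`, bottom `y`
and left side `h`. -/
def boundary (A : B) :
    FreeProduct.obj D.vert D.horiz (D.horiz.src (D.top A)) ⟶
      FreeProduct.obj D.vert D.horiz (D.horiz.src (D.top A)) :=
  FreeProduct.inH D.vert D.horiz (D.top A) rfl rfl ≫
    FreeProduct.inV D.vert D.horiz (D.right A) (D.top_right A) rfl ≫
    Groupoid.inv (FreeProduct.inH D.vert D.horiz (D.bot A) rfl (D.bot_right A).symm) ≫
    Groupoid.inv (FreeProduct.inV D.vert D.horiz (D.left A) (D.top_left A) (D.bot_left A))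

/-- The arrows of the form `[A]`. -/
inductive IsBoundary : ∀ {c d : FreeProduct D.vert D.horiz}, (c ⟶ d) → Prop
  | mk (A : B) : IsBoundary (D.boundary A)

/-- The subgroupoid `J` of `𝒱 ⊛ ℋ` generated by the arrows `[A]`. -/
def J : Subgroupoid (FreeProduct D.vert D.horiz) :=
  Subgroupoid.generated fun c d => {w : c ⟶ d | D.IsBoundary w}

/-- Parallel arrows `u`, `w` of `𝒱 ⊛ ℋ` are related if `u w⁻¹` belongs to `J`. -/
def modJ : HomRel (FreeProduct D.vert D.horiz) :=
  fun c _ u w => u ≫ Groupoid.inv w ∈ D.J.arrows c c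

/-- The arrows of the diagonal groupoid `(𝒱 ⊛ ℋ) / J`. -/
def Diag : Type _ :=
  Σ p q : P, (CategoryTheory.Quotient.functor D.modJ).obj (FreeProduct.obj D.vert D.horiz p) ⟶
    (CategoryTheory.Quotient.functor D.modJ).obj (FreeProduct.obj D.vert D.horiz q)

/-- The diagonal groupoid `𝒟(B) = (𝒱 ⊛ ℋ) / J` over `P`. -/
def diagonal : ArrowGroupoid P D.Diag :=
  ArrowGroupoid.ofGroupoid fun p =>
    (CategoryTheory.Quotient.functor D.modJ).obj (FreeProduct.obj D.vert D.horiz p)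

/-- The morphism `j : 𝒱 → 𝒟(B)`. -/
def diagV (f : V) : D.Diag :=
  ⟨D.vert.src f, D.vert.tgt f, (CategoryTheory.Quotient.functor D.modJ).map
    (FreeProduct.inV D.vert D.horiz f rfl rfl)⟩

/-- The morphism `i : ℋ → 𝒟(B)`. -/
def diagH (x : H) : D.Diag :=
  ⟨D.horiz.src x, D.horiz.tgt x, (CategoryTheory.Quotient.functor D.modJ).map
    (FreeProduct.inH D.vert D.horiz x rfl rfl)⟩

/-- The map `(f, x) ↦ j(f) i(x)` from `𝒱 ×_{b,l} ℋ` to `𝒟(B)`. -/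
def toDiag (z : D.CornerSpace) : D.Diag :=
  D.diagonal.mul (D.diagV z.1.1) (D.diagH z.1.2) z.2

end DoubleGroupoid

end

/-! As a set, the diagonal groupoid is the orbit space of the core action. A box with top x, right
side g, left side h and bottom y gives i(x) j(g) = j(h) i(y). Since the double source map is
surjective, horizontal inversion yields a box with any prescribed composable top and right side.
Vertical arrows can therefore be moved to the left through horizontal ones, and every arrow is some
j(f) i(x) (`toDiag_surjective`). Points of one core orbit give the same arrow because j(l(E))
i(b(E)) = 1. For the converse, 𝒱 and ℋ act from the right on the set of orbits, fibred over 𝒫 by the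
right vertex: ℋ by multiplication, 𝒱 by filling a corner, which is well defined on orbits
(`pushPoint_rel`). The boundaries [A] act trivially, so 𝒟(B) acts, and j(f) i(x) sends the identity
orbit at its source to the orbit of (f, x). The arrow thus determines the orbit
(`diagToQuot_toDiag`, `toDiag_eq_iff`).

For the smooth structure, 𝒟(B) gets the quotient topology, and the core action needs a slice at
every point (`IsLie.exists_slice`). The core is studied inside B instead of as a manifold of its
own: horizontal inversion identifies the core boxes with the preimage of a copy of 𝒫 under the
double source map, a submersion, which gives local coordinates α(p, c). Slimness makes the action
free, but a slice also needs the orbit maps to be immersive at the units. Suppose that the left and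
bottom sides of E_τ = α(p, τv) have zero velocity at τ = 0. Translating this path by core
multiplication gives a vector field on the core boxes with target p. Along its integral curve from
the unit the left and bottom sides are stationary, hence constant, so by slimness the curve is
constant and v = 0 (`IsLie.IsUnitChart.eq_zero_of_isStationaryAt`).

The inverse function theorem then provides a transversal to the orbits. Properness enters through
the closedness of the anchor map: it forces two nearby points of one orbit to differ by a core box
near a unit, so that the transversal meets each orbit locally once, and it makes the orbit relation
closed, so that the quotient is Hausdorff. `HasSlices` turns this into a manifold structure for
which the projection is a submersion.

Local sections of the projection give normal forms j(f) i(x) that depend smoothly on the arrow. As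
the boxes filling a corner can also be chosen smoothly, the structure maps are smooth. Source and
target are submersions because they have smooth local sections through every arrow
(`isSubmersion_of_localSections`). -/

open scoped Manifold ContDiff Topology

set_option linter.unusedSectionVars false

/-! ### Germs of smooth maps -/

section SmoothNear

open Filter

variable {E E' E'' E₃ : Type*} [NormedAddCommGroup E] [NormedSpace ℝ E]
  [NormedAddCommGroup E'] [NormedSpace ℝ E'] [NormedAddCommGroup E''] [NormedSpace ℝ E'']
  {H H' H'' : Type*} [TopologicalSpace H] [TopologicalSpace H'] [TopologicalSpace H'']
  {I : ModelWithCorners ℝ E H} {I' : ModelWithCorners ℝ E' H'} {I'' : ModelWithCorners ℝ E'' H''}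
  {M M' M'' : Type*} [TopologicalSpace M] [ChartedSpace H M] [TopologicalSpace M']
  [ChartedSpace H' M'] [TopologicalSpace M''] [ChartedSpace H'' M'']

variable (I I') in
/-- The map `f` is smooth at all points of a neighbourhood of `x`. -/
def SmoothNear (f : M → M') (x : M) : Prop := ∀ᶠ y in 𝓝 x, ContMDiffAt I I' ∞ f y

namespace SmoothNear

theorem contMDiffAt {f : M → M'} {x : M} (h : SmoothNear I I' f x) : ContMDiffAt I I' ∞ f x :=
  h.self_of_nhds

theorem continuousAt {f : M → M'} {x : M} (h : SmoothNear I I' f x) : ContinuousAt f x :=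
  h.contMDiffAt.continuousAt

theorem mdifferentiableAt {f : M → M'} {x : M} (h : SmoothNear I I' f x) :
    MDifferentiableAt I I' f x :=
  h.contMDiffAt.mdifferentiableAt (by simp)

/-- Smoothness at a single point lacks this property: for the exponent `∞` the neighbourhood may
shrink with the order of differentiation. -/
theorem eventually {f : M → M'} {x : M} (h : SmoothNear I I' f x) :
    ∀ᶠ y in 𝓝 x, SmoothNear I I' f y := eventually_eventually_nhds.2 h

theorem congr {f g : M → M'} {x : M} (h : SmoothNear I I' f x) (e : g =ᶠ[𝓝 x] f) :
    SmoothNear I I' g x := by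
  have e' : ∀ᶠ y in 𝓝 x, g =ᶠ[𝓝 y] f := eventually_eventually_nhds.2 e
  filter_upwards [h, e'] with y hy hy' using hy.congr_of_eventuallyEq hy'

theorem comp {f : M → M'} {g : M' → M''} {x : M} (hg : SmoothNear I' I'' g (f x))
    (hf : SmoothNear I I' f x) : SmoothNear I I'' (fun y => g (f y)) x := by
  filter_upwards [hf, hf.continuousAt.eventually hg] with y hy hy' using hy'.comp y hy

theorem comp_of_eq {f : M → M'} {g : M' → M''} {x : M} {y : M'} (hg : SmoothNear I' I'' g y)
    (hf : SmoothNear I I' f x) (e : f x = y) : SmoothNear I I'' (fun y => g (f y)) x :=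
  comp (e ▸ hg) hf

theorem prodMk {f : M → M'} {g : M → M''} {x : M} (hf : SmoothNear I I' f x)
    (hg : SmoothNear I I'' g x) : SmoothNear I (I'.prod I'') (fun y => (f y, g y)) x := by
  filter_upwards [hf, hg] with y h1 h2 using h1.prodMk h2

theorem prodMk_space {f : M → E'} {g : M → E''} {x : M} (hf : SmoothNear I 𝓘(ℝ, E') f x)
    (hg : SmoothNear I 𝓘(ℝ, E'') g x) : SmoothNear I 𝓘(ℝ, E' × E'') (fun y => (f y, g y)) x := by
  filter_upwards [hf, hg] with y h1 h2 using h1.prodMk_space h2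

theorem fst {f : M → M' × M''} {x : M} (hf : SmoothNear I (I'.prod I'') f x) :
    SmoothNear I I' (fun y => (f y).1) x := by
  filter_upwards [hf] with y h1 using contMDiff_fst.contMDiffAt.comp y h1

theorem snd {f : M → M' × M''} {x : M} (hf : SmoothNear I (I'.prod I'') f x) :
    SmoothNear I I'' (fun y => (f y).2) x := by
  filter_upwards [hf] with y h1 using contMDiff_snd.contMDiffAt.comp y h1

theorem contDiffAt {f : E → E'} {x : E} (hf : SmoothNear 𝓘(ℝ, E) 𝓘(ℝ, E') f x) :
    ContDiffAt ℝ ∞ f x := hf.contMDiffAt.contDiffAt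

end SmoothNear

theorem ContMDiff.smoothNear {f : M → M'} (h : ContMDiff I I' ∞ f) (x : M) :
    SmoothNear I I' f x := Eventually.of_forall h

theorem ContMDiffOn.smoothNear {f : M → M'} {s : Set M} (h : ContMDiffOn I I' ∞ f s)
    (hs : IsOpen s) {x : M} (hx : x ∈ s) :
    SmoothNear I I' f x :=
  eventually_of_mem (hs.mem_nhds hx) fun _ hy => h.contMDiffAt (hs.mem_nhds hy)

theorem smoothNear_const (c : M') (x : M) : SmoothNear I I' (fun _ : M => c) x :=
  contMDiff_const.smoothNear x

theorem smoothNear_id (x : M) : SmoothNear I I (fun y : M => y) x := contMDiff_id.smoothNear x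

theorem smoothNear_fst (x : M × M') : SmoothNear (I.prod I') I Prod.fst x :=
  contMDiff_fst.smoothNear x

theorem smoothNear_snd (x : M × M') : SmoothNear (I.prod I') I' Prod.snd x :=
  contMDiff_snd.smoothNear x

theorem ContDiff.smoothNear {f : E → E'} (h : ContDiff ℝ ∞ f) (x : E) :
    SmoothNear 𝓘(ℝ, E) 𝓘(ℝ, E') f x := h.contMDiff.smoothNear x

theorem smoothNear_chartAt [IsManifold I ∞ M] {x y : M} (h : y ∈ (chartAt H x).source) :
    SmoothNear I I (chartAt H x) y := contMDiffOn_chart.smoothNear (chartAt H x).open_source h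

theorem smoothNear_chartAt_symm [IsManifold I ∞ M] {x : M} {y : H} (h : y ∈ (chartAt H x).target) :
    SmoothNear I I (chartAt H x).symm y :=
  contMDiffOn_chart_symm.smoothNear (chartAt H x).open_target h

end SmoothNear

/-! ### The inverse function theorem and surjective linear maps -/

section InverseFunction

open Filter

variable {E E' : Type*} [NormedAddCommGroup E] [NormedSpace ℝ E] [CompleteSpace E]
  [NormedAddCommGroup E'] [NormedSpace ℝ E']

/-- The inverse function theorem for smooth maps: a map with invertible derivative at `a` is a
diffeomorphism between neighbourhoods of `a` and `f a`. -/
theorem exists_openPartialHomeomorph_of_hasFDerivAt {f : E → E'} {a : E}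
    (hf : SmoothNear 𝓘(ℝ, E) 𝓘(ℝ, E') f a) (f' : E ≃L[ℝ] E') (hf' : HasFDerivAt f (f' : E →L[ℝ] E') a) :
    ∃ e : OpenPartialHomeomorph E E', a ∈ e.source ∧ (⇑e = f) ∧
      ContDiffOn ℝ ∞ e e.source ∧ ContDiffOn ℝ ∞ e.symm e.target := by
  have hn : (∞ : WithTop ℕ∞) ≠ 0 := by simp
  let e0 := hf.contDiffAt.toOpenPartialHomeomorph f hf' hn
  have hcont : ContinuousAt (fderiv ℝ f) a :=
    (hf.contDiffAt.fderiv_right (m := 0) (by simp)).continuousAt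
  have h1 : ∀ᶠ y in 𝓝 a, fderiv ℝ f y ∈ Set.range ((↑) : (E ≃L[ℝ] E') → E →L[ℝ] E') :=
    hcont.eventually (by rw [hf'.fderiv]; exact ContinuousLinearEquiv.nhds f')
  obtain ⟨s, hs, hso, has⟩ := eventually_nhds_iff.1 (h1.and hf)
  have he0 : ⇑e0 = f := rfl
  -- Shrinking to points where the derivative is invertible makes the inverse smooth on its whole
  -- domain, not only at `f a`.
  let e := e0.restrOpen s hso
  have hes : e.source = e0.source ∩ s := rfl
  have hee : ⇑e = f := rfl
  have key : ∀ x ∈ e.source, x ∈ s := fun x hx => hx.2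
  refine ⟨e, ⟨hf.contDiffAt.mem_toOpenPartialHomeomorph_source hf' hn, has⟩, hee, ?_, ?_⟩
  · intro x hx
    exact (hs x (key x hx)).2.contDiffAt.contDiffWithinAt
  · intro y hy
    have hx := e.map_target hy
    obtain ⟨⟨L, hL⟩, h2⟩ := hs _ (key _ hx)
    refine (e.contDiffAt_symm (f₀' := L) hy ?_ h2.contDiffAt).contDiffWithinAt
    rw [hL]
    exact (h2.contDiffAt.differentiableAt (by simp)).hasFDerivAt

/-- A surjective linear map between finite dimensional spaces is the first component of a linear
equivalence. -/
theorem exists_continuousLinearEquiv_fst {F : Type*} [NormedAddCommGroup F] [NormedSpace ℝ F]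
    [FiniteDimensional ℝ E] [FiniteDimensional ℝ E'] [FiniteDimensional ℝ F] (D : E →L[ℝ] E')
    (hD : Function.Surjective D)
    (hd : Module.finrank ℝ E = Module.finrank ℝ E' + Module.finrank ℝ F) :
    ∃ L : E ≃L[ℝ] E' × F, ∀ x, (L x).1 = D x := by
  have hk : Module.finrank ℝ (LinearMap.ker D.toLinearMap) = Module.finrank ℝ F := by
    have := D.toLinearMap.finrank_range_add_finrank_ker
    rw [LinearMap.range_eq_top.2 hD, finrank_top] at this
    omega
  let k : LinearMap.ker D.toLinearMap ≃ₗ[ℝ] F := LinearEquiv.ofFinrankEq _ _ hk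
  obtain ⟨pr, hpr⟩ := (LinearMap.ker D.toLinearMap).subtype.exists_leftInverse_of_injective
    (LinearMap.ker_eq_bot.2 Subtype.val_injective)
  let L0 : E →ₗ[ℝ] E' × F := D.toLinearMap.prod (k.toLinearMap ∘ₗ pr)
  have hinj : Function.Injective L0 := by
    rw [injective_iff_map_eq_zero]
    intro x hx
    have h1 : D x = 0 := congrArg Prod.fst hx
    have h2 : k (pr x) = 0 := congrArg Prod.snd hx
    have h3 : pr x = 0 := by simpa using h2
    have h4 := LinearMap.congr_fun hpr (⟨x, h1⟩ : LinearMap.ker D.toLinearMap)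
    simp only [LinearMap.comp_apply, Submodule.subtype_apply, h3, LinearMap.id_apply] at h4
    exact (congrArg Subtype.val h4).symm
  have hfr : Module.finrank ℝ E = Module.finrank ℝ (E' × F) := by rw [Module.finrank_prod, hd]
  exact ⟨(L0.linearEquivOfInjective hinj hfr).toContinuousLinearEquiv, fun x => rfl⟩

end InverseFunction

/-! ### Submersions: local form, and recognition by local sections -/

namespace Manifold

open Filter

variable {EM EN F : Type*} [NormedAddCommGroup EM] [NormedSpace ℝ EM]
  [NormedAddCommGroup EN] [NormedSpace ℝ EN] [NormedAddCommGroup F] [NormedSpace ℝ F]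
  {M N : Type*} [TopologicalSpace M] [ChartedSpace EM M] [IsManifold 𝓘(ℝ, EM) ∞ M]
  [TopologicalSpace N] [ChartedSpace EN N] [IsManifold 𝓘(ℝ, EN) ∞ N] {s : M → N}

/-- Near a point, a submersion is the first component of a diffeomorphism `m ↦ (s m, γ m)`, with
inverse `S`. -/
theorem IsSubmersionAtOfComplement.exists_localInverse {m₀ : M}
    (h : IsSubmersionAtOfComplement F 𝓘(ℝ, EM) 𝓘(ℝ, EN) ∞ s m₀) :
    ∃ (γ : M → F) (S : N × F → M), SmoothNear 𝓘(ℝ, EM) 𝓘(ℝ, F) γ m₀ ∧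
      SmoothNear (𝓘(ℝ, EN).prod 𝓘(ℝ, F)) 𝓘(ℝ, EM) S (s m₀, γ m₀) ∧
      (∀ᶠ m in 𝓝 m₀, S (s m, γ m) = m) ∧
      ∀ᶠ w in 𝓝 (s m₀, γ m₀), s (S w) = w.1 ∧ γ (S w) = w.2 := by
  let γ : M → F := fun m => (h.equiv (h.domChart m)).2
  let S : N × F → M := fun w => h.domChart.symm (h.equiv.symm (h.codChart w.1, w.2))
  have hm₀ := h.mem_domChart_source
  have hS : ∀ m ∈ h.domChart.source, h.equiv.symm (h.codChart (s m), γ m) = h.domChart m := by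
    intro m hm
    rw [FiberProduct.codChart_apply h hm]
    exact h.equiv.symm_apply_apply _
  have hin : SmoothNear (𝓘(ℝ, EN).prod 𝓘(ℝ, F)) 𝓘(ℝ, EM)
      (fun w : N × F => h.equiv.symm (h.codChart w.1, w.2)) (s m₀, γ m₀) := by
    refine SmoothNear.comp (g := h.equiv.symm) (h.equiv.symm.contDiff.smoothNear _) ?_
    refine SmoothNear.prodMk_space ?_ (smoothNear_snd _)
    refine SmoothNear.comp (g := h.codChart) ?_ (smoothNear_fst _)
    exact (contMDiffOn_of_mem_maximalAtlas h.codChart_mem_maximalAtlas).smoothNear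
      h.codChart.open_source h.mem_codChart_source
  have htar : h.equiv.symm (h.codChart (s m₀), γ m₀) ∈ h.domChart.target := by
    rw [hS _ hm₀]; exact h.domChart.map_source hm₀
  refine ⟨γ, S, ?_, ?_, ?_, ?_⟩
  · refine SmoothNear.comp (g := fun u => (h.equiv u).2)
      ((contDiff_snd.comp h.equiv.contDiff).smoothNear _) ?_
    exact (contMDiffOn_of_mem_maximalAtlas h.domChart_mem_maximalAtlas).smoothNear
      h.domChart.open_source hm₀
  · refine SmoothNear.comp (g := h.domChart.symm) ?_ hin
    exact (contMDiffOn_symm_of_mem_maximalAtlas h.domChart_mem_maximalAtlas).smoothNear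
      h.domChart.open_target htar
  · filter_upwards [h.domChart.open_source.mem_nhds hm₀] with m hm
    simp only [S, hS m hm, h.domChart.left_inv hm]
  · have h1 := hin.continuousAt.eventually (h.domChart.open_target.mem_nhds htar)
    have h2 : ∀ᶠ w : N × F in 𝓝 (s m₀, γ m₀), w.1 ∈ h.codChart.source :=
      continuousAt_fst.eventually (h.codChart.open_source.mem_nhds h.mem_codChart_source)
    filter_upwards [h1, h2] with w h1 h2
    have h3 := h.domChart.map_target h1
    have h4 : h.domChart (S w) = h.equiv.symm (h.codChart w.1, w.2) := h.domChart.right_inv h1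
    refine ⟨?_, ?_⟩
    · refine h.codChart.injOn (h.source_subset_preimage_source h3) h2 ?_
      rw [FiberProduct.codChart_apply h h3, h4]
      simp
    · simp only [γ, h4]; simp

/-- A map between finite dimensional manifolds which has a smooth local section through each point
is a submersion. -/
theorem isSubmersion_of_localSections [FiniteDimensional ℝ EN]
    (hfin : M → FiniteDimensional ℝ EM) (hs : ContMDiff 𝓘(ℝ, EM) 𝓘(ℝ, EN) ∞ s)
    (H : ∀ m, ∃ σ : N → M, SmoothNear 𝓘(ℝ, EN) 𝓘(ℝ, EM) σ (s m) ∧ σ (s m) = m ∧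
      ∀ᶠ n in 𝓝 (s m), s (σ n) = n) :
    IsSubmersion 𝓘(ℝ, EM) 𝓘(ℝ, EN) ∞ s := by
  refine IsSubmersionOfComplement.isSubmersion (F :=
    EuclideanSpace ℝ (Fin (Module.finrank ℝ EM - Module.finrank ℝ EN))) fun m => ?_
  have := hfin m
  have := FiniteDimensional.complete ℝ EM
  obtain ⟨σ, hσ, hσm, hσs⟩ := H m
  let φ := chartAt EM m
  let ψ := chartAt EN (s m)
  let f : EM → EN := fun u => ψ (s (φ.symm u))
  let g : EN → EM := fun w => φ (σ (ψ.symm w))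
  have hφm : φ.symm (φ m) = m := φ.left_inv (mem_chart_source EM m)
  have hψm : ψ.symm (ψ (s m)) = s m := ψ.left_inv (mem_chart_source EN _)
  have hf : SmoothNear 𝓘(ℝ, EM) 𝓘(ℝ, EN) f (φ m) := by
    refine (smoothNear_chartAt (mem_chart_source EN (s m))).comp_of_eq (f := fun u => s (φ.symm u))
      ?_ (by simp only [hφm])
    exact (hs.smoothNear m).comp_of_eq
      (smoothNear_chartAt_symm ((chartAt EM m).map_source (mem_chart_source EM m))) hφm
  have hg : SmoothNear 𝓘(ℝ, EN) 𝓘(ℝ, EM) g (ψ (s m)) := by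
    refine (smoothNear_chartAt (mem_chart_source EM m)).comp_of_eq (f := fun u => σ (ψ.symm u))
      ?_ (by simp only [hψm, hσm])
    exact hσ.comp_of_eq
      (smoothNear_chartAt_symm ((chartAt EN (s m)).map_source (mem_chart_source EN _))) hψm
  have hgm : g (ψ (s m)) = φ m := by simp only [g, hψm, hσm]
  have hfg : ∀ᶠ w in 𝓝 (ψ (s m)), f (g w) = w := by
    have c1 : ContinuousAt ψ.symm (ψ (s m)) :=
      ψ.continuousAt_symm (ψ.map_source (mem_chart_source EN _))
    have h1 : ∀ᶠ w in 𝓝 (ψ (s m)), s (σ (ψ.symm w)) = ψ.symm w :=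
      c1.eventually (by rw [hψm]; exact hσs)
    have h2 : ∀ᶠ w in 𝓝 (ψ (s m)), σ (ψ.symm w) ∈ φ.source := by
      refine c1.eventually (p := fun n => σ n ∈ φ.source) ?_
      rw [hψm]
      refine hσ.continuousAt.eventually (φ.open_source.mem_nhds ?_)
      rw [hσm]; exact mem_chart_source EM m
    filter_upwards [h1, h2, ψ.open_target.mem_nhds (ψ.map_source (mem_chart_source EN _))]
      with w h1 h2 h3
    simp only [f, g, φ.left_inv h2, h1, ψ.right_inv h3]
  have hf' := (hf.contDiffAt.differentiableAt (by simp)).hasFDerivAt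
  have hg' := (hg.contDiffAt.differentiableAt (by simp)).hasFDerivAt
  set D := fderiv ℝ f (φ m)
  -- Differentiating `f ∘ g = id` gives a right inverse of `D`.
  have hD : Function.Surjective D := by
    have h1 : HasFDerivAt (fun w => f (g w)) (D.comp (fderiv ℝ g (ψ (s m)))) (ψ (s m)) :=
      HasFDerivAt.comp (g := f) (ψ (s m)) (by rw [hgm]; exact hf') hg'
    have h2 := (h1.congr_of_eventuallyEq (f₁ := id)
      (by filter_upwards [hfg] with w hw; exact hw.symm)).unique (hasFDerivAt_id _)
    intro y
    exact ⟨fderiv ℝ g (ψ (s m)) y, by rw [← ContinuousLinearMap.comp_apply, h2]; rfl⟩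
  have hle : Module.finrank ℝ EN ≤ Module.finrank ℝ EM :=
    LinearMap.finrank_le_finrank_of_surjective (f := D.toLinearMap) hD
  obtain ⟨L, hL⟩ := exists_continuousLinearEquiv_fst
    (F := EuclideanSpace ℝ (Fin (Module.finrank ℝ EM - Module.finrank ℝ EN))) D hD
    (by rw [finrank_euclideanSpace_fin]; omega)
  -- A correction of the chart: `L ∘ Φ` has first component `f`, and since `L` has first component
  -- `D`, the derivative of `Φ` at the point is the identity. In the chart `φ` followed by `Φ`, the
  -- map is the first component of `L`.
  let Φ : EM → EM := fun u => L.symm (f u, (L u).2)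
  have hΦ : SmoothNear 𝓘(ℝ, EM) 𝓘(ℝ, EM) Φ (φ m) := by
    refine SmoothNear.comp (g := L.symm) (L.symm.contDiff.smoothNear _) (hf.prodMk_space ?_)
    exact (contDiff_snd.comp L.contDiff).smoothNear _
  have hΦ' : HasFDerivAt Φ ((ContinuousLinearEquiv.refl ℝ EM : EM ≃L[ℝ] EM) : EM →L[ℝ] EM) (φ m) := by
    let K := (ContinuousLinearMap.snd ℝ EN _).comp L.toContinuousLinearMap
    have h1 : HasFDerivAt Φ (L.symm.toContinuousLinearMap.comp (D.prod K)) (φ m) :=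
      HasFDerivAt.comp (g := L.symm) (f := fun u => (f u, K u)) _ L.symm.hasFDerivAt
        (hf'.prodMk K.hasFDerivAt)
    convert h1 using 1
    ext x
    have : (D x, (L x).2) = L x := Prod.ext (hL x).symm rfl
    simp [K, this]
  obtain ⟨e, hem, hef, hes, het⟩ := exists_openPartialHomeomorph_of_hasFDerivAt hΦ _ hΦ'
  refine IsSubmersionAtOfComplement.mk_of_continuousAt (hs.continuous.continuousAt) L
    (φ.trans e) ψ (by simpa using ⟨mem_chart_source EM m, hem⟩) (mem_chart_source EN _) ?_
    (IsManifold.chart_mem_maximalAtlas _) ?_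
  · refine OpenPartialHomeomorph.mem_maximalAtlas_of_contMDiffOn _ ?_ ?_
    · refine ContMDiffOn.comp (g := e) (f := φ) hes.contMDiffOn (contMDiffOn_chart.mono ?_) ?_
      · intro x hx; simp at hx; exact hx.1
      · intro x hx; simp at hx; exact hx.2
    · refine ContMDiffOn.comp (g := φ.symm) (f := e.symm) contMDiffOn_chart_symm
        (het.contMDiffOn.mono ?_) ?_
      · intro x hx; simp at hx; exact hx.1
      · intro x hx; simp at hx; exact hx.2
  · intro y hy
    have hy' : y ∈ e.target := by simp at hy; exact hy.1
    have h1 : Φ (e.symm y) = y := by rw [← hef, e.right_inv hy']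
    have h2 : (L (Φ (e.symm y))).1 = f (e.symm y) := by simp [Φ]
    rw [h1] at h2
    simpa [f] using h2.symm

end Manifold

/-! ### Local smooth maps into and out of fibre products -/

namespace FiberProduct

open Manifold Set Filter

variable {EM EN EP : Type*}
  [NormedAddCommGroup EM] [NormedSpace ℝ EM] [NormedAddCommGroup EN] [NormedSpace ℝ EN]
  [NormedAddCommGroup EP] [NormedSpace ℝ EP]
  {M N P : Type*} [TopologicalSpace M] [ChartedSpace EM M]
  [TopologicalSpace N] [ChartedSpace EN N] [TopologicalSpace P] [ChartedSpace EP P]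
  {f : M → P} {g : N → P} [IsManifold 𝓘(ℝ, EM) ∞ M] [IsManifold 𝓘(ℝ, EN) ∞ N]
    [IsManifold 𝓘(ℝ, EP) ∞ P] (hf : IsSubmersion 𝓘(ℝ, EM) 𝓘(ℝ, EP) ∞ f)
    (hg : ContMDiff 𝓘(ℝ, EN) 𝓘(ℝ, EP) ∞ g)
    {EW HW W : Type*} [NormedAddCommGroup EW] [NormedSpace ℝ EW] [TopologicalSpace HW]
    {IW : ModelWithCorners ℝ EW HW} [TopologicalSpace W] [ChartedSpace HW W]

theorem contMDiff_val :
    letI := chartedSpace hf hg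
    ContMDiff 𝓘(ℝ, EN × hf.complement) (𝓘(ℝ, EM).prod 𝓘(ℝ, EN)) ∞
      (fun z : FiberProduct f g => z.1) := by
  let _ := chartedSpace hf hg
  exact (contMDiff_iff hf hg _).1 contMDiff_id

/-- The pointwise form of `contMDiff_iff`, needed for maps such as local sections that are smooth
only near a point. -/
theorem contMDiffAt_iff (u : W → FiberProduct f g) (w : W) :
    letI := chartedSpace hf hg
    ContMDiffAt IW 𝓘(ℝ, EN × hf.complement) ∞ u w ↔
      ContMDiffAt IW (𝓘(ℝ, EM).prod 𝓘(ℝ, EN)) ∞ (fun w => (u w).1) w := by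
  let _ := chartedSpace hf hg
  have := isManifold hf hg
  refine ⟨fun h => (contMDiff_val hf hg).contMDiffAt.comp w h, fun h => ?_⟩
  have hc : ContinuousAt u w := Topology.IsInducing.subtypeVal.continuousAt_iff.2 h.continuousAt
  let c := chartAt (EN × hf.complement) (u w)
  have hs := (mem_chart_source (EN × hf.complement) (u w))
  have h1 : ContMDiffAt IW 𝓘(ℝ, EN × hf.complement) ∞ (fun w => c (u w)) w := by
    have d1 : ContMDiffAt IW 𝓘(ℝ, EN) ∞ (fun w' => chartAt EN (u w).1.2 (u w').1.2) w :=
      (contMDiffAt_of_mem_maximalAtlas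
        (IsManifold.chart_mem_maximalAtlas (I := 𝓘(ℝ, EN)) (n := ∞) (u w).1.2)
        (mem_chart_source _ _)).comp w (contMDiff_snd.contMDiffAt.comp w h)
    have hsub := hf.isSubmersionOfComplement_complement.isSubmersionAt (u w).1.1
    have d2 : ContMDiffAt IW 𝓘(ℝ, EM) ∞ (fun w' => hsub.domChart (u w').1.1) w :=
      (contMDiffAt_of_mem_maximalAtlas hsub.domChart_mem_maximalAtlas
        hsub.mem_domChart_source).comp w (contMDiff_fst.contMDiffAt.comp w h)
    have d3 := (contDiff_snd.comp hsub.equiv.contDiff (n := ∞)).contMDiff.contMDiffAt.comp w d2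
    exact d1.prodMk_space d3
  have h2 := (contMDiffAt_symm_of_mem_maximalAtlas
    (IsManifold.chart_mem_maximalAtlas (I := 𝓘(ℝ, EN × hf.complement)) (n := ∞) (u w))
    (c.map_source hs)).comp w h1
  refine h2.congr_of_eventuallyEq ?_
  filter_upwards [hc (c.open_source.mem_nhds hs)] with w' hw'
  exact (c.left_inv hw').symm

theorem smoothNear_iff (u : W → FiberProduct f g) (w : W) :
    letI := chartedSpace hf hg
    SmoothNear IW 𝓘(ℝ, EN × hf.complement) u w ↔
      SmoothNear IW (𝓘(ℝ, EM).prod 𝓘(ℝ, EN)) (fun w => (u w).1) w :=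
  eventually_congr (Eventually.of_forall fun w' => contMDiffAt_iff hf hg u w')

/-- A fibre product is locally a smooth retract of the ambient product. -/
theorem exists_retraction (z : FiberProduct f g) :
    letI := chartedSpace hf hg
    ∃ R : M × N → FiberProduct f g,
      SmoothNear (𝓘(ℝ, EM).prod 𝓘(ℝ, EN)) 𝓘(ℝ, EN × hf.complement) R z.1 ∧
      ∀ᶠ m in 𝓝 z.1, ∀ e : f m.1 = g m.2, R m = ⟨m, e⟩ := by
  let _ := chartedSpace hf hg
  obtain ⟨γ, S, hγ, hS, hSs, hsS⟩ :=
    (hf.isSubmersionOfComplement_complement.isSubmersionAt z.1.1).exists_localInverse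
  classical
  -- Moves the first component, with the coordinate `γ` kept fixed, into the fibre of `f` over `g
  -- m.2`.
  let A : M × N → M × N := fun m => (S (g m.2, γ m.1), m.2)
  have hz : (g z.1.2, γ z.1.1) = (f z.1.1, γ z.1.1) := by rw [z.2]
  have hin : SmoothNear (𝓘(ℝ, EM).prod 𝓘(ℝ, EN)) (𝓘(ℝ, EP).prod 𝓘(ℝ, hf.complement))
      (fun m : M × N => (g m.2, γ m.1)) z.1 :=
    ((hg.smoothNear z.1.2).comp (smoothNear_snd z.1)).prodMk
      (SmoothNear.comp (f := Prod.fst) hγ (smoothNear_fst z.1))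
  have hA : SmoothNear (𝓘(ℝ, EM).prod 𝓘(ℝ, EN)) (𝓘(ℝ, EM).prod 𝓘(ℝ, EN)) A z.1 :=
    (hS.comp_of_eq hin hz).prodMk (smoothNear_snd z.1)
  have hfA : ∀ᶠ m in 𝓝 z.1, f (A m).1 = g (A m).2 := by
    have : Tendsto (fun m : M × N => (g m.2, γ m.1)) (𝓝 z.1) (𝓝 (f z.1.1, γ z.1.1)) := by
      rw [← hz]; exact hin.continuousAt
    filter_upwards [this.eventually hsS] with m hm using hm.1
  let R : M × N → FiberProduct f g := fun m => if h : f (A m).1 = g (A m).2 then ⟨A m, h⟩ else z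
  refine ⟨R, (smoothNear_iff hf hg R z.1).2 (hA.congr ?_), ?_⟩
  · filter_upwards [hfA] with m hm
    simp only [R, hm, dif_pos]
  · have h1 : ∀ᶠ m : M × N in 𝓝 z.1, S (f m.1, γ m.1) = m.1 := continuousAt_fst.eventually hSs
    filter_upwards [h1] with m hm e
    have hAm : A m = m := Prod.ext (by simp only [A]; rw [← e, hm]) rfl
    simp only [R, hAm, e, dif_pos]

/-- A smooth map on a fibre product extends locally to the ambient product. -/
theorem exists_extension (G : FiberProduct f g → W) (z : FiberProduct f g)
    (hG : letI := chartedSpace hf hg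
      SmoothNear 𝓘(ℝ, EN × hf.complement) IW G z) :
    ∃ G' : M × N → W, SmoothNear (𝓘(ℝ, EM).prod 𝓘(ℝ, EN)) IW G' z.1 ∧
      ∀ᶠ m in 𝓝 z.1, ∀ e : f m.1 = g m.2, G' m = G ⟨m, e⟩ := by
  let _ := chartedSpace hf hg
  obtain ⟨R, hR, hRz⟩ := exists_retraction hf hg z
  exact ⟨fun m => G (R m), hG.comp_of_eq hR (hRz.self_of_nhds z.2),
    hRz.mono fun m hm e => congrArg G (hm e)⟩

end FiberProduct

/-! ### Curves with zero velocity -/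

section Velocity

open Filter

variable {E E' : Type*} [NormedAddCommGroup E] [NormedSpace ℝ E]
  [NormedAddCommGroup E'] [NormedSpace ℝ E'] {H H' : Type*} [TopologicalSpace H]
  [TopologicalSpace H'] {I : ModelWithCorners ℝ E H} {I' : ModelWithCorners ℝ E' H'}
  {M M' : Type*} [TopologicalSpace M] [ChartedSpace H M] [TopologicalSpace M'] [ChartedSpace H' M']

variable (I) in
/-- The curve `u` is differentiable at `t`, with velocity zero. -/
def IsStationaryAt (u : ℝ → M) (t : ℝ) : Prop := HasMFDerivAt 𝓘(ℝ, ℝ) I u t 0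

namespace IsStationaryAt

theorem const (c : M) (t : ℝ) : IsStationaryAt I (fun _ => c) t := hasMFDerivAt_const c t

theorem map {u : ℝ → M} {t : ℝ} (h : IsStationaryAt I u t) {g : M → M'} {m : M}
    (hg : SmoothNear I I' g m) (e : u t = m) : IsStationaryAt I' (fun τ => g (u τ)) t := by
  subst e
  simpa [IsStationaryAt] using! hg.mdifferentiableAt.hasMFDerivAt.comp t h

theorem prodMk {u : ℝ → M} {u' : ℝ → M'} {t : ℝ} (h : IsStationaryAt I u t)
    (h' : IsStationaryAt I' u' t) : IsStationaryAt (I.prod I') (fun τ => (u τ, u' τ)) t :=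
  HasMFDerivAt.prodMk h h'

theorem congr {u u' : ℝ → M} {t : ℝ} (h : IsStationaryAt I u t) (e : u' =ᶠ[𝓝 t] u) :
    IsStationaryAt I u' t := HasMFDerivAt.congr_of_eventuallyEq (f := u) h e

end IsStationaryAt

/-- The velocity of a composite with a smooth map depends only on the velocity of the curve. -/
theorem IsStationaryAt.of_hasDerivAt {F : Type*} [NormedAddCommGroup F] [NormedSpace ℝ F]
    {g : F → M} {u u' : ℝ → F} {t t' : ℝ} {v : F} (hg : SmoothNear 𝓘(ℝ, F) I g (u t))
    (e : u' t' = u t)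
    (hu : HasDerivAt u v t) (hu' : HasDerivAt u' v t')
    (h : IsStationaryAt I (fun τ => g (u τ)) t) : IsStationaryAt I (fun τ => g (u' τ)) t' := by
  have h1 := hg.mdifferentiableAt.hasMFDerivAt
  have h2 : HasMFDerivAt 𝓘(ℝ, ℝ) I (fun τ => g (u τ)) t _ :=
    h1.comp t hu.hasFDerivAt.hasMFDerivAt
  have h3 : HasMFDerivAt 𝓘(ℝ, ℝ) I (fun τ => g (u' τ)) t' _ :=
    HasMFDerivAt.comp (g := g) t' (by rw [e]; exact h1) hu'.hasFDerivAt.hasMFDerivAt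
  have h4 := hasMFDerivAt_unique h2 h
  unfold IsStationaryAt
  convert h3 using 1
  · exact h4.symm

/-- A curve which is stationary at all times near `t` is constant near `t`. -/
theorem eventually_eq_of_isStationaryAt {M : Type*} [TopologicalSpace M] [ChartedSpace E M]
    [IsManifold 𝓘(ℝ, E) ∞ M] {u : ℝ → M} {t : ℝ}
    (h : ∀ᶠ τ in 𝓝 t, IsStationaryAt 𝓘(ℝ, E) u τ) : ∀ᶠ τ in 𝓝 t, u τ = u t := by
  let c := chartAt E (u t)
  have hc : ContinuousAt u t := HasMFDerivAt.continuousAt h.self_of_nhds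
  have hs : ∀ᶠ τ in 𝓝 t, u τ ∈ c.source :=
    hc.eventually (c.open_source.mem_nhds (mem_chart_source E _))
  obtain ⟨ε, hε, hball⟩ := Metric.eventually_nhds_iff_ball.1 (h.and hs)
  have hd : ∀ τ ∈ Metric.ball t ε, HasFDerivAt (fun τ => c (u τ)) (0 : ℝ →L[ℝ] E) τ := by
    intro τ hτ
    exact ((hball τ hτ).1.map (smoothNear_chartAt (hball τ hτ).2) rfl).hasFDerivAt
  filter_upwards [Metric.ball_mem_nhds t hε] with τ hτ
  refine c.injOn (hball τ hτ).2 (mem_chart_source E _) ?_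
  refine (convex_ball t ε).is_const_of_fderivWithin_eq_zero (𝕜 := ℝ) (f := fun τ => c (u τ))
    (fun x hx => (hd x hx).differentiableAt.differentiableWithinAt) (fun x hx => ?_) hτ
    (Metric.mem_ball_self hε)
  rw [fderivWithin_of_isOpen Metric.isOpen_ball hx, (hd x hx).fderiv]

end Velocity

/-! ### Smooth structure on a quotient with slices -/

section QuotientManifold

open Manifold Set Filter Topology

variable {E ED : Type*} [NormedAddCommGroup E] [NormedSpace ℝ E]
  [NormedAddCommGroup ED] [NormedSpace ℝ ED]
  {Z Q : Type*} [TopologicalSpace Z] [ChartedSpace E Z] [IsManifold 𝓘(ℝ, E) ∞ Z]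
  [TopologicalSpace Q]

variable (E ED) in
/-- A quotient map `π` from a manifold `Z` such that any two points of a fibre are related by a
local smooth map that preserves the fibres, and such that `π` has a smooth slice at each point: a
smooth section `σ` of a smooth map `q` whose fibres are, locally, those of `π`. -/
structure HasSlices (π : Z → Q) : Prop where
  isQuotientMap : IsQuotientMap π
  exists_translation : ∀ z z', π z = π z' → ∃ T : Z → Z, SmoothNear 𝓘(ℝ, E) 𝓘(ℝ, E) T z ∧
    T z = z' ∧ ∀ᶠ w in 𝓝 z, π (T w) = π w
  exists_slice : ∀ z, ∃ (q : Z → ED) (σ : ED → Z), SmoothNear 𝓘(ℝ, E) 𝓘(ℝ, ED) q z ∧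
    SmoothNear 𝓘(ℝ, ED) 𝓘(ℝ, E) σ (q z) ∧ σ (q z) = z ∧ (∀ᶠ y in 𝓝 (q z), q (σ y) = y) ∧
    (∀ᶠ w in 𝓝 z, π (σ (q w)) = π w) ∧ ∀ᶠ p in 𝓝 (z, z), π p.1 = π p.2 → q p.1 = q p.2

namespace HasSlices

variable {π : Z → Q} (h : HasSlices E ED π)

include h

/-- The saturation of an open set is open: a point equivalent to a point `z'` of the set has a
translation to `z'`, and this carries a whole neighbourhood into the set along the fibres. -/
theorem isOpenMap : IsOpenMap π := by
  intro W hW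
  rw [← h.isQuotientMap.isOpen_preimage, isOpen_iff_mem_nhds]
  rintro z ⟨z', hz', e⟩
  obtain ⟨T, hT, hTz, hπ⟩ := h.exists_translation z z' e.symm
  filter_upwards [hT.continuousAt.eventually (by rw [hTz]; exact hW.mem_nhds hz'), hπ] with w h1 h2
  exact ⟨T w, h1, h2⟩

/-- The chart is the inverse of `π ∘ σ` on a small open set `O`. Injectivity holds because `q`
recovers the slice coordinate from the fibre; openness because `π (σ O')` equals the image under `π`
of an open set of the form `U ∩ q ⁻¹' O'`. -/
theorem exists_chart (z : Z) : ∃ (e : OpenPartialHomeomorph Q ED) (σ : ED → Z), π z ∈ e.source ∧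
    ContMDiffOn 𝓘(ℝ, ED) 𝓘(ℝ, E) ∞ σ e.target ∧ (∀ y ∈ e.target, e.symm y = π (σ y)) ∧
    ∀ w, π w ∈ e.source → SmoothNear 𝓘(ℝ, E) 𝓘(ℝ, ED) (fun w => e (π w)) w := by
  obtain ⟨q, σ, hq, hσ, hσz, hqσ, hπ, hinj⟩ := h.exists_slice z
  obtain ⟨U', hU', hinj⟩ := (eventually_prod_self_iff
    (r := fun w w' => π w = π w' → q w = q w')).1 (by rwa [nhds_prod_eq] at hinj)
  obtain ⟨U, hUp, hUo, hzU⟩ := eventually_nhds_iff.1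
    ((hq.and hπ).and (show ∀ᶠ w in 𝓝 z, w ∈ U' from hU'))
  have hσU : ∀ᶠ y in 𝓝 (q z), σ y ∈ U :=
    hσ.continuousAt.eventually (by rw [hσz]; exact hUo.mem_nhds hzU)
  obtain ⟨O, hOp, hOo, hzO⟩ := eventually_nhds_iff.1 ((hσ.and hqσ).and hσU)
  have hqc : ContinuousOn q U := fun w hw => (hUp w hw).1.1.continuousAt.continuousWithinAt
  have hσc : ContinuousOn σ O := fun w hw => (hOp w hw).1.1.continuousAt.continuousWithinAt
  have hinjU : ∀ w ∈ U, ∀ w' ∈ U, π w = π w' → q w = q w' := fun w hw w' hw' =>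
    hinj w (hUp w hw).2 w' (hUp w' hw').2
  have hinjO : InjOn (fun y => π (σ y)) O := by
    intro y hy y' hy' e
    have := hinjU _ (hOp y hy).2 _ (hOp y' hy').2 e
    rwa [(hOp y hy).1.2, (hOp y' hy').1.2] at this
  have : Nonempty ED := ⟨q z⟩
  have hcont : ContinuousOn (fun y => π (σ y)) O :=
    h.isQuotientMap.continuous.comp_continuousOn hσc
  have hopen : IsOpenMap (O.domRestrict fun y => π (σ y)) := by
    intro S hS
    obtain ⟨O', hO', rfl⟩ := hS
    have : (O.domRestrict fun y => π (σ y)) '' (Subtype.val ⁻¹' O') =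
        π '' (U ∩ q ⁻¹' (O ∩ O')) := by
      ext x
      constructor
      · rintro ⟨⟨y, hy⟩, hy', rfl⟩
        exact ⟨σ y, ⟨(hOp y hy).2, by simpa [(hOp y hy).1.2] using ⟨hy, hy'⟩⟩, rfl⟩
      · rintro ⟨w, ⟨hw, hw', hw''⟩, rfl⟩
        exact ⟨⟨q w, hw'⟩, hw'', (hUp w hw).1.2⟩
    rw [this]
    exact h.isOpenMap _ (hqc.isOpen_inter_preimage hUo (hOo.inter hO'))
  let e := OpenPartialHomeomorph.ofContinuousOpenRestrict (hinjO.toPartialEquiv _ O) hcont hopen hOo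
  have he : ∀ y, e y = π (σ y) := fun y => rfl
  have hes : e.source = O := rfl
  have key : ∀ w ∈ U, q w ∈ O → e.symm (π w) = q w := by
    intro w hw hw'
    rw [← (hUp w hw).1.2, ← he]
    exact e.left_inv hw'
  refine ⟨e.symm, σ, ?_, ?_, fun y _ => rfl, ?_⟩
  · rw [← hσz, ← he]
    exact e.map_source hzO
  · exact fun y hy => (hOp y hy).1.1.contMDiffWithinAt
  · intro w hw
    let y := e.symm (π w)
    have hy : y ∈ O := e.map_target hw
    have hyw : π w = π (σ y) := (e.right_inv hw).symm
    -- Only near the slice is the chart composed with `π` equal to `q`, so an arbitrary point of the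
    -- fibre is first translated to the slice point `σ y`.
    obtain ⟨T, hT, hTw, hTπ⟩ := h.exists_translation w (σ y) hyw
    have hqT : SmoothNear 𝓘(ℝ, E) 𝓘(ℝ, ED) (fun w => q (T w)) w := by
      refine SmoothNear.comp_of_eq (g := q) (y := σ y) ?_ hT hTw
      filter_upwards [hUo.mem_nhds (hOp y hy).2] with w' hw' using (hUp w' hw').1.1
    refine hqT.congr ?_
    have h1 : ∀ᶠ w' in 𝓝 w, T w' ∈ U :=
      hT.continuousAt.eventually (by rw [hTw]; exact hUo.mem_nhds (hOp y hy).2)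
    have h2 : ∀ᶠ w' in 𝓝 w, q (T w') ∈ O :=
      hqT.continuousAt.eventually (by
        simp only [hTw, (hOp y hy).1.2]; exact hOo.mem_nhds hy)
    filter_upwards [h1, h2, hTπ] with w' h1 h2 h3
    rw [← h3, key _ h1 h2]

/-- The chart around `x` given by a slice. -/
noncomputable def chart (x : Q) : OpenPartialHomeomorph Q ED :=
  (h.exists_chart (Function.surjInv h.isQuotientMap.surjective x)).choose

theorem chart_spec (x : Q) : ∃ σ : ED → Z, x ∈ (h.chart x).source ∧
    ContMDiffOn 𝓘(ℝ, ED) 𝓘(ℝ, E) ∞ σ (h.chart x).target ∧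
    (∀ y ∈ (h.chart x).target, (h.chart x).symm y = π (σ y)) ∧
    ∀ w, π w ∈ (h.chart x).source →
      SmoothNear 𝓘(ℝ, E) 𝓘(ℝ, ED) (fun w => h.chart x (π w)) w := by
  obtain ⟨σ, hx, hσ⟩ :=
    (h.exists_chart (Function.surjInv h.isQuotientMap.surjective x)).choose_spec
  have hx' : π (Function.surjInv h.isQuotientMap.surjective x) ∈ (h.chart x).source := hx
  rw [Function.surjInv_eq h.isQuotientMap.surjective] at hx'
  exact ⟨σ, hx', hσ⟩

/-- The smooth structure of the quotient. -/
@[reducible] noncomputable def chartedSpace : ChartedSpace ED Q where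
  atlas := range h.chart
  chartAt := h.chart
  mem_chart_source x := (h.chart_spec x).choose_spec.1
  chart_mem_atlas x := mem_range_self x

/-- A transition map is `(e' ∘ π) ∘ σ`, with `σ` the section belonging to the first chart `e` and
`e'` the second chart. -/
theorem isManifold : letI := h.chartedSpace; IsManifold 𝓘(ℝ, ED) ∞ Q := by
  let _ := h.chartedSpace
  refine isManifold_of_contDiffOn _ _ _ ?_
  rintro _ _ ⟨x, rfl⟩ ⟨x', rfl⟩
  obtain ⟨σ, -, hσ, hσπ, -⟩ := h.chart_spec x
  obtain ⟨-, -, -, -, hπ⟩ := h.chart_spec x'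
  rw [← contMDiffOn_iff_contDiffOn]
  intro y hy
  have hy1 : y ∈ (h.chart x).target := by simp at hy; exact hy.1
  have hy2 : (h.chart x).symm y ∈ (h.chart x').source := by simp at hy; exact hy.2
  rw [hσπ y hy1] at hy2
  refine ContMDiffAt.contMDiffWithinAt ?_
  refine SmoothNear.contMDiffAt (((hπ _ hy2).comp
    (hσ.smoothNear (h.chart x).open_target hy1)).congr ?_)
  filter_upwards [(h.chart x).open_target.mem_nhds hy1] with y' hy'
  simp [hσπ y' hy']

theorem contMDiff : letI := h.chartedSpace; ContMDiff 𝓘(ℝ, E) 𝓘(ℝ, ED) ∞ π := by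
  let _ := h.chartedSpace
  have := h.isManifold
  intro z
  obtain ⟨-, hx, -, -, hπ⟩ := h.chart_spec (π z)
  have hs : π z ∈ (chartAt ED (π z)).source := mem_chart_source ED (π z)
  have h2 := (smoothNear_chartAt_symm (I := 𝓘(ℝ, ED)) ((chartAt ED (π z)).map_source hs)).comp_of_eq
    (f := fun w => chartAt ED (π z) (π w)) (hπ z hx) rfl
  refine (h2.congr ?_).contMDiffAt
  filter_upwards [h.isQuotientMap.continuous.continuousAt ((chartAt ED (π z)).open_source.mem_nhds
    (mem_chart_source ED (π z)))] with w hw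
  exact ((chartAt ED (π z)).left_inv hw).symm

/-- The section of the chart passes through some point of the fibre of `z`; a translation moves it
to `z`. -/
theorem exists_localSection (z : Z) : letI := h.chartedSpace
    ∃ σ : Q → Z, SmoothNear 𝓘(ℝ, ED) 𝓘(ℝ, E) σ (π z) ∧ σ (π z) = z ∧
      ∀ᶠ x in 𝓝 (π z), π (σ x) = x := by
  let _ := h.chartedSpace
  have := h.isManifold
  obtain ⟨σ, hx, hσ, hσπ, -⟩ := h.chart_spec (π z)
  let c := h.chart (π z)
  have h1 : SmoothNear 𝓘(ℝ, ED) 𝓘(ℝ, E) (fun x => σ (c x)) (π z) :=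
    (hσ.smoothNear c.open_target (c.map_source hx)).comp
      (smoothNear_chartAt (I := 𝓘(ℝ, ED)) (x := π z) hx)
  have h2 : ∀ x ∈ c.source, π (σ (c x)) = x := fun x hx => by
    rw [← hσπ _ (c.map_source hx)]; exact c.left_inv hx
  obtain ⟨T, hT, hTz, hTπ⟩ := h.exists_translation (σ (c (π z))) z (h2 _ hx)
  refine ⟨fun x => T (σ (c x)), hT.comp (f := fun x => σ (c x)) h1, hTz, ?_⟩
  filter_upwards [h1.continuousAt.eventually hTπ, c.open_source.mem_nhds hx] with x h3 h4
  rw [h3, h2 x h4]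

/-- Finite dimension of `E` is required only in the presence of a point of `Z`: the model space of
an empty manifold is arbitrary. -/
theorem isSubmersion [FiniteDimensional ℝ ED] (hfin : Z → FiniteDimensional ℝ E) :
    letI := h.chartedSpace; IsSubmersion 𝓘(ℝ, E) 𝓘(ℝ, ED) ∞ π := by
  let _ := h.chartedSpace
  have := h.isManifold
  exact isSubmersion_of_localSections hfin h.contMDiff h.exists_localSection

theorem isOpenQuotientMap : IsOpenQuotientMap π :=
  ⟨h.isQuotientMap.surjective, h.isQuotientMap.continuous, h.isOpenMap⟩

theorem secondCountableTopology [SecondCountableTopology Z] : SecondCountableTopology Q :=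
  h.isQuotientMap.secondCountableTopology h.isOpenMap

theorem t2Space (hc : IsClosed {p : Z × Z | π p.1 = π p.2}) : T2Space Q :=
  (t2Space_iff_of_isOpenQuotientMap h.isOpenQuotientMap).2 hc

end HasSlices

end QuotientManifold

/-! ### Groupoid calculus with a total product -/

namespace ArrowGroupoid

variable {P G : Type*} (𝒢 : ArrowGroupoid P G)

open Classical in
/-- The product, extended by `(g, h) ↦ g` to pairs that are not composable. -/
noncomputable def tmul (g h : G) : G := if e : 𝒢.tgt g = 𝒢.src h then 𝒢.mul g h e else g

variable {g h k : G}

theorem tmul_eq (e : 𝒢.tgt g = 𝒢.src h) : 𝒢.tmul g h = 𝒢.mul g h e := dif_pos e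

/-- The default value `g` is chosen so that this needs no composability. -/
theorem src_tmul (g h : G) : 𝒢.src (𝒢.tmul g h) = 𝒢.src g := by
  unfold tmul
  split_ifs with e
  · exact 𝒢.src_mul g h e
  · rfl

theorem tgt_tmul (e : 𝒢.tgt g = 𝒢.src h) : 𝒢.tgt (𝒢.tmul g h) = 𝒢.tgt h := by
  rw [tmul_eq _ e, tgt_mul]

theorem tmul_assoc (e : 𝒢.tgt g = 𝒢.src h) (e' : 𝒢.tgt h = 𝒢.src k) :
    𝒢.tmul (𝒢.tmul g h) k = 𝒢.tmul g (𝒢.tmul h k) := by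
  rw [𝒢.tmul_eq (g := 𝒢.tmul g h) ((𝒢.tgt_tmul e).trans e'),
    𝒢.tmul_eq (h := 𝒢.tmul h k) (e.trans (𝒢.src_tmul h k).symm),
    𝒢.mul_congr (𝒢.tmul_eq e) rfl _ ((𝒢.tgt_mul g h e).trans e'),
    𝒢.mul_congr rfl (𝒢.tmul_eq e') _ (e.trans (𝒢.src_mul h k e').symm)]
  exact 𝒢.mul_assoc g h k e e'

theorem one_tmul {p : P} (e : p = 𝒢.src g) : 𝒢.tmul (𝒢.one p) g = g := by
  rw [𝒢.tmul_eq ((𝒢.tgt_one p).trans e), one_mul']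

theorem tmul_one {p : P} (e : 𝒢.tgt g = p) : 𝒢.tmul g (𝒢.one p) = g := by
  rw [𝒢.tmul_eq (e.trans (𝒢.src_one p).symm), mul_one']

theorem inv_tmul (g : G) : 𝒢.tmul (𝒢.inv g) g = 𝒢.one (𝒢.tgt g) := by
  rw [𝒢.tmul_eq (𝒢.tgt_inv g), inv_mul]

theorem tmul_inv (g : G) : 𝒢.tmul g (𝒢.inv g) = 𝒢.one (𝒢.src g) := by
  rw [𝒢.tmul_eq (𝒢.src_inv g).symm, mul_inv]

theorem inv_tmul_cancel (e : 𝒢.tgt g = 𝒢.src h) : 𝒢.tmul (𝒢.inv g) (𝒢.tmul g h) = h := by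
  rw [← 𝒢.tmul_assoc (𝒢.tgt_inv g) e, inv_tmul, 𝒢.one_tmul e]

theorem tmul_inv_cancel (e : 𝒢.src g = 𝒢.src h) : 𝒢.tmul g (𝒢.tmul (𝒢.inv g) h) = h := by
  rw [← 𝒢.tmul_assoc (𝒢.src_inv g).symm ((𝒢.tgt_inv g).trans e), tmul_inv, 𝒢.one_tmul e]

theorem tmul_tmul_inv (e : 𝒢.tgt g = 𝒢.src h) : 𝒢.tmul (𝒢.tmul g h) (𝒢.inv h) = g := by
  rw [𝒢.tmul_assoc e (𝒢.src_inv h).symm, tmul_inv, 𝒢.tmul_one e]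

theorem eq_inv_of_tmul_eq_one {p : P} (e : 𝒢.tgt g = 𝒢.src h) (hp : 𝒢.tmul g h = 𝒢.one p) :
    g = 𝒢.inv h := 𝒢.eq_inv_of_mul_eq_one e (by rw [← hp, 𝒢.tmul_eq e])

theorem inv_inv (g : G) : 𝒢.inv (𝒢.inv g) = g :=
  (𝒢.eq_inv_of_tmul_eq_one (𝒢.src_inv g).symm (𝒢.tmul_inv g)).symm

theorem tmul_left_cancel (e : 𝒢.tgt g = 𝒢.src h) (e' : 𝒢.tgt g = 𝒢.src k)
    (hk : 𝒢.tmul g h = 𝒢.tmul g k) : h = k := by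
  rw [← 𝒢.inv_tmul_cancel e, hk, 𝒢.inv_tmul_cancel e']

theorem eq_one_of_tmul_eq_left (e : 𝒢.tgt g = 𝒢.src h) (he : 𝒢.tmul g h = g) :
    h = 𝒢.one (𝒢.tgt g) :=
  𝒢.tmul_left_cancel e (𝒢.src_one _).symm (by rw [he, 𝒢.tmul_one rfl])

theorem eq_one_of_tmul_eq_right (e : 𝒢.tgt g = 𝒢.src h) (he : 𝒢.tmul g h = h) :
    g = 𝒢.one (𝒢.src h) := by
  rw [← 𝒢.tmul_tmul_inv e, he, tmul_inv]

end ArrowGroupoid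

/-! ### Sides of composite boxes -/

namespace DoubleGroupoid

variable {P V H B : Type*} (D : DoubleGroupoid P V H B)

theorem left_tmul {A C : B} (e : D.bot A = D.top C) :
    D.left (D.boxV.tmul A C) = D.vert.tmul (D.left A) (D.left C) := by
  rw [D.boxV.tmul_eq e, left, D.left_mul, D.vert.tmul_eq]

theorem right_tmul {A C : B} (e : D.bot A = D.top C) :
    D.right (D.boxV.tmul A C) = D.vert.tmul (D.right A) (D.right C) := by
  rw [D.boxV.tmul_eq e, right, D.right_mul, D.vert.tmul_eq]

theorem top_tmul {A C : B} (e : D.right A = D.left C) :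
    D.top (D.boxH.tmul A C) = D.horiz.tmul (D.top A) (D.top C) := by
  rw [D.boxH.tmul_eq e, top, D.top_mul, D.horiz.tmul_eq]

theorem bot_tmul {A C : B} (e : D.right A = D.left C) :
    D.bot (D.boxH.tmul A C) = D.horiz.tmul (D.bot A) (D.bot C) := by
  rw [D.boxH.tmul_eq e, bot, D.bot_mul, D.horiz.tmul_eq]

theorem left_oneV (x : H) : D.left (D.boxV.one x) = D.vert.one (D.horiz.src x) := D.left_one x
theorem right_oneV (x : H) : D.right (D.boxV.one x) = D.vert.one (D.horiz.tgt x) := D.right_one x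
theorem top_oneV (x : H) : D.top (D.boxV.one x) = x := D.boxV.src_one x
theorem bot_oneV (x : H) : D.bot (D.boxV.one x) = x := D.boxV.tgt_one x
theorem left_oneH (f : V) : D.left (D.boxH.one f) = f := D.boxH.src_one f
theorem right_oneH (f : V) : D.right (D.boxH.one f) = f := D.boxH.tgt_one f
theorem top_oneH (f : V) : D.top (D.boxH.one f) = D.horiz.one (D.vert.src f) := D.top_one f
theorem bot_oneH (f : V) : D.bot (D.boxH.one f) = D.horiz.one (D.vert.tgt f) := D.bot_one f
theorem left_tmulH (A C : B) : D.left (D.boxH.tmul A C) = D.left A := D.boxH.src_tmul A C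
theorem right_tmulH {A C : B} (e : D.right A = D.left C) :
    D.right (D.boxH.tmul A C) = D.right C := D.boxH.tgt_tmul e
theorem top_tmulV (A C : B) : D.top (D.boxV.tmul A C) = D.top A := D.boxV.src_tmul A C
theorem bot_tmulV {A C : B} (e : D.bot A = D.top C) :
    D.bot (D.boxV.tmul A C) = D.bot C := D.boxV.tgt_tmul e
theorem top_invV (A : B) : D.top (D.boxV.inv A) = D.bot A := D.boxV.src_inv A
theorem bot_invV (A : B) : D.bot (D.boxV.inv A) = D.top A := D.boxV.tgt_inv A
theorem left_invH (A : B) : D.left (D.boxH.inv A) = D.right A := D.boxH.src_inv A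
theorem right_invH (A : B) : D.right (D.boxH.inv A) = D.left A := D.boxH.tgt_inv A

theorem top_inv (A : B) : D.top (D.boxH.inv A) = D.horiz.inv (D.top A) := by
  refine D.horiz.eq_inv_of_tmul_eq_one (p := D.vert.src (D.right A)) ?_ ?_
  · rw [← top_right, D.boxH.tgt_inv, top_left]
  · rw [← D.top_tmul (D.boxH.tgt_inv A), D.boxH.inv_tmul, top, D.top_one]

/-- A box with identities as top and right sides relates points of `𝒱 ×_{b,l} ℋ`. -/
theorem coreOrbit_of_core {A : B} {p q : P} (ht : D.top A = D.horiz.one p)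
    (hr : D.right A = D.vert.one q) {w z : D.CornerSpace} (e : D.vert.tgt z.1.1 = p)
    (h1 : w.1.1 = D.vert.tmul z.1.1 (D.left A)) (h2 : w.1.2 = D.horiz.tmul (D.bot A) z.1.2) :
    D.coreOrbit w z := by
  let E : D.Core := ⟨A, ⟨p, ht⟩, ⟨q, hr⟩⟩
  have hE : D.coreTgt E = p := by
    have := D.top_right A
    rw [← right, ← top, ht, D.horiz.tgt_one] at this
    exact this
  refine ⟨E, hE.trans e.symm, Subtype.ext (Prod.ext ?_ ?_)⟩
  · rw [h1, D.vert.tmul_eq]; rfl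
  · rw [h2, D.horiz.tmul_eq]; rfl

/-- A box whose right side is an identity relates points of `𝒱 ×_{b,l} ℋ`. -/
theorem coreOrbit_of_right_eq_one {C : B} {q : P} (hr : D.right C = D.vert.one q)
    {w z : D.CornerSpace} {f : V} {x : H} (e : D.vert.tgt f = D.vert.src (D.left C))
    (e' : D.horiz.tgt (D.top C) = D.horiz.src x)
    (h1 : w.1.1 = D.vert.tmul f (D.left C)) (h2 : w.1.2 = D.horiz.tmul (D.bot C) x)
    (h3 : z.1.1 = f) (h4 : z.1.2 = D.horiz.tmul (D.top C) x) : D.coreOrbit w z := by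
  have hq : q = D.horiz.tgt (D.top C) := by
    have := D.top_right C
    rwa [← right, hr, D.vert.src_one] at this
  have hq' : q = D.horiz.tgt (D.bot C) := by
    have := D.bot_right C
    rwa [← right, hr, D.vert.tgt_one] at this
  have hc : D.right C = D.left (D.boxV.one (D.horiz.inv (D.top C))) := by
    rw [hr, D.left_oneV, D.horiz.src_inv, hq]
  -- Attaching the identity box on `t(C)⁻¹` on the right makes the top an identity, keeps the right
  -- side one, and changes the bottom to `b(C) t(C)⁻¹`.
  refine D.coreOrbit_of_core (A := D.boxH.tmul C (D.boxV.one (D.horiz.inv (D.top C))))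
    (p := D.vert.src (D.left C)) (q := D.horiz.src (D.top C)) ?_ ?_ (by rw [h3, e]) ?_ ?_
  · rw [D.top_tmul hc, D.top_oneV, D.horiz.tmul_inv, D.top_left]
  · rw [right, D.boxH.tgt_tmul hc, D.right_one, D.horiz.tgt_inv]
  · rw [left, D.boxH.src_tmul, h1, h3]
  · rw [D.bot_tmul hc, D.bot_oneV, h2, h4, D.horiz.tmul_assoc, D.horiz.inv_tmul_cancel e']
    · rw [D.horiz.src_inv, ← hq', hq]
    · rw [D.horiz.tgt_inv, D.horiz.src_tmul]

/-! ### The right actions of ℋ and 𝒱 on core orbits -/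

section Action

variable (hfill : Function.Surjective D.doubleSource)

include hfill in
/-- The filling condition: there is a box with a given top and a given right side. -/
theorem exists_box_top_right {x : H} {g : V} (e : D.horiz.tgt x = D.vert.src g) :
    ∃ A : B, D.top A = x ∧ D.right A = g := by
  obtain ⟨A, hA⟩ := hfill ⟨(D.horiz.inv x, g), by rw [D.horiz.src_inv, e]⟩
  have h1 : D.top A = D.horiz.inv x := congrArg (fun z => z.1.1) hA
  have h2 : D.left A = g := congrArg (fun z => z.1.2) hA
  exact ⟨D.boxH.inv A, by rw [D.top_inv, h1, D.horiz.inv_inv], by rw [right, D.boxH.tgt_inv, ← h2]⟩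

/-- The point `(f l(A), b(A))`, for a box `A` with top `x`. -/
noncomputable def pushPoint (z : D.CornerSpace) (A : B) (e : D.top A = z.1.2) : D.CornerSpace :=
  ⟨(D.vert.tmul z.1.1 (D.left A), D.bot A), by
    rw [D.vert.tgt_tmul, D.bot_left]
    rw [z.2, ← e, D.top_left]⟩

/-- The action of 𝒱 is well defined, both on orbits and independently of the filling box. With `z' =
E ▷ z`, the box `C`, formed by `E` and the identity box on x, connects x with `b(E) x`. Stacking the
vertical inverse of `A`, then `C`, then `A'` gives a box from `b(A)` to `b(A')` with right side
`r(A)⁻¹ r(A') = 1`, which relates the two pushed points. -/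
theorem pushPoint_rel {z z' : D.CornerSpace} {A A' : B} (e : D.top A = z.1.2)
    (e' : D.top A' = z'.1.2) (hz : D.coreOrbit z' z) (hr : D.right A' = D.right A) :
    D.coreOrbit (D.pushPoint z' A' e') (D.pushPoint z A e) := by
  obtain ⟨E, hE, rfl⟩ := hz
  have h1 : (D.coreAct E z hE).1.1 = D.vert.tmul z.1.1 (D.left E) := (D.vert.tmul_eq _).symm
  have h2 : (D.coreAct E z hE).1.2 = D.horiz.tmul (D.bot E) z.1.2 := (D.horiz.tmul_eq _).symm
  have hmom : D.coreTgt E = D.horiz.src z.1.2 := hE.trans z.2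
  have htE : D.horiz.tgt (D.bot E) = D.horiz.src z.1.2 := by rw [tgt_bot_core, hmom]
  -- the box with top `x` and bottom `b(E) x`
  let C := D.boxH.tmul E (D.boxV.one z.1.2)
  have hc : D.right E = D.left (D.boxV.one z.1.2) := by rw [right_core, D.left_oneV, hmom]
  have hCt : D.top C = z.1.2 := by
    rw [D.top_tmul hc, D.top_oneV, top_core, D.horiz.one_tmul hmom]
  have hCb : D.bot C = D.horiz.tmul (D.bot E) z.1.2 := by
    rw [D.bot_tmul hc, D.bot_oneV]
  have hCl : D.left C = D.left E := D.boxH.src_tmul _ _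
  have hCr : D.right C = D.vert.one (D.horiz.tgt z.1.2) := by
    rw [right, D.boxH.tgt_tmul hc, D.right_one]
  have hA : D.bot (D.boxV.inv A) = D.top C := by rw [D.bot_invV, hCt, ← e]
  have hCA : D.bot C = D.top A' := by rw [hCb, e', h2]
  have hAC : D.bot (D.boxV.tmul (D.boxV.inv A) C) = D.top A' := by
    rw [D.bot_tmulV hA, hCA]
  have hsA : D.vert.src (D.left A) = D.vert.src (D.left E) := by
    rw [D.top_left, ← top, e, src_left_core, hmom]
  have hlC : D.vert.tgt (D.left E) = D.vert.src (D.left A') := by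
    rw [D.top_left, ← top, e', h2, D.horiz.src_tmul, src_bot_core, coreSrc]
  have hzA : D.vert.tgt z.1.1 = D.vert.src (D.left A) := by
    rw [z.2, ← e, ← D.top_left]
  have hsrA : D.vert.src (D.right A) = D.horiz.tgt z.1.2 := by rw [D.top_right, ← top, e]
  -- The horizontal factor common to both points is an identity here, since they have the bottoms of
  -- `A'` and `A` as horizontal components.
  refine D.coreOrbit_of_right_eq_one (C := D.boxV.tmul (D.boxV.tmul (D.boxV.inv A) C) A')
    (f := D.vert.tmul z.1.1 (D.left A)) (x := D.horiz.one (D.horiz.tgt (D.bot A)))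
    (q := D.vert.tgt (D.right A)) ?_ ?_ ?_ ?_ ?_ rfl ?_
  · rw [D.right_tmul hAC, D.right_tmul hA, right_inv, hCr, D.vert.tmul_one, hr, D.vert.inv_tmul]
    rw [D.vert.tgt_inv, hsrA]
  · rw [D.left_tmul hAC, D.left_tmul hA, left_inv, D.vert.tgt_tmul hzA, D.vert.src_tmul,
      D.vert.src_tmul, D.vert.src_inv]
  · rw [D.top_tmulV, D.top_tmulV, D.top_invV, D.horiz.src_one]
  · rw [D.left_tmul hAC, D.left_tmul hA, left_inv, hCl]
    change D.vert.tmul (D.coreAct E z hE).1.1 (D.left A') = _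
    have e1 : D.vert.tgt (D.vert.inv (D.left A)) = D.vert.src (D.left E) := by
      rw [D.vert.tgt_inv, hsA]
    rw [h1, D.vert.tmul_assoc e1 hlC, D.vert.tmul_assoc (h := D.left A) hzA,
      D.vert.tmul_inv_cancel, D.vert.tmul_assoc _ hlC]
    · rw [hzA, hsA]
    · rw [D.vert.src_tmul, hsA]
    · rw [D.vert.src_tmul, D.vert.src_inv]
  · have : D.bot (D.boxV.tmul (D.boxV.tmul (D.boxV.inv A) C) A') = D.bot A' := D.boxV.tgt_tmul hAC
    rw [this, D.horiz.tmul_one]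
    · rfl
    · rw [← D.bot_right, ← D.bot_right, ← right, ← right, hr]
  · have : D.top (D.boxV.tmul (D.boxV.tmul (D.boxV.inv A) C) A') = D.bot A := by
      rw [top, D.boxV.src_tmul, D.boxV.src_tmul, D.boxV.src_inv]
    rw [this, D.horiz.tmul_one rfl]
    rfl

/-- The right vertex of an orbit. -/
def quotTgt : D.CoreQuotient → P :=
  Quotient.lift (fun z => D.horiz.tgt z.1.2) (by
    rintro w z ⟨E, e, rfl⟩
    exact D.horiz.tgt_mul _ _ _)

/-- The right action of `ℋ` on orbits. -/
noncomputable def quotActH (y : H) : D.CoreQuotient → D.CoreQuotient :=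
  Quotient.map (fun z => ⟨(z.1.1, D.horiz.tmul z.1.2 y), by rw [z.2, D.horiz.src_tmul]⟩) (by
    rintro w z ⟨E, e, rfl⟩
    refine ⟨E, e, Subtype.ext (Prod.ext rfl ?_)⟩
    have e1 : D.horiz.tgt (D.bot E) = D.horiz.src z.1.2 := by
      rw [tgt_bot_core, e, moment, z.2]
    change D.horiz.tmul (D.horiz.mul (D.bot E) z.1.2 e1) y =
      D.horiz.mul (D.bot E) (D.horiz.tmul z.1.2 y) (by rw [D.horiz.src_tmul, e1])
    rw [← D.horiz.tmul_eq, ← D.horiz.tmul_eq]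
    by_cases hy : D.horiz.tgt z.1.2 = D.horiz.src y
    · exact D.horiz.tmul_assoc e1 hy
    · have h1 : D.horiz.tmul z.1.2 y = z.1.2 := dif_neg hy
      rw [h1]
      exact dif_neg (by rwa [D.horiz.tgt_tmul e1]))

open Classical in
/-- The right action of `𝒱` on orbits. -/
noncomputable def quotActV (g : V) : D.CoreQuotient → D.CoreQuotient :=
  -- Orbits that cannot be multiplied by `g` stay fixed, so the action is a total map.
  Quotient.lift (fun z => if e : D.horiz.tgt z.1.2 = D.vert.src g then
    Quotient.mk D.coreOrbit (D.pushPoint z (D.exists_box_top_right hfill e).choose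
      (D.exists_box_top_right hfill e).choose_spec.1) else Quotient.mk D.coreOrbit z) (by
    intro w z hwz
    have ht : D.horiz.tgt w.1.2 = D.horiz.tgt z.1.2 := by
      obtain ⟨E, e, rfl⟩ := hwz
      exact D.horiz.tgt_mul _ _ _
    by_cases e : D.horiz.tgt z.1.2 = D.vert.src g
    · rw [dif_pos e, dif_pos (ht.trans e)]
      refine Quotient.sound (D.pushPoint_rel _ _ hwz ?_)
      rw [(D.exists_box_top_right hfill e).choose_spec.2,
        (D.exists_box_top_right hfill (ht.trans e)).choose_spec.2]
    · rw [dif_neg e, dif_neg (by rwa [ht])]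
      exact Quotient.sound hwz)

theorem quotActV_mk {g : V} {z : D.CornerSpace} {A : B} (ht : D.top A = z.1.2)
    (hr : D.right A = g) : D.quotActV hfill g (Quotient.mk _ z) =
      Quotient.mk _ (D.pushPoint z A ht) := by
  have e : D.horiz.tgt z.1.2 = D.vert.src g := by rw [← hr, D.top_right, ← top, ht]
  have h1 := (D.exists_box_top_right hfill e).choose_spec
  refine (dif_pos e).trans (Quotient.sound (D.pushPoint_rel _ _ (D.coreOrbit.refl z) ?_))
  rw [h1.2, hr]

theorem quotTgt_quotActV {g : V} {s : D.CoreQuotient} (e : D.quotTgt s = D.vert.src g) :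
    D.quotTgt (D.quotActV hfill g s) = D.vert.tgt g := by
  obtain ⟨z, rfl⟩ := Quotient.exists_rep s
  obtain ⟨A, ht, hr⟩ := D.exists_box_top_right hfill e
  rw [D.quotActV_mk hfill ht hr]
  change D.horiz.tgt (D.bot A) = _
  rw [← D.bot_right, ← hr]

theorem quotTgt_quotActH {y : H} {s : D.CoreQuotient} (e : D.quotTgt s = D.horiz.src y) :
    D.quotTgt (D.quotActH y s) = D.horiz.tgt y := by
  obtain ⟨z, rfl⟩ := Quotient.exists_rep s
  exact D.horiz.tgt_tmul e

theorem quotActH_tmul {x y : H} (e : D.horiz.tgt x = D.horiz.src y) {s : D.CoreQuotient}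
    (hs : D.quotTgt s = D.horiz.src x) :
    D.quotActH (D.horiz.tmul x y) s = D.quotActH y (D.quotActH x s) := by
  obtain ⟨z, rfl⟩ := Quotient.exists_rep s
  refine congrArg (Quotient.mk _) (Subtype.ext (Prod.ext rfl ?_))
  exact (D.horiz.tmul_assoc hs e).symm

theorem quotActH_one {p : P} {s : D.CoreQuotient} (hs : D.quotTgt s = p) :
    D.quotActH (D.horiz.one p) s = s := by
  obtain ⟨z, rfl⟩ := Quotient.exists_rep s
  exact congrArg (Quotient.mk _) (Subtype.ext (Prod.ext rfl (D.horiz.tmul_one hs)))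

theorem quotActV_tmul {f g : V} (e : D.vert.tgt f = D.vert.src g) {s : D.CoreQuotient}
    (hs : D.quotTgt s = D.vert.src f) :
    D.quotActV hfill (D.vert.tmul f g) s = D.quotActV hfill g (D.quotActV hfill f s) := by
  obtain ⟨z, rfl⟩ := Quotient.exists_rep s
  obtain ⟨A, ht, hr⟩ := D.exists_box_top_right hfill hs
  obtain ⟨A', ht', hr'⟩ := D.exists_box_top_right hfill (x := D.bot A) (g := g)
    (by rw [← D.bot_right, ← right, hr, e])
  have hAA : D.bot A = D.top A' := ht'.symm
  rw [D.quotActV_mk hfill ht hr, D.quotActV_mk hfill (A := A') ht' hr',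
    D.quotActV_mk hfill (A := D.boxV.tmul A A') (by rw [top, D.boxV.src_tmul, ← top, ht])
      (by rw [D.right_tmul hAA, hr, hr'])]
  refine congrArg (Quotient.mk _) (Subtype.ext (Prod.ext ?_ ?_))
  · change D.vert.tmul z.1.1 (D.left (D.boxV.tmul A A')) =
      D.vert.tmul (D.vert.tmul z.1.1 (D.left A)) (D.left A')
    rw [D.left_tmul hAA, D.vert.tmul_assoc]
    · rw [D.top_left, ← top, ht, z.2]
    · rw [D.top_left, ← top, ht', D.bot_left]
  · exact D.boxV.tgt_tmul hAA

theorem quotActV_one {p : P} {s : D.CoreQuotient} (hs : D.quotTgt s = p) :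
    D.quotActV hfill (D.vert.one p) s = s := by
  obtain ⟨z, rfl⟩ := Quotient.exists_rep s
  have hs' : D.horiz.tgt z.1.2 = p := hs
  rw [D.quotActV_mk hfill (A := D.boxV.one z.1.2) (D.boxV.src_one _)
    (by rw [right, D.right_one, hs'])]
  refine congrArg (Quotient.mk _) (Subtype.ext (Prod.ext ?_ (D.boxV.tgt_one _)))
  change D.vert.tmul z.1.1 (D.left _) = _
  rw [left, D.left_one, D.vert.tmul_one z.2]

/-- If `A'` fills the corner (x, `l(A)`), then `A'` followed by `A` fills the corner (x `t(A)`,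
`r(A)`). It has the left side of `A'`, and its bottom is `b(A') b(A)`. -/
theorem quotAct_box (A : B) {s : D.CoreQuotient} (hs : D.quotTgt s = D.horiz.src (D.top A)) :
    D.quotActV hfill (D.right A) (D.quotActH (D.top A) s) =
      D.quotActH (D.bot A) (D.quotActV hfill (D.left A) s) := by
  obtain ⟨z, rfl⟩ := Quotient.exists_rep s
  obtain ⟨A', ht, hr⟩ := D.exists_box_top_right hfill (x := z.1.2) (g := D.left A)
    (hs.trans (D.top_left A).symm)
  rw [D.quotActV_mk hfill ht hr]
  refine (D.quotActV_mk hfill (A := D.boxH.tmul A' A) ?_ (D.boxH.tgt_tmul hr)).trans ?_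
  · rw [D.top_tmul hr, ht]
  · refine congrArg (Quotient.mk _) (Subtype.ext (Prod.ext ?_ ?_))
    · change D.vert.tmul z.1.1 (D.left _) = D.vert.tmul z.1.1 (D.left A')
      rw [left, D.boxH.src_tmul]
    · exact D.bot_tmul hr

end Action

end DoubleGroupoid

/-! ### The action of the diagonal groupoid on orbits -/

open CategoryTheory in
/-- The arrows of a free groupoid are generated by the given arrows and their inverses. -/
theorem Quiver.FreeGroupoid.induction {X : Type*} [Quiver X]
    {R : ∀ {x y : X}, ((of X).obj x ⟶ (of X).obj y) → Prop} (hid : ∀ x, R (𝟙 ((of X).obj x)))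
    (hof : ∀ {w x y : X} (u : (of X).obj w ⟶ (of X).obj x) (e : x ⟶ y),
      R u → R (u ≫ (of X).map e))
    (hinv : ∀ {w x y : X} (u : (of X).obj w ⟶ (of X).obj y) (e : x ⟶ y),
      R u → R (u ≫ Groupoid.inv ((of X).map e)))
    {x y : X} (u : (of X).obj x ⟶ (of X).obj y) : R u := by
  obtain ⟨p⟩ := u
  change Quiver.Path (V := Quiver.Symmetrify X) x y at p
  induction p with
  | nil => exact hid _
  | cons p e ih =>
    rcases e with e | e
    · exact hof _ e (ih (Quot.mk _ p))
    · exact hinv _ e (ih (Quot.mk _ p))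

namespace DoubleGroupoid

open CategoryTheory

variable {P V H B : Type*} (D : DoubleGroupoid P V H B)

/-- The vertices of the groupoid of bijections between the fibres of `quotTgt`. -/
structure FibreVertex (D : DoubleGroupoid P V H B) where
  pt : P

/-- The orbits with right vertex `p`. -/
abbrev QuotFibre (p : P) : Type _ := {s : D.CoreQuotient // D.quotTgt s = p}

instance : Groupoid D.FibreVertex where
  Hom p q := D.QuotFibre p.pt ≃ D.QuotFibre q.pt
  id _ := Equiv.refl _
  comp := Equiv.trans
  inv := Equiv.symm
  inv_comp := Equiv.symm_trans_self
  comp_inv := Equiv.self_trans_symm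

variable {D} in
/-- The map between fibres underlying an arrow. -/
def FibreVertex.app {a b : D.FibreVertex} (u : a ⟶ b) (s : D.QuotFibre a.pt) :
    D.QuotFibre b.pt := Equiv.toFun u s

theorem FibreVertex.app_comp {a b c : D.FibreVertex} (u : a ⟶ b) (w : b ⟶ c)
    (s : D.QuotFibre a.pt) : FibreVertex.app (u ≫ w) s = FibreVertex.app w (FibreVertex.app u s) :=
  rfl

theorem FibreVertex.hom_ext {a b : D.FibreVertex} {u w : a ⟶ b}
    (h : ∀ s, (FibreVertex.app u s).1 = (FibreVertex.app w s).1) : u = w :=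
  Equiv.ext fun s => Subtype.ext (h s)

section Bijection

variable (hfill : Function.Surjective D.doubleSource)

/-- The bijection between fibres given by a vertical arrow. -/
noncomputable def fibreV (g : V) : D.QuotFibre (D.vert.src g) ≃ D.QuotFibre (D.vert.tgt g) where
  toFun s := ⟨D.quotActV hfill g s.1, D.quotTgt_quotActV hfill s.2⟩
  invFun s := ⟨D.quotActV hfill (D.vert.inv g) s.1, by
    rw [D.quotTgt_quotActV hfill (s.2.trans (D.vert.src_inv g).symm), D.vert.tgt_inv]⟩
  left_inv s := Subtype.ext (by
    change D.quotActV hfill _ (D.quotActV hfill g s.1) = _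
    rw [← D.quotActV_tmul hfill (D.vert.src_inv g).symm s.2, D.vert.tmul_inv,
      D.quotActV_one hfill s.2])
  right_inv s := Subtype.ext (by
    change D.quotActV hfill g (D.quotActV hfill _ s.1) = _
    rw [← D.quotActV_tmul hfill (D.vert.tgt_inv g) (s.2.trans (D.vert.src_inv g).symm),
      D.vert.inv_tmul, D.quotActV_one hfill s.2])

/-- The bijection between fibres given by a horizontal arrow. -/
noncomputable def fibreH (x : H) : D.QuotFibre (D.horiz.src x) ≃ D.QuotFibre (D.horiz.tgt x) where
  toFun s := ⟨D.quotActH x s.1, D.quotTgt_quotActH s.2⟩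
  invFun s := ⟨D.quotActH (D.horiz.inv x) s.1, by
    rw [D.quotTgt_quotActH (s.2.trans (D.horiz.src_inv x).symm), D.horiz.tgt_inv]⟩
  left_inv s := Subtype.ext (by
    change D.quotActH _ (D.quotActH x s.1) = _
    rw [← D.quotActH_tmul (D.horiz.src_inv x).symm s.2, D.horiz.tmul_inv,
      D.quotActH_one s.2])
  right_inv s := Subtype.ext (by
    change D.quotActH x (D.quotActH _ s.1) = _
    rw [← D.quotActH_tmul (D.horiz.tgt_inv x) (s.2.trans (D.horiz.src_inv x).symm),
      D.horiz.inv_tmul, D.quotActH_one s.2])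

/-- The action of the generators of the free product on orbits. -/
noncomputable def fibrePrefunctor :
    @Prefunctor (FreeProductVertex D.vert D.horiz) _ D.FibreVertex CategoryStruct.toQuiver where
  obj p := ⟨p⟩
  map {p q} e := match e with
    | Sum.inl g => (Equiv.subtypeEquivRight fun s => by rw [g.2.1]).trans
        ((D.fibreV hfill g.1).trans (Equiv.subtypeEquivRight fun s => by rw [g.2.2]))
    | Sum.inr x => (Equiv.subtypeEquivRight fun s => by rw [x.2.1]).trans
        ((D.fibreH x.1).trans (Equiv.subtypeEquivRight fun s => by rw [x.2.2]))

/-- The action of the free groupoid on orbits. -/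
noncomputable def freeFunctor :
    Quiver.FreeGroupoid (FreeProductVertex D.vert D.horiz) ⥤ D.FibreVertex :=
  Quiver.FreeGroupoid.lift (D.fibrePrefunctor hfill)

theorem freeFunctor_map {p q : FreeProductVertex D.vert D.horiz} (e : p ⟶ q) :
    (D.freeFunctor hfill).map ((Quiver.FreeGroupoid.of _).map e) =
      (D.fibrePrefunctor hfill).map e :=
  Category.id_comp ((D.fibrePrefunctor hfill).map e)

theorem freeFunctor_freeV {p q : FreeProductVertex D.vert D.horiz} (g : V) (hp : D.vert.src g = p)
    (hq : D.vert.tgt g = q) (s : D.QuotFibre p) :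
    (FibreVertex.app ((D.freeFunctor hfill).map (freeV D.vert D.horiz g hp hq)) s).1 =
      D.quotActV hfill g s.1 := by
  unfold freeV
  rw [D.freeFunctor_map hfill]
  rfl

theorem freeFunctor_freeH {p q : FreeProductVertex D.vert D.horiz} (x : H)
    (hp : D.horiz.src x = p) (hq : D.horiz.tgt x = q) (s : D.QuotFibre p) :
    (FibreVertex.app ((D.freeFunctor hfill).map (freeH D.vert D.horiz x hp hq)) s).1 =
      D.quotActH x s.1 := by
  unfold freeH
  rw [D.freeFunctor_map hfill]
  rfl

/-- The action of the free product on orbits. -/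
noncomputable def freeProductFunctor : FreeProduct D.vert D.horiz ⥤ D.FibreVertex :=
  CategoryTheory.Quotient.lift _ (D.freeFunctor hfill) (by
    rintro _ _ _ _ (⟨f, g, e⟩ | ⟨x, y, e⟩)
    · refine FibreVertex.hom_ext D fun s => ?_
      have hs : D.quotTgt s.1 = D.vert.src f := s.2
      rw [Functor.map_comp, FibreVertex.app_comp]
      refine (D.freeFunctor_freeV hfill g rfl rfl _).trans ?_
      refine Eq.trans ?_ (D.freeFunctor_freeV hfill _ _ _ s).symm
      rw [← D.vert.tmul_eq e, D.quotActV_tmul hfill e hs]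
      exact congrArg _ (D.freeFunctor_freeV hfill f rfl e s)
    · refine FibreVertex.hom_ext D fun s => ?_
      have hs : D.quotTgt s.1 = D.horiz.src x := s.2
      rw [Functor.map_comp, FibreVertex.app_comp]
      refine (D.freeFunctor_freeH hfill y rfl rfl _).trans ?_
      refine Eq.trans ?_ (D.freeFunctor_freeH hfill _ _ _ s).symm
      rw [← D.horiz.tmul_eq e, D.quotActH_tmul e hs]
      exact congrArg _ (D.freeFunctor_freeH hfill x rfl e s))

theorem freeProductFunctor_inV {p q : P} (g : V) (hp : D.vert.src g = p)
    (hq : D.vert.tgt g = q) (s : D.QuotFibre p) :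
    (FibreVertex.app ((D.freeProductFunctor hfill).map (FreeProduct.inV D.vert D.horiz g hp hq)) s).1 = D.quotActV hfill g s.1 :=
  D.freeFunctor_freeV hfill g hp hq s

theorem freeProductFunctor_inH {p q : P} (x : H) (hp : D.horiz.src x = p)
    (hq : D.horiz.tgt x = q) (s : D.QuotFibre p) :
    (FibreVertex.app ((D.freeProductFunctor hfill).map (FreeProduct.inH D.vert D.horiz x hp hq)) s).1 = D.quotActH x s.1 :=
  D.freeFunctor_freeH hfill x hp hq s

/-- By `quotAct_box` the two ways around the box act equally; they differ by the factor [A], which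
is then cancelled. -/
theorem freeProductFunctor_boundary (A : B) :
    (D.freeProductFunctor hfill).map (D.boundary A) = 𝟙 _ := by
  have h : FreeProduct.inH D.vert D.horiz (D.top A) rfl rfl ≫
      FreeProduct.inV D.vert D.horiz (D.right A) (D.top_right A) rfl =
        D.boundary A ≫ FreeProduct.inV D.vert D.horiz (D.left A) (D.top_left A) (D.bot_left A) ≫
          FreeProduct.inH D.vert D.horiz (D.bot A) rfl (D.bot_right A).symm := by
    simp [boundary]
  have h1 : (D.freeProductFunctor hfill).map (FreeProduct.inH D.vert D.horiz (D.top A) rfl rfl ≫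
      FreeProduct.inV D.vert D.horiz (D.right A) (D.top_right A) rfl) =
      (D.freeProductFunctor hfill).map (FreeProduct.inV D.vert D.horiz (D.left A) (D.top_left A)
        (D.bot_left A) ≫ FreeProduct.inH D.vert D.horiz (D.bot A) rfl (D.bot_right A).symm) := by
    refine FibreVertex.hom_ext D fun s => ?_
    have hs : D.quotTgt s.1 = D.horiz.src (D.top A) := s.2
    rw [Functor.map_comp, Functor.map_comp, FibreVertex.app_comp, FibreVertex.app_comp]
    refine (D.freeProductFunctor_inV hfill _ _ _ _).trans ?_
    refine Eq.trans ?_ (D.freeProductFunctor_inH hfill _ _ _ _).symm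
    refine (congrArg _ (D.freeProductFunctor_inH hfill _ _ _ s)).trans ?_
    refine (D.quotAct_box hfill A hs).trans ?_
    exact congrArg _ (D.freeProductFunctor_inV hfill _ _ _ s).symm
  rw [h, Functor.map_comp] at h1
  exact (cancel_mono _).1 (h1.trans (Category.id_comp _).symm)

/-- The kernel of the action is a subgroupoid that contains every [A], hence contains `J`. -/
theorem freeProductFunctor_of_modJ {c d : FreeProduct D.vert D.horiz} (u w : c ⟶ d)
    (h : D.modJ u w) : (D.freeProductFunctor hfill).map u = (D.freeProductFunctor hfill).map w := by
  have hle : D.J ≤ Subgroupoid.ker (D.freeProductFunctor hfill) := by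
    refine sInf_le ?_
    rintro c d _ ⟨A⟩
    exact (Subgroupoid.mem_ker_iff _ _).2 ⟨rfl, D.freeProductFunctor_boundary hfill A⟩
  obtain ⟨h1, h2⟩ := (Subgroupoid.mem_ker_iff _ _).1
    (Subgroupoid.le_iff _ _ |>.1 hle h)
  rw [eqToHom_refl, Functor.map_comp] at h2
  have h3 : u = (u ≫ Groupoid.inv w) ≫ w := by simp
  rw [h3, Functor.map_comp, Functor.map_comp, h2, Category.id_comp]

/-- The action of the diagonal groupoid on orbits. -/
noncomputable def diagFunctor : CategoryTheory.Quotient D.modJ ⥤ D.FibreVertex :=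
  CategoryTheory.Quotient.lift _ (D.freeProductFunctor hfill)
    fun _ _ u w h => D.freeProductFunctor_of_modJ hfill u w h

/-- The identity orbit at `p`. -/
noncomputable def quotOne (p : P) : D.QuotFibre p :=
  ⟨Quotient.mk _ ⟨(D.vert.one p, D.horiz.one p), by rw [D.vert.tgt_one, D.horiz.src_one]⟩,
    D.horiz.tgt_one p⟩

/-- The image of an identity orbit under an arrow of the diagonal groupoid. -/
noncomputable def diagToQuot (d : D.Diag) : D.CoreQuotient :=
  (FibreVertex.app ((D.diagFunctor hfill).map d.2.2) (D.quotOne d.1)).1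

end Bijection

/-! ### Normal forms j(f) i(x) and their uniqueness up to the core -/

/-- The arrow of the diagonal groupoid given by an arrow of the free product. -/
def diagOf {p q : P} (u : FreeProduct.obj D.vert D.horiz p ⟶ FreeProduct.obj D.vert D.horiz q) :
    D.Diag := ⟨p, q, (CategoryTheory.Quotient.functor D.modJ).map u⟩

theorem diagOf_comp {p q r : P}
    (u : FreeProduct.obj D.vert D.horiz p ⟶ FreeProduct.obj D.vert D.horiz q)
    (w : FreeProduct.obj D.vert D.horiz q ⟶ FreeProduct.obj D.vert D.horiz r) :
    D.diagonal.tmul (D.diagOf u) (D.diagOf w) = D.diagOf (u ≫ w) := by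
  rw [D.diagonal.tmul_eq (show D.diagonal.tgt (D.diagOf u) = D.diagonal.src (D.diagOf w) from rfl)]
  simp [diagonal, ArrowGroupoid.ofGroupoid, diagOf]
  rfl

/-- The arrow of the diagonal groupoid given by an arrow of the free groupoid. -/
def diagOfFree {p q : FreeProductVertex D.vert D.horiz}
    (u : (Quiver.FreeGroupoid.of _).obj p ⟶ (Quiver.FreeGroupoid.of _).obj q) : D.Diag :=
  D.diagOf (p := p) (q := q)
    ((CategoryTheory.Quotient.functor (FreeProductRel D.vert D.horiz)).map u)

theorem diagOfFree_comp {p q r : FreeProductVertex D.vert D.horiz}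
    (u : (Quiver.FreeGroupoid.of _).obj p ⟶ (Quiver.FreeGroupoid.of _).obj q)
    (w : (Quiver.FreeGroupoid.of _).obj q ⟶ (Quiver.FreeGroupoid.of _).obj r) :
    D.diagOfFree (u ≫ w) = D.diagonal.tmul (D.diagOfFree u) (D.diagOfFree w) :=
  (congrArg D.diagOf (CategoryTheory.Functor.map_comp _ u w)).trans (D.diagOf_comp _ _).symm

theorem diagOf_inV {p q : P} (g : V) (hp : D.vert.src g = p) (hq : D.vert.tgt g = q) :
    D.diagOf (FreeProduct.inV D.vert D.horiz g hp hq) = D.diagV g := by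
  subst hp hq; rfl

theorem diagOf_inH {p q : P} (x : H) (hp : D.horiz.src x = p) (hq : D.horiz.tgt x = q) :
    D.diagOf (FreeProduct.inH D.vert D.horiz x hp hq) = D.diagH x := by
  subst hp hq; rfl

theorem diagV_tmul {f g : V} (e : D.vert.tgt f = D.vert.src g) :
    D.diagV (D.vert.tmul f g) = D.diagonal.tmul (D.diagV f) (D.diagV g) := by
  have h : FreeProduct.inV D.vert D.horiz f rfl e ≫ FreeProduct.inV D.vert D.horiz g rfl rfl =
      FreeProduct.inV D.vert D.horiz (D.vert.mul f g e) (D.vert.src_mul f g e)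
        (D.vert.tgt_mul f g e) :=
    CategoryTheory.Quotient.sound _ (FreeProductRel.vert f g e)
  rw [D.vert.tmul_eq e, ← D.diagOf_inV _ (D.vert.src_mul f g e) (D.vert.tgt_mul f g e), ← h,
    ← diagOf_comp, diagOf_inV, diagOf_inV]

theorem diagH_tmul {x y : H} (e : D.horiz.tgt x = D.horiz.src y) :
    D.diagH (D.horiz.tmul x y) = D.diagonal.tmul (D.diagH x) (D.diagH y) := by
  have h : FreeProduct.inH D.vert D.horiz x rfl e ≫ FreeProduct.inH D.vert D.horiz y rfl rfl =
      FreeProduct.inH D.vert D.horiz (D.horiz.mul x y e) (D.horiz.src_mul x y e)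
        (D.horiz.tgt_mul x y e) :=
    CategoryTheory.Quotient.sound _ (FreeProductRel.horiz x y e)
  rw [D.horiz.tmul_eq e, ← D.diagOf_inH _ (D.horiz.src_mul x y e) (D.horiz.tgt_mul x y e), ← h,
    ← diagOf_comp, diagOf_inH, diagOf_inH]

theorem tgt_diagV (f : V) : D.diagonal.tgt (D.diagV f) = D.vert.tgt f := rfl
theorem src_diagH (x : H) : D.diagonal.src (D.diagH x) = D.horiz.src x := rfl
theorem tgt_diagH (x : H) : D.diagonal.tgt (D.diagH x) = D.horiz.tgt x := rfl

/-- An idempotent of a groupoid is an identity. -/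
theorem diagV_one (p : P) : D.diagV (D.vert.one p) = D.diagonal.one p := by
  have e : D.vert.tgt (D.vert.one p) = D.vert.src (D.vert.one p) := by
    rw [D.vert.tgt_one, D.vert.src_one]
  have h := D.diagV_tmul e
  rw [D.vert.one_tmul (D.vert.src_one p).symm] at h
  rw [D.diagonal.eq_one_of_tmul_eq_left (g := D.diagV (D.vert.one p)) (h := D.diagV (D.vert.one p)) e h.symm, tgt_diagV,
    D.vert.tgt_one]

theorem diagH_one (p : P) : D.diagH (D.horiz.one p) = D.diagonal.one p := by
  have e : D.horiz.tgt (D.horiz.one p) = D.horiz.src (D.horiz.one p) := by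
    rw [D.horiz.tgt_one, D.horiz.src_one]
  have h := D.diagH_tmul e
  rw [D.horiz.one_tmul (D.horiz.src_one p).symm] at h
  rw [D.diagonal.eq_one_of_tmul_eq_left (g := D.diagH (D.horiz.one p)) (h := D.diagH (D.horiz.one p)) e h.symm, tgt_diagH,
    D.horiz.tgt_one]

theorem diagV_inv (f : V) : D.diagV (D.vert.inv f) = D.diagonal.inv (D.diagV f) := by
  refine D.diagonal.eq_inv_of_tmul_eq_one (p := D.vert.tgt f) (D.vert.tgt_inv f) ?_
  rw [← D.diagV_tmul (D.vert.tgt_inv f), D.vert.inv_tmul, diagV_one]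

theorem diagH_inv (x : H) : D.diagH (D.horiz.inv x) = D.diagonal.inv (D.diagH x) := by
  refine D.diagonal.eq_inv_of_tmul_eq_one (p := D.horiz.tgt x) (D.horiz.tgt_inv x) ?_
  rw [← D.diagH_tmul (D.horiz.tgt_inv x), D.horiz.inv_tmul, diagH_one]

theorem diag_box (A : B) : D.diagonal.tmul (D.diagH (D.top A)) (D.diagV (D.right A)) =
    D.diagonal.tmul (D.diagV (D.left A)) (D.diagH (D.bot A)) := by
  have h : D.modJ (FreeProduct.inH D.vert D.horiz (D.top A) rfl rfl ≫
      FreeProduct.inV D.vert D.horiz (D.right A) (D.top_right A) rfl)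
      (FreeProduct.inV D.vert D.horiz (D.left A) (D.top_left A) (D.bot_left A) ≫
        FreeProduct.inH D.vert D.horiz (D.bot A) rfl (D.bot_right A).symm) := by
    have h1 : D.boundary A ∈ D.J.arrows _ _ :=
      Subgroupoid.subset_generated _ _ _ (IsBoundary.mk A)
    unfold modJ
    convert h1 using 1
    simp [boundary]
  have h2 := congrArg (fun u => (⟨_, _, u⟩ : D.Diag)) (CategoryTheory.Quotient.sound _ h)
  have h3 : D.diagOf (FreeProduct.inH D.vert D.horiz (D.top A) rfl rfl ≫
      FreeProduct.inV D.vert D.horiz (D.right A) (D.top_right A) rfl) =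
      D.diagOf (FreeProduct.inV D.vert D.horiz (D.left A) (D.top_left A) (D.bot_left A) ≫
        FreeProduct.inH D.vert D.horiz (D.bot A) rfl (D.bot_right A).symm) := h2
  rwa [← diagOf_comp, ← diagOf_comp, diagOf_inH, diagOf_inV, diagOf_inH, diagOf_inV] at h3

theorem toDiag_eq (z : D.CornerSpace) :
    D.toDiag z = D.diagonal.tmul (D.diagV z.1.1) (D.diagH z.1.2) :=
  (D.diagonal.tmul_eq (g := D.diagV z.1.1) (h := D.diagH z.1.2) z.2).symm

theorem src_toDiag (z : D.CornerSpace) : D.diagonal.src (D.toDiag z) = D.vert.src z.1.1 := by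
  rw [toDiag_eq, D.diagonal.src_tmul]; rfl

theorem tgt_toDiag (z : D.CornerSpace) : D.diagonal.tgt (D.toDiag z) = D.horiz.tgt z.1.2 := by
  rw [toDiag_eq, D.diagonal.tgt_tmul (g := D.diagV z.1.1) (h := D.diagH z.1.2) z.2]; rfl

/-- The box `E` gives `j(l(E)) i(b(E)) = i(t(E)) j(r(E)) = 1`, and the action inserts exactly this
factor between j(f) and i(x). -/
theorem toDiag_eq_of_coreOrbit {w z : D.CornerSpace} (h : D.coreOrbit w z) :
    D.toDiag w = D.toDiag z := by
  obtain ⟨E, e, rfl⟩ := h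
  have h1 : (D.coreAct E z e).1.1 = D.vert.tmul z.1.1 (D.left E) := (D.vert.tmul_eq _).symm
  have h2 : (D.coreAct E z e).1.2 = D.horiz.tmul (D.bot E) z.1.2 := (D.horiz.tmul_eq _).symm
  have e1 : D.vert.tgt z.1.1 = D.vert.src (D.left E) := by rw [src_left_core, e, moment]
  have e2 : D.horiz.tgt (D.bot E) = D.horiz.src z.1.2 := by rw [tgt_bot_core, e, moment, z.2]
  have e3 : D.vert.tgt (D.left E) = D.horiz.src (D.bot E) := D.bot_left E
  have hE : D.diagonal.tmul (D.diagV (D.left E)) (D.diagH (D.bot E)) =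
      D.diagonal.one (D.coreTgt E) := by
    rw [← D.diag_box, top_core, right_core, diagV_one, diagH_one,
      D.diagonal.one_tmul (D.diagonal.src_one _).symm]
  rw [toDiag_eq, toDiag_eq, h1, h2, D.diagV_tmul e1, D.diagH_tmul e2,
    D.diagonal.tmul_assoc (g := D.diagV z.1.1) (h := D.diagV (D.left E))
      (k := D.diagonal.tmul (D.diagH (D.bot E)) (D.diagH z.1.2)) e1
      (Eq.trans e3 (D.diagonal.src_tmul (D.diagH (D.bot E)) (D.diagH z.1.2)).symm),
    ← D.diagonal.tmul_assoc (g := D.diagV (D.left E)) (h := D.diagH (D.bot E))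
      (k := D.diagH z.1.2) e3 e2, hE, D.diagonal.one_tmul]
  rw [src_diagH, ← e2, tgt_bot_core]

section Bijection

variable (hfill : Function.Surjective D.doubleSource)

/-- The identity box on f fills the corner (1, f), so f carries the identity orbit to the orbit of
(f, 1), and x carries that to the orbit of (f, x). This left inverse is what shows that no further
pairs are identified in the diagonal groupoid. -/
theorem diagToQuot_toDiag (z : D.CornerSpace) :
    D.diagToQuot hfill (D.toDiag z) = Quotient.mk _ z := by
  have h : D.toDiag z = D.diagOf (FreeProduct.inV D.vert D.horiz z.1.1 rfl z.2 ≫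
      FreeProduct.inH D.vert D.horiz z.1.2 rfl rfl) := by
    rw [toDiag_eq, ← diagOf_comp, diagOf_inV, diagOf_inH]
  rw [h]
  refine Eq.trans (b := (FibreVertex.app ((D.freeProductFunctor hfill).map
    (FreeProduct.inV D.vert D.horiz z.1.1 rfl z.2 ≫
      FreeProduct.inH D.vert D.horiz z.1.2 rfl rfl)) (D.quotOne _)).1) rfl ?_
  rw [Functor.map_comp, FibreVertex.app_comp]
  refine (D.freeProductFunctor_inH hfill _ _ _ _).trans ?_
  refine (congrArg _ (D.freeProductFunctor_inV hfill _ _ _ (D.quotOne _))).trans ?_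
  have h1 := D.quotActV_mk hfill (g := z.1.1)
    (z := ⟨(D.vert.one (D.vert.src z.1.1), D.horiz.one (D.vert.src z.1.1)), by
      rw [D.vert.tgt_one, D.horiz.src_one]⟩) (A := D.boxH.one z.1.1) (D.top_oneH _) (D.right_oneH _)
  refine (congrArg _ h1).trans ?_
  refine congrArg (Quotient.mk _) (Subtype.ext (Prod.ext ?_ ?_))
  · change D.vert.tmul (D.vert.one _) (D.left _) = _
    rw [D.left_oneH, D.vert.one_tmul rfl]
  · change D.horiz.tmul (D.bot _) _ = _
    rw [D.bot_oneH, D.horiz.one_tmul z.2]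

include hfill in
theorem toDiag_eq_iff {w z : D.CornerSpace} : D.toDiag w = D.toDiag z ↔ D.coreOrbit w z := by
  refine ⟨fun h => Quotient.exact ?_, D.toDiag_eq_of_coreOrbit⟩
  rw [← D.diagToQuot_toDiag hfill, ← D.diagToQuot_toDiag hfill, h]

/-- The product of an arrow in normal form with a vertical arrow. -/
theorem toDiag_tmul_diagV {z : D.CornerSpace} {A : B} (e : D.top A = z.1.2) :
    D.diagonal.tmul (D.toDiag z) (D.diagV (D.right A)) = D.toDiag (D.pushPoint z A e) := by
  have e1 : D.vert.tgt z.1.1 = D.vert.src (D.left A) := by rw [z.2, ← e, ← D.top_left]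
  have e2 : D.horiz.tgt z.1.2 = D.vert.src (D.right A) := by rw [← e, ← D.top_right]
  rw [toDiag_eq, D.diagonal.tmul_assoc (g := D.diagV z.1.1) (h := D.diagH z.1.2) (k := D.diagV (D.right A))
      z.2 e2, ← e, diag_box, toDiag_eq,
    ← D.diagonal.tmul_assoc (g := D.diagV z.1.1) (h := D.diagV (D.left A))
      (k := D.diagH (D.bot A)) e1 (D.bot_left A),
    ← D.diagV_tmul e1]
  rfl

theorem toDiag_tmul_diagH (z : D.CornerSpace) {y : H} (e : D.horiz.tgt z.1.2 = D.horiz.src y) :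
    D.diagonal.tmul (D.toDiag z) (D.diagH y) =
      D.toDiag ⟨(z.1.1, D.horiz.tmul z.1.2 y), by rw [z.2, D.horiz.src_tmul]⟩ := by
  rw [toDiag_eq, D.diagonal.tmul_assoc (g := D.diagV z.1.1) (h := D.diagH z.1.2) (k := D.diagH y) z.2 e,
    ← D.diagH_tmul e, toDiag_eq]

-- Normal forms are stable under right multiplication by the generators and their inverses: a
-- horizontal arrow is absorbed, a vertical one is moved past x by a filling box. Induction on words
-- of the free groupoid does the rest.
include hfill in
theorem toDiag_surjective : Function.Surjective D.toDiag := by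
  suffices ∀ {p q : FreeProductVertex D.vert D.horiz}
      (u : (Quiver.FreeGroupoid.of _).obj p ⟶ (Quiver.FreeGroupoid.of _).obj q),
      ∃ z, D.diagOfFree u = D.toDiag z by
    rintro ⟨p, q, ⟨⟨u⟩⟩⟩
    obtain ⟨z, hz⟩ := this (p := p) (q := q) u
    exact ⟨z, hz.symm⟩
  have hV : ∀ (z : D.CornerSpace) (g : V), D.horiz.tgt z.1.2 = D.vert.src g →
      ∃ z', D.diagonal.tmul (D.toDiag z) (D.diagV g) = D.toDiag z' := by
    intro z g e
    obtain ⟨A, ht, hr⟩ := D.exists_box_top_right hfill e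
    exact ⟨_, by rw [← hr]; exact D.toDiag_tmul_diagV ht⟩
  have hH : ∀ (z : D.CornerSpace) (y : H), D.horiz.tgt z.1.2 = D.horiz.src y →
      ∃ z', D.diagonal.tmul (D.toDiag z) (D.diagH y) = D.toDiag z' :=
    fun z y e => ⟨_, D.toDiag_tmul_diagH z e⟩
  intro p q u
  induction u using Quiver.FreeGroupoid.induction with
  | hid p =>
    refine ⟨⟨(D.vert.one p, D.horiz.one p), (D.vert.tgt_one p).trans (D.horiz.src_one p).symm⟩, ?_⟩
    rw [toDiag_eq]
    exact ((D.diagV_one p).symm ▸ (D.diagH_one p).symm ▸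
      (D.diagonal.one_tmul (D.diagonal.src_one p).symm).symm)
  | hof u e ih =>
    obtain ⟨z, hz⟩ := ih
    have ht := (D.tgt_toDiag z).symm.trans (congrArg D.diagonal.tgt hz.symm)
    rw [diagOfFree_comp, hz]
    rcases e with ⟨g, hp, hq⟩ | ⟨y, hp, hq⟩
    · obtain ⟨z', hz'⟩ := hV z g (ht.trans hp.symm)
      refine ⟨z', ?_⟩
      rw [← hz', ← D.diagOf_inV g hp hq]
      rfl
    · obtain ⟨z', hz'⟩ := hH z y (ht.trans hp.symm)
      refine ⟨z', ?_⟩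
      rw [← hz', ← D.diagOf_inH y hp hq]
      rfl
  | hinv u e ih =>
    obtain ⟨z, hz⟩ := ih
    have ht := (D.tgt_toDiag z).symm.trans (congrArg D.diagonal.tgt hz.symm)
    rw [diagOfFree_comp, hz]
    rcases e with ⟨g, hp, hq⟩ | ⟨y, hp, hq⟩
    · obtain ⟨z', hz'⟩ := hV z (D.vert.inv g) (ht.trans (by rw [D.vert.src_inv, hq]; rfl))
      refine ⟨z', ?_⟩
      rw [← hz', D.diagV_inv, ← D.diagOf_inV g hp hq]
      rfl
    · obtain ⟨z', hz'⟩ := hH z (D.horiz.inv y) (ht.trans (by rw [D.horiz.src_inv, hq]; rfl))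
      refine ⟨z', ?_⟩
      rw [← hz', D.diagH_inv, ← D.diagOf_inH y hp hq]
      rfl

end Bijection

end DoubleGroupoid

/-! ### Smoothness of products along composable maps -/

namespace ArrowGroupoid.IsLie

open Manifold Filter

variable {EP EG P G : Type*} [NormedAddCommGroup EP] [NormedSpace ℝ EP] [NormedAddCommGroup EG]
  [NormedSpace ℝ EG] [TopologicalSpace P] [ChartedSpace EP P] [IsManifold 𝓘(ℝ, EP) ∞ P]
  [TopologicalSpace G] [ChartedSpace EG G] [IsManifold 𝓘(ℝ, EG) ∞ G] {𝒢 : ArrowGroupoid P G}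
  (hG : 𝒢.IsLie EP EG)
  {EW HW W : Type*} [NormedAddCommGroup EW] [NormedSpace ℝ EW] [TopologicalSpace HW]
  {I : ModelWithCorners ℝ EW HW} [TopologicalSpace W] [ChartedSpace HW W]

include hG

/-- The product of a Lie groupoid extends locally to a smooth map on all pairs of arrows. -/
theorem exists_extension_mul {g h : G} (e : 𝒢.tgt g = 𝒢.src h) :
    ∃ m : G × G → G, SmoothNear (𝓘(ℝ, EG).prod 𝓘(ℝ, EG)) 𝓘(ℝ, EG) m (g, h) ∧
      ∀ᶠ w in 𝓝 (g, h), 𝒢.tgt w.1 = 𝒢.src w.2 → m w = 𝒢.tmul w.1 w.2 := by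
  let _ := FiberProduct.chartedSpace hG.tgt_submersion hG.src_submersion.contMDiff
  obtain ⟨m, hm, hm'⟩ := FiberProduct.exists_extension hG.tgt_submersion
    hG.src_submersion.contMDiff (fun z : FiberProduct 𝒢.tgt 𝒢.src => 𝒢.mul z.1.1 z.1.2 z.2)
    ⟨(g, h), e⟩ (hG.mul_smooth.smoothNear _)
  exact ⟨m, hm, hm'.mono fun w hw e => (hw e).trans (𝒢.tmul_eq e).symm⟩

/-- The total product need not be continuous near a composable pair; along maps with composable
values it agrees with a local smooth extension of the product. -/
theorem smoothNear_tmul {u w : W → G} {x : W} (hu : SmoothNear I 𝓘(ℝ, EG) u x)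
    (hw : SmoothNear I 𝓘(ℝ, EG) w x) (e : ∀ᶠ y in 𝓝 x, 𝒢.tgt (u y) = 𝒢.src (w y)) :
    SmoothNear I 𝓘(ℝ, EG) (fun y => 𝒢.tmul (u y) (w y)) x := by
  obtain ⟨m, hm, hm'⟩ := hG.exists_extension_mul e.self_of_nhds
  refine (hm.comp_of_eq (hu.prodMk hw) rfl).congr ?_
  filter_upwards [e, (hu.prodMk hw).continuousAt.eventually hm'] with y h1 h2 using (h2 h1).symm

theorem isStationaryAt_tmul {u w : ℝ → G} {t : ℝ} (hu : IsStationaryAt 𝓘(ℝ, EG) u t)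
    (hw : IsStationaryAt 𝓘(ℝ, EG) w t) (e : ∀ᶠ τ in 𝓝 t, 𝒢.tgt (u τ) = 𝒢.src (w τ)) :
    IsStationaryAt 𝓘(ℝ, EG) (fun τ => 𝒢.tmul (u τ) (w τ)) t := by
  obtain ⟨m, hm, hm'⟩ := hG.exists_extension_mul e.self_of_nhds
  have h := hu.prodMk hw
  refine (h.map hm rfl).congr ?_
  filter_upwards [e, (HasMFDerivAt.continuousAt h).eventually hm'] with τ h1 h2 using (h2 h1).symm

theorem smoothNear_src (g : G) : SmoothNear 𝓘(ℝ, EG) 𝓘(ℝ, EP) 𝒢.src g :=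
  hG.src_submersion.contMDiff.smoothNear g

theorem smoothNear_tgt (g : G) : SmoothNear 𝓘(ℝ, EG) 𝓘(ℝ, EP) 𝒢.tgt g :=
  hG.tgt_submersion.contMDiff.smoothNear g

theorem smoothNear_inv (g : G) : SmoothNear 𝓘(ℝ, EG) 𝓘(ℝ, EG) 𝒢.inv g := hG.inv_smooth.smoothNear g

theorem smoothNear_one (p : P) : SmoothNear 𝓘(ℝ, EP) 𝓘(ℝ, EG) 𝒢.one p := hG.one_smooth.smoothNear p

end ArrowGroupoid.IsLie

/-! ### Core boxes and their product -/

namespace DoubleGroupoid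

section CoreBox

variable {P V H B : Type*} (D : DoubleGroupoid P V H B)

/-- The top and right sides of the box `A` are identities at `p`. -/
structure IsCoreBox (A : B) (p : P) : Prop where
  top_eq : D.top A = D.horiz.one p
  right_eq : D.right A = D.vert.one p

/-- The identity box at `p`. -/
def unitBox (p : P) : B := D.boxH.one (D.vert.one p)

theorem isCoreBox_unitBox (p : P) : D.IsCoreBox (D.unitBox p) p :=
  ⟨by rw [unitBox, top_oneH, D.vert.src_one], D.right_oneH _⟩

theorem left_unitBox (p : P) : D.left (D.unitBox p) = D.vert.one p := D.left_oneH _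

theorem bot_unitBox (p : P) : D.bot (D.unitBox p) = D.horiz.one p := by
  rw [unitBox, bot_oneH, D.vert.tgt_one]

theorem isCoreBox_core (E : D.Core) : D.IsCoreBox E.1 (D.coreTgt E) := ⟨top_core E, right_core E⟩

variable {D}

namespace IsCoreBox

variable {A C : B} {p q : P}

theorem src_left (h : D.IsCoreBox A p) : D.vert.src (D.left A) = p := by
  rw [D.top_left, ← top, h.top_eq, D.horiz.src_one]

theorem tgt_bot (h : D.IsCoreBox A p) : D.horiz.tgt (D.bot A) = p := by
  rw [← D.bot_right, ← right, h.right_eq, D.vert.tgt_one]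

/-- Every use of slimness in the proof goes through this statement. -/
theorem ext (hs : D.IsSlim) (hA : D.IsCoreBox A p) (hC : D.IsCoreBox C p)
    (hl : D.left A = D.left C) (hb : D.bot A = D.bot C) : A = C :=
  hs (by simp only [hl, hb, hA.top_eq, hC.top_eq, hA.right_eq, hC.right_eq])

end IsCoreBox

variable (D)

/-- The product of core boxes, for arbitrary boxes. -/
noncomputable def boxComp (A C : B) : B :=
  D.boxV.tmul (D.boxH.tmul (D.boxH.one (D.left C)) C) (D.boxH.tmul A (D.boxV.one (D.bot C)))

variable {D} {A C : B} {p q : P}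

namespace IsCoreBox

variable (hA : D.IsCoreBox A q) (hC : D.IsCoreBox C p) (e : D.vert.tgt (D.left C) = q)

include hA hC e

theorem boxComp_aux :
    D.right A = D.left (D.boxV.one (D.bot C)) ∧
      D.bot (D.boxH.tmul (D.boxH.one (D.left C)) C) =
        D.top (D.boxH.tmul A (D.boxV.one (D.bot C))) := by
  have e1 : D.horiz.src (D.bot C) = q := by rw [← D.bot_left, ← left, e]
  have e2 : D.right A = D.left (D.boxV.one (D.bot C)) := by rw [left_oneV, hA.right_eq, e1]
  refine ⟨e2, ?_⟩
  rw [D.bot_tmul (D.right_oneH _), D.top_tmul e2, bot_oneH, top_oneV, hA.top_eq, e]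

theorem left_boxComp : D.left (D.boxComp A C) = D.vert.tmul (D.left C) (D.left A) := by
  obtain ⟨e2, e3⟩ := boxComp_aux hA hC e
  rw [boxComp, D.left_tmul e3, left_tmulH, left_tmulH, left_oneH]

theorem bot_boxComp : D.bot (D.boxComp A C) = D.horiz.tmul (D.bot A) (D.bot C) := by
  obtain ⟨e2, e3⟩ := boxComp_aux hA hC e
  rw [boxComp, D.bot_tmulV e3, D.bot_tmul e2, bot_oneV]

theorem boxComp : D.IsCoreBox (D.boxComp A C) p := by
  obtain ⟨e2, e3⟩ := boxComp_aux hA hC e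
  constructor
  · rw [DoubleGroupoid.boxComp, top_tmulV, D.top_tmul (D.right_oneH _), top_oneH, hC.top_eq,
      hC.src_left, D.horiz.one_tmul (D.horiz.src_one p).symm]
  · rw [DoubleGroupoid.boxComp, D.right_tmul e3, D.right_tmulH (D.right_oneH _), D.right_tmulH e2,
      right_oneV, hC.tgt_bot, hC.right_eq, D.vert.one_tmul (D.vert.src_one p).symm]

end IsCoreBox

theorem IsCoreBox.unitBox_boxComp (hs : D.IsSlim) (hC : D.IsCoreBox C p)
    (e : D.vert.tgt (D.left C) = q) : D.boxComp (D.unitBox q) C = C := by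
  have hq := D.isCoreBox_unitBox q
  refine IsCoreBox.ext hs (hq.boxComp hC e) hC ?_ ?_
  · rw [IsCoreBox.left_boxComp hq hC e, left_unitBox, D.vert.tmul_one e]
  · rw [IsCoreBox.bot_boxComp hq hC e, bot_unitBox, D.horiz.one_tmul]
    rw [← e, D.bot_left]

theorem IsCoreBox.boxComp_unitBox (hs : D.IsSlim) (hA : D.IsCoreBox A q) :
    D.boxComp A (D.unitBox q) = A := by
  have hq := D.isCoreBox_unitBox q
  have e : D.vert.tgt (D.left (D.unitBox q)) = q := by rw [left_unitBox, D.vert.tgt_one]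
  refine IsCoreBox.ext hs (hA.boxComp hq e) hA ?_ ?_
  · rw [IsCoreBox.left_boxComp hA hq e, left_unitBox, D.vert.one_tmul hA.src_left.symm]
  · rw [IsCoreBox.bot_boxComp hA hq e, bot_unitBox, D.horiz.tmul_one hA.tgt_bot]

end CoreBox

/-! ### Local coordinates on the core boxes -/

section CoreChart

open Manifold Filter

variable {EP EV EH EB P V H B : Type*} [NormedAddCommGroup EP] [NormedSpace ℝ EP]
  [NormedAddCommGroup EV] [NormedSpace ℝ EV] [NormedAddCommGroup EH] [NormedSpace ℝ EH]
  [NormedAddCommGroup EB] [NormedSpace ℝ EB]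
  [TopologicalSpace P] [ChartedSpace EP P] [IsManifold 𝓘(ℝ, EP) ∞ P]
  [TopologicalSpace V] [ChartedSpace EV V] [IsManifold 𝓘(ℝ, EV) ∞ V]
  [TopologicalSpace H] [ChartedSpace EH H] [IsManifold 𝓘(ℝ, EH) ∞ H]
  [TopologicalSpace B] [ChartedSpace EB B] [IsManifold 𝓘(ℝ, EB) ∞ B]
  {D : DoubleGroupoid P V H B} (hD : D.IsLie EP EV EH EB)

/-- The model space of the fibres of the double source map. -/
abbrev IsLie.CoreModel (hD : D.IsLie EP EV EH EB) : Type _ :=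
  letI := FiberProduct.chartedSpace hD.horiz_lie.src_submersion
    hD.vert_lie.src_submersion.contMDiff
  hD.doubleSource_submersion.complement

include hD

theorem IsLie.smoothNear_boxComp {EW HW W : Type*} [NormedAddCommGroup EW] [NormedSpace ℝ EW]
    [TopologicalSpace HW] {I : ModelWithCorners ℝ EW HW} [TopologicalSpace W] [ChartedSpace HW W]
    {u w : W → B} {p : W → P} {x : W} (hu : SmoothNear I 𝓘(ℝ, EB) u x)
    (hw : SmoothNear I 𝓘(ℝ, EB) w x)
    (hu' : ∀ᶠ y in 𝓝 x, D.IsCoreBox (u y) (D.vert.tgt (D.left (w y))))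
    (hw' : ∀ᶠ y in 𝓝 x, D.IsCoreBox (w y) (p y)) :
    SmoothNear I 𝓘(ℝ, EB) (fun y => D.boxComp (u y) (w y)) x := by
  have h1 := (hD.boxH_lie.smoothNear_one _).comp ((hD.boxH_lie.smoothNear_src _).comp hw)
  have h2 := (hD.boxV_lie.smoothNear_one _).comp ((hD.boxV_lie.smoothNear_tgt _).comp hw)
  refine hD.boxV_lie.smoothNear_tmul (hD.boxH_lie.smoothNear_tmul h1 hw ?_)
    (hD.boxH_lie.smoothNear_tmul hu h2 ?_) ?_
  · exact Eventually.of_forall fun y => D.boxH.tgt_one _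
  · filter_upwards [hu', hw'] with y h3 h4 using (IsCoreBox.boxComp_aux h3 h4 rfl).1
  · filter_upwards [hu', hw'] with y h3 h4 using (IsCoreBox.boxComp_aux h3 h4 rfl).2

/-- Local coordinates for the core boxes near `A`. -/
theorem IsLie.exists_coreChart {A : B} {p : P} (hA : D.IsCoreBox A p) :
    ∃ (α : P × hD.CoreModel → B) (γ : B → hD.CoreModel),
      SmoothNear (𝓘(ℝ, EP).prod 𝓘(ℝ, hD.CoreModel)) 𝓘(ℝ, EB) α (p, γ A) ∧
      SmoothNear 𝓘(ℝ, EB) 𝓘(ℝ, hD.CoreModel) γ A ∧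
      (∀ᶠ w in 𝓝 (p, γ A), D.IsCoreBox (α w) w.1 ∧ γ (α w) = w.2) ∧
      ∀ᶠ C in 𝓝 A, ∀ q, D.IsCoreBox C q → α (q, γ C) = C := by
  let _ := FiberProduct.chartedSpace hD.horiz_lie.src_submersion
    hD.vert_lie.src_submersion.contMDiff
  have := FiberProduct.isManifold hD.horiz_lie.src_submersion hD.vert_lie.src_submersion.contMDiff
  -- A box is a core box at q exactly when its horizontal inverse has double source `ι q`. Thus the
  -- core is, up to inversion, the preimage of `ι P` under a submersion, and is parametrized by the
  -- vertex and the fibre coordinate.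
  let ι : P → FiberProduct D.horiz.src D.vert.src := fun y =>
    ⟨(D.horiz.one y, D.vert.one y), by rw [D.horiz.src_one, D.vert.src_one]⟩
  have hι : ∀ y, SmoothNear 𝓘(ℝ, EP) 𝓘(ℝ, EV × hD.horiz_lie.src_submersion.complement) ι y :=
    fun y => (FiberProduct.smoothNear_iff hD.horiz_lie.src_submersion
      hD.vert_lie.src_submersion.contMDiff ι y).2
      ((hD.horiz_lie.smoothNear_one y).prodMk (hD.vert_lie.smoothNear_one y))
  have hds : ∀ {C : B} {q : P}, D.IsCoreBox C q → D.doubleSource (D.boxH.inv C) = ι q := by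
    intro C q hC
    refine Subtype.ext (Prod.ext ?_ ?_)
    · exact (D.top_inv C).trans (by rw [hC.top_eq, D.horiz.inv_one])
    · exact (D.left_invH C).trans hC.right_eq
  obtain ⟨γ, S, hγ, hS, hSs, hsS⟩ :=
    (hD.doubleSource_submersion.isSubmersionOfComplement_complement.isSubmersionAt
      (D.boxH.inv A)).exists_localInverse
  have hinv := fun C => hD.boxH_lie.smoothNear_inv C
  have hpair : SmoothNear (𝓘(ℝ, EP).prod 𝓘(ℝ, hD.CoreModel))
      (𝓘(ℝ, EV × hD.horiz_lie.src_submersion.complement).prod 𝓘(ℝ, hD.CoreModel))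
      (fun w : P × hD.CoreModel => (ι w.1, w.2)) (p, γ (D.boxH.inv A)) :=
    (SmoothNear.comp (g := ι) (hι _) (smoothNear_fst _)).prodMk (smoothNear_snd _)
  have hp : (ι p, γ (D.boxH.inv A)) = (D.doubleSource (D.boxH.inv A), γ (D.boxH.inv A)) := by
    rw [hds hA]
  refine ⟨fun w => D.boxH.inv (S (ι w.1, w.2)), fun C => γ (D.boxH.inv C),
    (hinv _).comp (hS.comp_of_eq hpair hp), SmoothNear.comp (g := γ) hγ (hinv A), ?_, ?_⟩
  · have ht : Tendsto (fun w : P × hD.CoreModel => (ι w.1, w.2)) (𝓝 (p, γ (D.boxH.inv A)))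
        (𝓝 (D.doubleSource (D.boxH.inv A), γ (D.boxH.inv A))) := by
      rw [← hp]; exact hpair.continuousAt
    filter_upwards [ht.eventually hsS] with w hw
    have h1 : D.top (S (ι w.1, w.2)) = D.horiz.one w.1 := congrArg (fun z => z.1.1) hw.1
    have h2 : D.left (S (ι w.1, w.2)) = D.vert.one w.1 := congrArg (fun z => z.1.2) hw.1
    refine ⟨⟨?_, ?_⟩, ?_⟩
    · rw [D.top_inv, h1, D.horiz.inv_one]
    · rw [D.right_invH, h2]
    · rw [D.boxH.inv_inv]
      exact hw.2
  · filter_upwards [(hinv A).continuousAt.eventually hSs] with C hC q hq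
    rw [← hds hq, hC, D.boxH.inv_inv]

theorem IsLie.smoothNear_unitBox (p : P) : SmoothNear 𝓘(ℝ, EP) 𝓘(ℝ, EB) D.unitBox p :=
  (hD.boxH_lie.smoothNear_one _).comp (hD.vert_lie.smoothNear_one p)

end CoreChart

section UnitChart

open Manifold Filter

variable {EP EV EH EB P V H B : Type*} [NormedAddCommGroup EP] [NormedSpace ℝ EP]
  [NormedAddCommGroup EV] [NormedSpace ℝ EV] [NormedAddCommGroup EH] [NormedSpace ℝ EH]
  [NormedAddCommGroup EB] [NormedSpace ℝ EB]
  [TopologicalSpace P] [ChartedSpace EP P] [IsManifold 𝓘(ℝ, EP) ∞ P]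
  [TopologicalSpace V] [ChartedSpace EV V] [IsManifold 𝓘(ℝ, EV) ∞ V]
  [TopologicalSpace H] [ChartedSpace EH H] [IsManifold 𝓘(ℝ, EH) ∞ H]
  [TopologicalSpace B] [ChartedSpace EB B] [IsManifold 𝓘(ℝ, EB) ∞ B]
  {D : DoubleGroupoid P V H B}

/-- Local coordinates for the core boxes near an identity box, in which the identity boxes form the
zero section. -/
structure IsLie.IsUnitChart (hD : D.IsLie EP EV EH EB) (p : P) (α : P × hD.CoreModel → B)
    (γ : B → hD.CoreModel) : Prop where
  smoothNear_param : SmoothNear (𝓘(ℝ, EP).prod 𝓘(ℝ, hD.CoreModel)) 𝓘(ℝ, EB) α (p, 0)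
  smoothNear_coord : SmoothNear 𝓘(ℝ, EB) 𝓘(ℝ, hD.CoreModel) γ (D.unitBox p)
  param_zero : ∀ᶠ y in 𝓝 p, α (y, 0) = D.unitBox y
  coord_unitBox : γ (D.unitBox p) = 0
  isCoreBox_param : ∀ᶠ w in 𝓝 (p, 0), D.IsCoreBox (α w) w.1
  coord_param : ∀ᶠ w in 𝓝 (p, 0), γ (α w) = w.2
  param_coord : ∀ᶠ C in 𝓝 (D.unitBox p), ∀ q, D.IsCoreBox C q → α (q, γ C) = C

/-- Subtracting the coordinate of the unit box moves the units to the zero section. -/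
theorem IsLie.exists_isUnitChart (hD : D.IsLie EP EV EH EB) (p : P) :
    ∃ (α : P × hD.CoreModel → B) (γ : B → hD.CoreModel), hD.IsUnitChart p α γ := by
  obtain ⟨α, γ, hα, hγ, hαγ, hγα⟩ := hD.exists_coreChart (D.isCoreBox_unitBox p)
  have hu := hD.smoothNear_unitBox p
  have hb : D.horiz.tgt (D.bot (D.unitBox p)) = p := (D.isCoreBox_unitBox p).tgt_bot
  have hγu : SmoothNear 𝓘(ℝ, EP) 𝓘(ℝ, hD.CoreModel) (fun y => γ (D.unitBox y)) p := hγ.comp hu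
  have hadd := fun w : hD.CoreModel × hD.CoreModel =>
    (contDiff_fst.add contDiff_snd : ContDiff ℝ ∞ fun w : hD.CoreModel × hD.CoreModel =>
      w.1 + w.2).smoothNear w
  have hsub := fun w : hD.CoreModel × hD.CoreModel =>
    (contDiff_fst.sub contDiff_snd : ContDiff ℝ ∞ fun w : hD.CoreModel × hD.CoreModel =>
      w.1 - w.2).smoothNear w
  have hpair : SmoothNear (𝓘(ℝ, EP).prod 𝓘(ℝ, hD.CoreModel))
      (𝓘(ℝ, EP).prod 𝓘(ℝ, hD.CoreModel))
      (fun w : P × hD.CoreModel => (w.1, w.2 + γ (D.unitBox w.1))) (p, 0) := by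
    refine (smoothNear_fst _).prodMk ?_
    exact (hadd _).comp ((smoothNear_snd _).prodMk_space
      (SmoothNear.comp (f := Prod.fst) hγu (smoothNear_fst (p, (0 : hD.CoreModel)))))
  have hp : (p, 0 + γ (D.unitBox p)) = (p, γ (D.unitBox p)) := by rw [zero_add]
  have hbot : SmoothNear 𝓘(ℝ, EB) 𝓘(ℝ, EP) (fun C => D.horiz.tgt (D.bot C)) (D.unitBox p) :=
    (hD.horiz_lie.smoothNear_tgt _).comp (hD.boxV_lie.smoothNear_tgt _)
  have ht : Tendsto (fun w : P × hD.CoreModel => (w.1, w.2 + γ (D.unitBox w.1))) (𝓝 (p, 0))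
      (𝓝 (p, γ (D.unitBox p))) := by rw [← hp]; exact hpair.continuousAt
  -- The coordinate must be smooth on all boxes near the unit, so the vertex is read off as the
  -- right end of the bottom, which is right for core boxes.
  refine ⟨fun w => α (w.1, w.2 + γ (D.unitBox w.1)),
    fun C => γ C - γ (D.unitBox (D.horiz.tgt (D.bot C))), hα.comp_of_eq hpair hp,
    (hsub _).comp (hγ.prodMk_space (hγu.comp_of_eq hbot hb)), ?_, by simp only [hb, sub_self], ?_, ?_, ?_⟩
  · filter_upwards [hu.continuousAt.eventually hγα] with y hy
    rw [zero_add, hy y (D.isCoreBox_unitBox y)]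
  · filter_upwards [ht.eventually hαγ] with w hw
    exact hw.1
  · filter_upwards [ht.eventually hαγ] with w hw
    rw [hw.2, hw.1.tgt_bot, add_sub_cancel_right]
  · filter_upwards [hγα] with C hC q hq
    simp only [hq.tgt_bot, sub_add_cancel]
    exact hC q hq

end UnitChart

end DoubleGroupoid

/-! ### Infinitesimal slimness by flowing along an invariant vector field -/

section Flow

open Filter

/-- If `N (c, 0) = c`, then the vector field `c ↦ ∂N/∂τ (c, 0)` has an integral curve through
zero. -/
theorem exists_curve_of_family {F : Type*} [NormedAddCommGroup F] [NormedSpace ℝ F]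
    [CompleteSpace F] {N : F × ℝ → F} {v : F} (hN : SmoothNear 𝓘(ℝ, F × ℝ) 𝓘(ℝ, F) N (0, 0))
    (hv : HasDerivAt (fun τ => N (0, τ)) v 0) :
    ∃ c : ℝ → F, c 0 = 0 ∧ HasDerivAt c v 0 ∧ ∀ᶠ t in 𝓝 0, ∃ w, HasDerivAt c w t ∧
      HasDerivAt (fun τ => N (c t, τ)) w 0 := by
  let X : F → F := fun c => fderiv ℝ N (c, 0) (0, 1)
  have hX : ContDiffAt ℝ 1 X 0 := by
    have h1 : ContDiffAt ℝ 1 (fderiv ℝ N) ((fun c : F => (c, (0 : ℝ))) 0) :=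
      hN.contDiffAt.fderiv_right (by norm_cast)
    exact (h1.comp (0 : F) (contDiffAt_id.prodMk contDiffAt_const)).clm_apply contDiffAt_const
  have hd : ∀ c, ContMDiffAt 𝓘(ℝ, F × ℝ) 𝓘(ℝ, F) ∞ N (c, 0) →
      HasDerivAt (fun τ => N (c, τ)) (X c) 0 := by
    intro c hc
    have h1 : HasFDerivAt N (fderiv ℝ N (c, 0)) ((fun τ : ℝ => (c, τ)) 0) :=
      (hc.contDiffAt.differentiableAt (by simp)).hasFDerivAt
    exact h1.comp_hasDerivAt (0 : ℝ) ((hasDerivAt_const _ _).prodMk (hasDerivAt_id _))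
  have hX0 : X 0 = v := (hd 0 hN.contMDiffAt).unique hv
  obtain ⟨c, hc0, ε, hε, hc⟩ :=
    hX.exists_forall_mem_closedBall_exists_eq_forall_mem_Ioo_hasDerivAt₀ 0
  have h0 := hc 0 (by constructor <;> linarith)
  refine ⟨c, hc0, by simpa only [hc0, hX0] using h0, ?_⟩
  have hcont : Tendsto (fun t => (c t, (0 : ℝ))) (𝓝 0) (𝓝 (0, 0)) := by
    have := (h0.continuousAt.prodMk (continuousAt_const (y := (0 : ℝ)))).tendsto
    rwa [hc0] at this
  filter_upwards [hcont.eventually hN, Ioo_mem_nhds (a := (0 : ℝ) - ε) (b := 0 + ε) (by linarith)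
    (by linarith)] with t ht ht'
  exact ⟨X (c t), hc t ht', hd _ ht⟩

end Flow

namespace DoubleGroupoid

section Immersion

open Manifold Filter

variable {EP EV EH EB P V H B : Type*} [NormedAddCommGroup EP] [NormedSpace ℝ EP]
  [NormedAddCommGroup EV] [NormedSpace ℝ EV] [NormedAddCommGroup EH] [NormedSpace ℝ EH]
  [NormedAddCommGroup EB] [NormedSpace ℝ EB]
  [TopologicalSpace P] [ChartedSpace EP P] [IsManifold 𝓘(ℝ, EP) ∞ P]
  [TopologicalSpace V] [ChartedSpace EV V] [IsManifold 𝓘(ℝ, EV) ∞ V]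
  [TopologicalSpace H] [ChartedSpace EH H] [IsManifold 𝓘(ℝ, EH) ∞ H]
  [TopologicalSpace B] [ChartedSpace EB B] [IsManifold 𝓘(ℝ, EB) ∞ B]
  {D : DoubleGroupoid P V H B} {hD : D.IsLie EP EV EH EB}

namespace IsLie.IsUnitChart

variable {p : P} {α : P × hD.CoreModel → B} {γ : B → hD.CoreModel} (hc : hD.IsUnitChart p α γ)

include hc

theorem param_self : α (p, 0) = D.unitBox p := hc.param_zero.self_of_nhds

/-- If the first-order variation of the left and bottom sides vanishes in a direction of the core,
then so does this direction: the infinitesimal version of slimness. -/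
theorem eq_zero_of_isStationaryAt [CompleteSpace hD.CoreModel] (hs : D.IsSlim) {v : hD.CoreModel}
    (hl : IsStationaryAt 𝓘(ℝ, EV) (fun τ : ℝ => D.left (α (p, τ • v))) 0)
    (hb : IsStationaryAt 𝓘(ℝ, EH) (fun τ : ℝ => D.bot (α (p, τ • v))) 0) : v = 0 := by
  let E : ℝ → B := fun τ => α (p, τ • v)
  let q : ℝ → P := fun τ => D.vert.tgt (D.left (E τ))
  -- The core box with coordinates c multiplied by `E τ`. It has to be based at `q τ`, the core
  -- source of `E τ`, in order to be composable; the product always has target `p`.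
  let A : hD.CoreModel × ℝ → B := fun w => D.boxComp (α (q w.2, w.1)) (E w.2)
  have hE0 : E 0 = D.unitBox p := by simp only [E, zero_smul, hc.param_self]
  have hq0 : q 0 = p := by simp only [q, hE0, left_unitBox, D.vert.tgt_one]
  have hsm : ContDiff ℝ ∞ fun τ : ℝ => τ • v := contDiff_id.smul contDiff_const
  have hpv : SmoothNear 𝓘(ℝ, ℝ) (𝓘(ℝ, EP).prod 𝓘(ℝ, hD.CoreModel))
      (fun τ : ℝ => (p, τ • v)) 0 := (smoothNear_const p 0).prodMk (hsm.smoothNear 0)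
  have hpv0 : (p, (0 : ℝ) • v) = (p, 0) := by rw [zero_smul]
  have hE : SmoothNear 𝓘(ℝ, ℝ) 𝓘(ℝ, EB) E 0 := hc.smoothNear_param.comp_of_eq hpv hpv0
  have hq : SmoothNear 𝓘(ℝ, ℝ) 𝓘(ℝ, EP) q 0 :=
    (hD.vert_lie.smoothNear_tgt _).comp ((hD.boxH_lie.smoothNear_src _).comp hE)
  have hpt : Tendsto (fun τ : ℝ => (p, τ • v)) (𝓝 0) (𝓝 (p, 0)) := by
    rw [← hpv0]; exact hpv.continuousAt
  have hEc : ∀ᶠ τ in 𝓝 (0 : ℝ), D.IsCoreBox (E τ) p := hpt.eventually hc.isCoreBox_param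
  have hsnd : SmoothNear 𝓘(ℝ, hD.CoreModel × ℝ) 𝓘(ℝ, ℝ) Prod.snd ((0 : hD.CoreModel), (0 : ℝ)) :=
    contDiff_snd.smoothNear _
  have hqc : SmoothNear 𝓘(ℝ, hD.CoreModel × ℝ) (𝓘(ℝ, EP).prod 𝓘(ℝ, hD.CoreModel))
      (fun w : hD.CoreModel × ℝ => (q w.2, w.1)) (0, 0) :=
    (SmoothNear.comp_of_eq hq hsnd rfl).prodMk (contDiff_fst.smoothNear _)
  have hqc0 : (q ((0 : hD.CoreModel), (0 : ℝ)).2, (0 : hD.CoreModel)) = (p, 0) := by rw [hq0]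
  have hqt : Tendsto (fun w : hD.CoreModel × ℝ => (q w.2, w.1)) (𝓝 (0, 0)) (𝓝 (p, 0)) := by
    rw [← hqc0]; exact hqc.continuousAt
  have hqcore := hqt.eventually hc.isCoreBox_param
  have hEc2 : ∀ᶠ w in 𝓝 ((0 : hD.CoreModel), (0 : ℝ)), D.IsCoreBox (E w.2) p :=
    hsnd.continuousAt.eventually hEc
  have hA0 : A (0, 0) = D.unitBox p := by
    simp only [A, hE0, hq0, hc.param_self]
    exact IsCoreBox.boxComp_unitBox hs (D.isCoreBox_unitBox p)
  have hA : SmoothNear 𝓘(ℝ, hD.CoreModel × ℝ) 𝓘(ℝ, EB) A (0, 0) :=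
    hD.smoothNear_boxComp (p := fun _ => p) (hc.smoothNear_param.comp_of_eq hqc hqc0)
      (SmoothNear.comp_of_eq hE hsnd rfl) hqcore hEc2
  have hAcore : ∀ᶠ w in 𝓝 ((0 : hD.CoreModel), (0 : ℝ)), D.IsCoreBox (A w) p := by
    filter_upwards [hqcore, hEc2] with w h1 h2 using h1.boxComp h2 rfl
  have hN : SmoothNear 𝓘(ℝ, hD.CoreModel × ℝ) 𝓘(ℝ, hD.CoreModel) (fun w => γ (A w)) (0, 0) :=
    hc.smoothNear_coord.comp_of_eq hA hA0
  -- For c = 0 the other factor is a unit, so the family is `E τ` itself, with coordinates `τ • v`.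
  have hv : HasDerivAt (fun τ => γ (A (0, τ))) v 0 := by
    refine (((hasDerivAt_id (0 : ℝ)).smul_const v).congr_deriv (one_smul ℝ v)).congr_of_eventuallyEq
      ?_
    have hqp : Tendsto q (𝓝 0) (𝓝 p) := by
      have := hq.continuousAt.tendsto
      rwa [hq0] at this
    filter_upwards [hqp.eventually hc.param_zero, hpt.eventually hc.coord_param, hEc] with τ h1 h2 h3
    simp only [A, h1, id]
    rw [IsCoreBox.unitBox_boxComp hs h3 rfl]
    exact h2
  obtain ⟨c, hc0, hcv, hcw⟩ := exists_curve_of_family hN hv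
  have hct : Tendsto c (𝓝 0) (𝓝 0) := by
    have := hcv.continuousAt.tendsto
    rwa [hc0] at this
  have hpc : Tendsto (fun d : hD.CoreModel => (p, d)) (𝓝 0) (𝓝 (p, 0)) :=
    (continuous_const.prodMk continuous_id).continuousAt
  have hαA : ∀ᶠ w in 𝓝 ((0 : hD.CoreModel), (0 : ℝ)), α (p, γ (A w)) = A w := by
    have : Tendsto A (𝓝 (0, 0)) (𝓝 (D.unitBox p)) := by rw [← hA0]; exact hA.continuousAt
    filter_upwards [this.eventually hc.param_coord, hAcore] with w h1 h2 using h1 p h2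
  have hqs : IsStationaryAt 𝓘(ℝ, EP) q 0 := hl.map (hD.vert_lie.smoothNear_tgt _) rfl
  have hqd : ∀ d : hD.CoreModel, SmoothNear 𝓘(ℝ, EP) (𝓘(ℝ, EP).prod 𝓘(ℝ, hD.CoreModel))
      (fun y : P => (y, d)) p := fun d => (smoothNear_id p).prodMk (smoothNear_const d p)
  -- The sides of the product are products of the sides of `E τ` and of `α (q τ, d)`. Both factors
  -- are stationary at τ = 0, the second one because `q` is. Hence left and bottom sides have zero
  -- derivative along the vector field, at every d near 0.
  have key : ∀ᶠ d in 𝓝 (0 : hD.CoreModel),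
      γ (A (d, 0)) = d ∧ IsStationaryAt 𝓘(ℝ, EV) (fun τ => D.left (α (p, γ (A (d, τ))))) 0 ∧
        IsStationaryAt 𝓘(ℝ, EH) (fun τ => D.bot (α (p, γ (A (d, τ))))) 0 := by
    filter_upwards [hαA.curry_nhds, hqcore.curry_nhds, hpc.eventually hc.coord_param,
      hpc.eventually hc.isCoreBox_param, hpc.eventually hc.smoothNear_param.eventually] with
      d h1 h2 h3 h4 h5
    have hα0 : ∀ (d : hD.CoreModel), (q 0, d) = (p, d) := fun d => by rw [hq0]
    refine ⟨?_, ?_, ?_⟩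
    · simp only [A, hE0, hq0]
      rw [IsCoreBox.boxComp_unitBox hs h4]
      exact h3
    · have h6 : IsStationaryAt 𝓘(ℝ, EV) (fun τ => D.left (α (q τ, d))) 0 :=
        hqs.map (((hD.boxH_lie.smoothNear_src _).comp (SmoothNear.comp (g := α) h5 (hqd d)))) hq0
      refine (hD.vert_lie.isStationaryAt_tmul hl h6 ?_).congr ?_
      · filter_upwards [h2] with τ h7 using h7.src_left.symm
      · filter_upwards [h1, h2, hEc] with τ h8 h9 h10
        rw [h8]
        exact IsCoreBox.left_boxComp h9 h10 rfl
    · have h6 : IsStationaryAt 𝓘(ℝ, EH) (fun τ => D.bot (α (q τ, d))) 0 :=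
        hqs.map (((hD.boxV_lie.smoothNear_tgt _).comp (SmoothNear.comp (g := α) h5 (hqd d)))) hq0
      refine (hD.horiz_lie.isStationaryAt_tmul h6 hb ?_).congr ?_
      · filter_upwards [h2] with τ h7
        rw [h7.tgt_bot]
        exact D.bot_left (E τ)
      · filter_upwards [h1, h2, hEc] with τ h8 h9 h10
        rw [h8]
        exact IsCoreBox.bot_boxComp h9 h10 rfl
  have hpd : ∀ d : hD.CoreModel, SmoothNear 𝓘(ℝ, hD.CoreModel)
      (𝓘(ℝ, EP).prod 𝓘(ℝ, hD.CoreModel)) (fun d : hD.CoreModel => (p, d)) d :=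
    fun d => (smoothNear_const p d).prodMk (smoothNear_id d)
  -- At time t the integral curve has the velocity of `τ ↦ γ (A (c t, τ))` at 0, and only velocities
  -- matter.
  have hstat : ∀ᶠ t in 𝓝 (0 : ℝ), IsStationaryAt 𝓘(ℝ, EV) (fun t => D.left (α (p, c t))) t ∧
      IsStationaryAt 𝓘(ℝ, EH) (fun t => D.bot (α (p, c t))) t := by
    filter_upwards [hct.eventually key, hcw,
      (hpc.comp hct).eventually hc.smoothNear_param.eventually] with t h1 h2 h3
    obtain ⟨w, hw, hw'⟩ := h2
    obtain ⟨h4, h5, h6⟩ := h1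
    have h7 : SmoothNear 𝓘(ℝ, hD.CoreModel) 𝓘(ℝ, EB) (fun d => α (p, d)) (γ (A (c t, 0))) := by
      rw [h4]
      exact SmoothNear.comp (g := α) h3 (hpd _)
    exact ⟨IsStationaryAt.of_hasDerivAt (g := fun d => D.left (α (p, d)))
        ((hD.boxH_lie.smoothNear_src _).comp h7) h4.symm hw' hw h5,
      IsStationaryAt.of_hasDerivAt (g := fun d => D.bot (α (p, d)))
        ((hD.boxV_lie.smoothNear_tgt _).comp h7) h4.symm hw' hw h6⟩
  -- Both sides are constant along the curve, so slimness identifies each of its boxes with the unit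
  -- box.
  have hzero : c =ᶠ[𝓝 0] fun _ => 0 := by
    filter_upwards [eventually_eq_of_isStationaryAt (hstat.mono fun t h => h.1),
      eventually_eq_of_isStationaryAt (hstat.mono fun t h => h.2),
      (hpc.comp hct).eventually hc.isCoreBox_param, (hpc.comp hct).eventually hc.coord_param] with
      t h1 h2 h3 h4
    rw [hc0, hc.param_self] at h1 h2
    have : α (p, c t) = D.unitBox p := h3.ext hs (D.isCoreBox_unitBox p) h1 h2
    have h5 : γ (α (p, c t)) = c t := h4
    rw [← h5, this, hc.coord_unitBox]
  exact hcv.unique ((hasDerivAt_const (0 : ℝ) (0 : hD.CoreModel)).congr_of_eventuallyEq hzero)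

end IsLie.IsUnitChart

end Immersion

end DoubleGroupoid

/-! ### Linear complements and finite dimension -/

section Linear

open Module

/-- A complement of the range of an injective linear map. -/
theorem exists_continuousLinearEquiv_add {E F : Type*} [NormedAddCommGroup E] [NormedSpace ℝ E]
    [NormedAddCommGroup F] [NormedSpace ℝ F] [FiniteDimensional ℝ E] [FiniteDimensional ℝ F]
    (T : F →L[ℝ] E) (hT : Function.Injective T) :
    ∃ (L : EuclideanSpace ℝ (Fin (finrank ℝ E - finrank ℝ F)) →L[ℝ] E)
      (e : (EuclideanSpace ℝ (Fin (finrank ℝ E - finrank ℝ F)) × F) ≃L[ℝ] E),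
      ∀ w, e w = L w.1 + T w.2 := by
  obtain ⟨C, hC⟩ := Submodule.exists_isCompl (LinearMap.range T.toLinearMap)
  have hr : finrank ℝ (LinearMap.range T.toLinearMap) = finrank ℝ F :=
    LinearMap.finrank_range_of_inj hT
  have hd := Submodule.finrank_add_eq_of_isCompl hC
  let g : EuclideanSpace ℝ (Fin (finrank ℝ E - finrank ℝ F)) ≃ₗ[ℝ] C :=
    LinearEquiv.ofFinrankEq _ _ (by rw [finrank_euclideanSpace_fin]; omega)
  let k : F ≃ₗ[ℝ] LinearMap.range T.toLinearMap := LinearEquiv.ofInjective T.toLinearMap hT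
  let e := (g.prodCongr k).trans (Submodule.prodEquivOfIsCompl C _ hC.symm)
  refine ⟨(C.subtype.comp g.toLinearMap).toContinuousLinearMap, e.toContinuousLinearEquiv,
    fun w => ?_⟩
  simp [e, k]

end Linear

/-- At a point the complement is a factor of the model space; without a point it would be arbitrary.
-/
theorem Manifold.IsSubmersion.finiteDimensional_complement {EM EN M N : Type*}
    [NormedAddCommGroup EM] [NormedSpace ℝ EM] [NormedAddCommGroup EN] [NormedSpace ℝ EN]
    [TopologicalSpace M] [ChartedSpace EM M] [TopologicalSpace N] [ChartedSpace EN N]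
    [FiniteDimensional ℝ EM] {s : M → N} (hs : IsSubmersion 𝓘(ℝ, EM) 𝓘(ℝ, EN) ∞ s) (m : M) :
    FiniteDimensional ℝ hs.complement :=
  Module.Finite.of_surjective
    ((LinearMap.snd ℝ EN hs.complement).comp
      (hs.isSubmersionOfComplement_complement.isSubmersionAt m).equiv.toLinearEquiv.toLinearMap)
    (Prod.snd_surjective.comp
      (hs.isSubmersionOfComplement_complement.isSubmersionAt m).equiv.surjective)

namespace DoubleGroupoid

/-! ### The core action through boxes, its freeness and its derivative -/

section BoxAct

variable {P V H B : Type*} (D : DoubleGroupoid P V H B)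

/-- The core action, for arbitrary boxes. -/
noncomputable def boxAct (A : B) (z : D.CornerSpace) : D.CornerSpace :=
  open Classical in
  if e : D.vert.tgt z.1.1 = D.vert.src (D.left A) then
    ⟨(D.vert.tmul z.1.1 (D.left A), D.horiz.tmul (D.bot A) z.1.2), by
      rw [D.vert.tgt_tmul e, D.horiz.src_tmul, D.bot_left]⟩
  else z

variable {D}

theorem IsCoreBox.boxAct_val {A : B} {z : D.CornerSpace} (h : D.IsCoreBox A (D.vert.tgt z.1.1)) :
    (D.boxAct A z).1 = (D.vert.tmul z.1.1 (D.left A), D.horiz.tmul (D.bot A) z.1.2) := by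
  rw [boxAct, dif_pos h.src_left.symm]

theorem IsCoreBox.toDiag_boxAct {A : B} {z : D.CornerSpace}
    (h : D.IsCoreBox A (D.vert.tgt z.1.1)) : D.toDiag (D.boxAct A z) = D.toDiag z :=
  D.toDiag_eq_of_coreOrbit (D.coreOrbit_of_core h.top_eq h.right_eq rfl
    (congrArg Prod.fst h.boxAct_val) (congrArg Prod.snd h.boxAct_val))

theorem boxAct_unitBox (z : D.CornerSpace) : D.boxAct (D.unitBox (D.vert.tgt z.1.1)) z = z := by
  refine Subtype.ext ((D.isCoreBox_unitBox _).boxAct_val.trans (Prod.ext ?_ ?_))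
  · simp only [left_unitBox, D.vert.tmul_one]
  · simp only [bot_unitBox, D.horiz.one_tmul z.2]

/-- Passes from the action groupoid, in which properness is stated, to boxes acting by `boxAct`, in
which smoothness is expressed. -/
theorem isCoreBox_of_coreAnchor {a : FiberProduct D.coreTgt D.moment} {w z : D.CornerSpace}
    (h : D.coreAnchor a = (w, z)) :
    D.IsCoreBox a.1.1.1 (D.vert.tgt z.1.1) ∧ w = D.boxAct a.1.1.1 z := by
  obtain ⟨⟨E, z'⟩, e⟩ := a
  obtain ⟨rfl, rfl⟩ := Prod.ext_iff.1 h
  have hE : D.IsCoreBox E.1 (D.vert.tgt z'.1.1) := by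
    have := D.isCoreBox_core E
    rwa [show D.coreTgt E = D.vert.tgt z'.1.1 from e] at this
  exact ⟨hE, Subtype.ext (Eq.trans
    (b := (D.vert.tmul z'.1.1 (D.left E.1), D.horiz.tmul (D.bot E.1) z'.1.2))
    (Prod.ext (D.vert.tmul_eq _).symm (D.horiz.tmul_eq _).symm) hE.boxAct_val.symm)⟩

theorem exists_coreAnchor {w z : D.CornerSpace} (h : D.coreOrbit w z) :
    ∃ a, D.coreAnchor a = (w, z) := by
  obtain ⟨E, e, rfl⟩ := h
  exact ⟨⟨(E, z), e⟩, rfl⟩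

/-- The core action is free. -/
theorem IsCoreBox.eq_unitBox (hs : D.IsSlim) {A : B} {z : D.CornerSpace}
    (h : D.IsCoreBox A (D.vert.tgt z.1.1)) (hz : D.boxAct A z = z) :
    A = D.unitBox (D.vert.tgt z.1.1) := by
  have h1 := h.boxAct_val
  rw [hz] at h1
  refine h.ext hs (D.isCoreBox_unitBox _) ?_ ?_
  · rw [left_unitBox]
    exact D.vert.eq_one_of_tmul_eq_left h.src_left.symm (congrArg Prod.fst h1).symm
  · rw [bot_unitBox, D.horiz.eq_one_of_tmul_eq_right (h.tgt_bot.trans z.2)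
      (congrArg Prod.snd h1).symm, z.2]

end BoxAct

section Slice

open Manifold Filter Module

variable {EP EV EH EB P V H B : Type*} [NormedAddCommGroup EP] [NormedSpace ℝ EP]
  [NormedAddCommGroup EV] [NormedSpace ℝ EV] [NormedAddCommGroup EH] [NormedSpace ℝ EH]
  [NormedAddCommGroup EB] [NormedSpace ℝ EB]
  [TopologicalSpace P] [ChartedSpace EP P] [IsManifold 𝓘(ℝ, EP) ∞ P]
  [TopologicalSpace V] [ChartedSpace EV V] [IsManifold 𝓘(ℝ, EV) ∞ V]
  [TopologicalSpace H] [ChartedSpace EH H] [IsManifold 𝓘(ℝ, EH) ∞ H]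
  [TopologicalSpace B] [ChartedSpace EB B] [IsManifold 𝓘(ℝ, EB) ∞ B]
  {D : DoubleGroupoid P V H B} (hD : D.IsLie EP EV EH EB)

/-- The model space of `𝒱 ×_{b,l} ℋ`. -/
abbrev IsLie.CornerModel (hD : D.IsLie EP EV EH EB) : Type _ :=
  EH × hD.vert_lie.tgt_submersion.complement

/-- The smooth structure of `𝒱 ×_{b,l} ℋ`. -/
@[reducible] noncomputable def IsLie.cornerChartedSpace (hD : D.IsLie EP EV EH EB) :
    ChartedSpace hD.CornerModel D.CornerSpace :=
  FiberProduct.chartedSpace hD.vert_lie.tgt_submersion hD.horiz_lie.src_submersion.contMDiff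

include hD

theorem IsLie.isManifold_corner :
    letI := hD.cornerChartedSpace
    IsManifold 𝓘(ℝ, hD.CornerModel) ∞ D.CornerSpace :=
  FiberProduct.isManifold hD.vert_lie.tgt_submersion hD.horiz_lie.src_submersion.contMDiff

theorem IsLie.smoothNear_corner_iff {EW HW W : Type*} [NormedAddCommGroup EW] [NormedSpace ℝ EW]
    [TopologicalSpace HW] {I : ModelWithCorners ℝ EW HW} [TopologicalSpace W] [ChartedSpace HW W]
    {u : W → D.CornerSpace} {x : W} :
    letI := hD.cornerChartedSpace
    SmoothNear I 𝓘(ℝ, hD.CornerModel) u x ↔ SmoothNear I 𝓘(ℝ, EV) (fun y => (u y).1.1) x ∧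
      SmoothNear I 𝓘(ℝ, EH) (fun y => (u y).1.2) x := by
  let _ := hD.cornerChartedSpace
  refine (FiberProduct.smoothNear_iff hD.vert_lie.tgt_submersion
    hD.horiz_lie.src_submersion.contMDiff u x).trans ⟨fun h => ⟨h.fst, h.snd⟩, fun h => ?_⟩
  exact h.1.prodMk h.2

theorem IsLie.smoothNear_boxAct {EW HW W : Type*} [NormedAddCommGroup EW] [NormedSpace ℝ EW]
    [TopologicalSpace HW] {I : ModelWithCorners ℝ EW HW} [TopologicalSpace W] [ChartedSpace HW W]
    {u : W → B} {w : W → D.CornerSpace} {x : W} (hu : SmoothNear I 𝓘(ℝ, EB) u x)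
    (hw : letI := hD.cornerChartedSpace; SmoothNear I 𝓘(ℝ, hD.CornerModel) w x)
    (h : ∀ᶠ y in 𝓝 x, D.IsCoreBox (u y) (D.vert.tgt (w y).1.1)) :
    letI := hD.cornerChartedSpace
    SmoothNear I 𝓘(ℝ, hD.CornerModel) (fun y => D.boxAct (u y) (w y)) x := by
  let _ := hD.cornerChartedSpace
  obtain ⟨h1, h2⟩ := hD.smoothNear_corner_iff.1 hw
  refine hD.smoothNear_corner_iff.2 ⟨?_, ?_⟩
  · refine (hD.vert_lie.smoothNear_tmul h1 ((hD.boxH_lie.smoothNear_src _).comp hu) ?_).congr ?_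
    · filter_upwards [h] with y hy using hy.src_left.symm
    · filter_upwards [h] with y hy using congrArg Prod.fst hy.boxAct_val
  · refine (hD.horiz_lie.smoothNear_tmul ((hD.boxV_lie.smoothNear_tgt _).comp hu) h2 ?_).congr ?_
    · filter_upwards [h] with y hy using hy.tgt_bot.trans (w y).2
    · filter_upwards [h] with y hy using congrArg Prod.snd hy.boxAct_val

theorem IsLie.smoothNear_moment (z : D.CornerSpace) :
    letI := hD.cornerChartedSpace
    SmoothNear 𝓘(ℝ, hD.CornerModel) 𝓘(ℝ, EP) (fun z : D.CornerSpace => D.vert.tgt z.1.1) z := by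
  let _ := hD.cornerChartedSpace
  have := (hD.smoothNear_corner_iff (u := fun z : D.CornerSpace => z)).1 (smoothNear_id z)
  exact (hD.vert_lie.smoothNear_tgt _).comp this.1

/-- Orbit equivalent points of `𝒱 ×_{b,l} ℋ` are related by a smooth map that preserves the
orbits. -/
theorem IsLie.exists_translation {z z' : D.CornerSpace} (h : D.coreOrbit z' z) :
    letI := hD.cornerChartedSpace
    ∃ T : D.CornerSpace → D.CornerSpace,
      SmoothNear 𝓘(ℝ, hD.CornerModel) 𝓘(ℝ, hD.CornerModel) T z ∧ T z = z' ∧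
        ∀ᶠ w in 𝓝 z, D.toDiag (T w) = D.toDiag w := by
  let _ := hD.cornerChartedSpace
  obtain ⟨a, ha⟩ := exists_coreAnchor h
  obtain ⟨hE, rfl⟩ := isCoreBox_of_coreAnchor ha
  obtain ⟨α, γ, hα, hγ, hαγ, hγα⟩ := hD.exists_coreChart hE
  have hη := hD.smoothNear_moment z
  have hpair : SmoothNear 𝓘(ℝ, hD.CornerModel) (𝓘(ℝ, EP).prod 𝓘(ℝ, hD.CoreModel))
      (fun w : D.CornerSpace => (D.vert.tgt w.1.1, γ a.1.1.1)) z :=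
    hη.prodMk (smoothNear_const _ _)
  have hcore := hpair.continuousAt.eventually hαγ
  -- The fibre coordinate of the acting core box is kept constant while its vertex follows w.
  refine ⟨fun w => D.boxAct (α (D.vert.tgt w.1.1, γ a.1.1.1)) w,
    hD.smoothNear_boxAct (hα.comp_of_eq hpair rfl) (smoothNear_id z)
      (hcore.mono fun w hw => hw.1), ?_, ?_⟩
  · simp only [hγα.self_of_nhds _ hE]
  · filter_upwards [hcore] with w hw using hw.1.toDiag_boxAct

/-- The core action is free and infinitesimally free: the orbit map has an injective
derivative. -/
theorem IsLie.IsUnitChart.eq_zero_of_isStationaryAt_boxAct [CompleteSpace hD.CoreModel]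
    (hs : D.IsSlim) {z : D.CornerSpace} {α : P × hD.CoreModel → B} {γ : B → hD.CoreModel}
    (hc : hD.IsUnitChart (D.vert.tgt z.1.1) α γ) {v : hD.CoreModel}
    (h : letI := hD.cornerChartedSpace; IsStationaryAt 𝓘(ℝ, hD.CornerModel)
      (fun τ : ℝ => D.boxAct (α (D.vert.tgt z.1.1, τ • v)) z) 0) : v = 0 := by
  let _ := hD.cornerChartedSpace
  have hval := fun w => (hD.smoothNear_corner_iff (u := fun z : D.CornerSpace => z)).1
    (smoothNear_id w)
  have hsm : ContDiff ℝ ∞ fun τ : ℝ => τ • v := contDiff_id.smul contDiff_const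
  have hpt : Tendsto (fun τ : ℝ => (D.vert.tgt z.1.1, τ • v)) (𝓝 0)
      (𝓝 (D.vert.tgt z.1.1, 0)) := by
    have : Continuous fun τ : ℝ => (D.vert.tgt z.1.1, τ • v) :=
      continuous_const.prodMk hsm.continuous
    simpa using this.tendsto 0
  have hcore := hpt.eventually hc.isCoreBox_param
  refine hc.eq_zero_of_isStationaryAt hs ?_ ?_
  -- The left side of the acting box is recovered by cancelling the constant vertical component of z
  -- on the left; likewise its bottom by cancelling the horizontal component on the right.
  · have h1 := h.map (hval _).1 rfl
    refine (hD.vert_lie.isStationaryAt_tmul (IsStationaryAt.const (D.vert.inv z.1.1) 0) h1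
      ?_).congr ?_
    · filter_upwards [hcore] with τ hτ
      rw [D.vert.tgt_inv, hτ.boxAct_val, D.vert.src_tmul]
    · filter_upwards [hcore] with τ hτ
      rw [hτ.boxAct_val, D.vert.inv_tmul_cancel hτ.src_left.symm]
  · have h1 := h.map (hval _).2 rfl
    refine (hD.horiz_lie.isStationaryAt_tmul h1 (IsStationaryAt.const (D.horiz.inv z.1.2) 0)
      ?_).congr ?_
    · filter_upwards [hcore] with τ hτ
      rw [D.horiz.src_inv, hτ.boxAct_val, D.horiz.tgt_tmul (hτ.tgt_bot.trans z.2)]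
    · filter_upwards [hcore] with τ hτ
      rw [hτ.boxAct_val, D.horiz.tmul_tmul_inv (hτ.tgt_bot.trans z.2)]

end Slice

end DoubleGroupoid

/-! ### Transversals from the inverse function theorem -/

section Transversal

open Filter Module

/-- If `g (y, 0) = y` and the derivative of `g` at `(u, 0)` in the second direction is injective,
then near `u` every point is `g (y, c)` for unique small `c` and `y` in a transversal through
`u`. -/
theorem exists_transversal {E F : Type*} [NormedAddCommGroup E] [NormedSpace ℝ E]
    [NormedAddCommGroup F] [NormedSpace ℝ F] [FiniteDimensional ℝ E] [FiniteDimensional ℝ F]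
    {g : E × F → E} {u : E} (hg : SmoothNear 𝓘(ℝ, E × F) 𝓘(ℝ, E) g (u, 0))
    (hg0 : ∀ᶠ y in 𝓝 u, g (y, 0) = y)
    (hinj : ∀ v : F, HasDerivAt (fun τ : ℝ => g (u, τ • v)) 0 0 → v = 0) :
    ∃ (q : E → EuclideanSpace ℝ (Fin (finrank ℝ E - finrank ℝ F))) (c : E → F)
      (σ : EuclideanSpace ℝ (Fin (finrank ℝ E - finrank ℝ F)) → E),
      SmoothNear 𝓘(ℝ, E) 𝓘(ℝ, EuclideanSpace ℝ (Fin (finrank ℝ E - finrank ℝ F))) q u ∧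
      SmoothNear 𝓘(ℝ, EuclideanSpace ℝ (Fin (finrank ℝ E - finrank ℝ F))) 𝓘(ℝ, E) σ (q u) ∧
      σ (q u) = u ∧ Tendsto c (𝓝 u) (𝓝 0) ∧ (∀ᶠ s in 𝓝 (q u), q (σ s) = s) ∧
      (∀ᶠ y in 𝓝 u, g (σ (q y), c y) = y) ∧
      ∀ᶠ w in 𝓝 (q u, 0), q (g (σ w.1, w.2)) = w.1 := by
  have : CompleteSpace E := FiniteDimensional.complete ℝ E
  have : CompleteSpace F := FiniteDimensional.complete ℝ F
  let G := fderiv ℝ g (u, 0)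
  have hG : HasFDerivAt g G (u, 0) := (hg.contDiffAt.differentiableAt (by simp)).hasFDerivAt
  have hG1 : ∀ y, G (y, 0) = y := by
    intro y
    have h1 : HasFDerivAt (fun y => g (y, 0)) (G.comp (ContinuousLinearMap.inl ℝ E F)) u :=
      HasFDerivAt.comp (g := g) u hG (hasFDerivAt_prodMk_left u 0)
    have h2 : HasFDerivAt (fun y => g (y, 0)) (ContinuousLinearMap.id ℝ E) u :=
      (hasFDerivAt_id u).congr_of_eventuallyEq hg0
    exact congrArg (fun T => T y) (h1.unique h2)
  let T : F →L[ℝ] E := G.comp (ContinuousLinearMap.inr ℝ E F)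
  have hT : Function.Injective T := by
    refine (injective_iff_map_eq_zero T).2 fun v hv => hinj v ?_
    have h1 : HasDerivAt (fun τ : ℝ => (u, τ • v)) (0, v) 0 :=
      (hasDerivAt_const _ _).prodMk
        (((hasDerivAt_id (0 : ℝ)).smul_const v).congr_deriv (one_smul ℝ v))
    have h2 : HasDerivAt (fun τ : ℝ => g (u, τ • v)) (G (0, v)) 0 :=
      HasFDerivAt.comp_hasDerivAt (l := g) (0 : ℝ) (by simpa using hG) h1
    exact h2.congr_deriv hv
  obtain ⟨L, e, he⟩ := exists_continuousLinearEquiv_add T hT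
  -- An affine transversal whose direction is complementary to the range of `T`. The derivative of
  -- `(s, c) ↦ g (σ s, c)` at 0 is then the equivalence `e`, and the components of the local inverse
  -- are `q` and `c`.
  let σ : EuclideanSpace ℝ (Fin (finrank ℝ E - finrank ℝ F)) → E := fun s => u + L s
  have hσ : ContDiff ℝ ∞ σ := contDiff_const.add L.contDiff
  have hσ0 : σ 0 = u := by simp [σ]
  have hσt : Tendsto σ (𝓝 0) (𝓝 u) := by
    have := hσ.continuous.tendsto 0
    rwa [hσ0] at this
  let Λ : EuclideanSpace ℝ (Fin (finrank ℝ E - finrank ℝ F)) × F → E × F := fun w => (σ w.1, w.2)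
  have hΛ : ContDiff ℝ ∞ Λ := (hσ.comp contDiff_fst).prodMk contDiff_snd
  have hΛ0 : Λ 0 = (u, 0) := Prod.ext hσ0 rfl
  have hΛ' : HasFDerivAt Λ ((L.comp (ContinuousLinearMap.fst ℝ
      (EuclideanSpace ℝ (Fin (finrank ℝ E - finrank ℝ F))) F)).prod
      (ContinuousLinearMap.snd ℝ _ F)) 0 :=
    ((L.hasFDerivAt.comp _ hasFDerivAt_fst).const_add u).prodMk hasFDerivAt_snd
  have hΨ : SmoothNear 𝓘(ℝ, EuclideanSpace ℝ (Fin (finrank ℝ E - finrank ℝ F)) × F) 𝓘(ℝ, E)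
      (fun w => g (Λ w)) 0 := hg.comp_of_eq (hΛ.smoothNear 0) hΛ0
  have hΨ' : HasFDerivAt (fun w => g (Λ w)) (e : _ →L[ℝ] E) 0 := by
    refine (HasFDerivAt.comp (g := g) 0 (by rw [hΛ0]; exact hG) hΛ').congr_fderiv ?_
    refine ContinuousLinearMap.ext fun w => ?_
    have h1 : G (L w.1, w.2) = G (L w.1, 0) + G (0, w.2) := by
      rw [← map_add, Prod.mk_add_mk, add_zero, zero_add]
    refine h1.trans ?_
    rw [hG1]
    exact (he w).symm
  obtain ⟨φ, hφ0, hφ, -, hφ2⟩ := exists_openPartialHomeomorph_of_hasFDerivAt hΨ e hΨ'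
  have hφu : φ 0 = u := by
    rw [hφ]
    simp only [hΛ0]
    exact hg0.self_of_nhds
  have huφ : u ∈ φ.target := hφu ▸ φ.map_source hφ0
  have hφsu : φ.symm u = 0 := by rw [← hφu, φ.left_inv hφ0]
  have hφs : SmoothNear 𝓘(ℝ, E) 𝓘(ℝ, EuclideanSpace ℝ (Fin (finrank ℝ E - finrank ℝ F)) × F)
      φ.symm u := hφ2.contMDiffOn.smoothNear φ.open_target huφ
  have hq0 : (φ.symm u).1 = 0 := by rw [hφsu]; rfl
  have hs0 : Tendsto (fun s : EuclideanSpace ℝ (Fin (finrank ℝ E - finrank ℝ F)) => (s, (0 : F)))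
      (𝓝 0) (𝓝 0) := (continuous_id.prodMk continuous_const).tendsto' _ _ rfl
  have hsource : ∀ᶠ w in 𝓝 0, w ∈ φ.source := φ.open_source.mem_nhds hφ0
  refine ⟨fun y => (φ.symm y).1, fun y => (φ.symm y).2, σ,
    SmoothNear.comp (g := Prod.fst) (contDiff_fst.smoothNear _) hφs, by
      simp only [hq0]; exact hσ.smoothNear 0, by simp only [hq0, hσ0], ?_, ?_, ?_, ?_⟩
  · have := hφs.continuousAt.tendsto
    rw [hφsu] at this
    exact (continuous_snd.tendsto' 0 0 rfl).comp this
  · simp only [hq0]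
    filter_upwards [hs0.eventually hsource, hσt.eventually hg0] with s h1 h2
    have h3 : φ (s, 0) = σ s := by rw [hφ]; exact h2
    rw [← h3, φ.left_inv h1]
  · filter_upwards [φ.open_target.mem_nhds huφ] with y hy
    have h3 := φ.right_inv hy
    rwa [hφ] at h3
  · simp only [hq0]
    filter_upwards [show ∀ᶠ w in 𝓝 (0, 0), w ∈ φ.source from hsource] with w hw
    have h3 := φ.left_inv hw
    rw [hφ] at h3
    exact congrArg Prod.fst h3

end Transversal

/-! ### Slices for the core action -/

namespace DoubleGroupoid

section Slices

open Manifold Filter Module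

variable {EP EV EH EB P V H B : Type*} [NormedAddCommGroup EP] [NormedSpace ℝ EP]
  [NormedAddCommGroup EV] [NormedSpace ℝ EV] [NormedAddCommGroup EH] [NormedSpace ℝ EH]
  [NormedAddCommGroup EB] [NormedSpace ℝ EB]
  [TopologicalSpace P] [ChartedSpace EP P] [IsManifold 𝓘(ℝ, EP) ∞ P]
  [TopologicalSpace V] [ChartedSpace EV V] [IsManifold 𝓘(ℝ, EV) ∞ V]
  [TopologicalSpace H] [ChartedSpace EH H] [IsManifold 𝓘(ℝ, EH) ∞ H]
  [TopologicalSpace B] [ChartedSpace EB B] [IsManifold 𝓘(ℝ, EB) ∞ B]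
  {D : DoubleGroupoid P V H B} (hD : D.IsLie EP EV EH EB)

/-- By freeness, the fibre of the anchor map over (z, z) consists of the unit box acting on z. As
the anchor map is closed, the fibres over nearby pairs stay close to this one. -/
theorem IsCoreProper.eventually_mem (hp : D.IsCoreProper) (hs : D.IsSlim) {z : D.CornerSpace}
    {U : Set B} (hU : U ∈ 𝓝 (D.unitBox (D.vert.tgt z.1.1))) :
    ∀ᶠ w in 𝓝 (z, z), ∀ a, D.coreAnchor a = w → a.1.1.1 ∈ U := by
  refine hp.isClosedMap.eventually_nhds_fiber (p := fun a => a.1.1.1 ∈ U) (z, z)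
    fun a ha => ?_
  obtain ⟨hE, hz⟩ := isCoreBox_of_coreAnchor ha
  have hc : Continuous fun a : FiberProduct D.coreTgt D.moment => a.1.1.1 :=
    continuous_subtype_val.comp (continuous_fst.comp continuous_subtype_val)
  refine hc.continuousAt.eventually ?_
  change U ∈ 𝓝 a.1.1.1
  rw [hE.eq_unitBox hs hz.symm]
  exact hU

/-- The model space of the quotient of the core action. -/
abbrev IsLie.SliceModel (hD : D.IsLie EP EV EH EB) : Type :=
  EuclideanSpace ℝ (Fin (finrank ℝ hD.CornerModel - finrank ℝ hD.CoreModel))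

include hD

/-- The local action (y, c) ↦ α(·, c) ▷ y satisfies the hypotheses of `exists_transversal`, by
infinitesimal freeness. This controls orbits only under small core boxes; properness excludes
returns to the slice by boxes far from the units. -/
theorem IsLie.exists_slice (hs : D.IsSlim) (hp : D.IsCoreProper)
    [FiniteDimensional ℝ hD.CornerModel] [FiniteDimensional ℝ hD.CoreModel] (z : D.CornerSpace) :
    letI := hD.cornerChartedSpace
    ∃ (q : D.CornerSpace → hD.SliceModel)
      (σ : hD.SliceModel →
        D.CornerSpace),
      SmoothNear 𝓘(ℝ, hD.CornerModel) 𝓘(ℝ, hD.SliceModel) q z ∧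
      SmoothNear 𝓘(ℝ, hD.SliceModel) 𝓘(ℝ, hD.CornerModel) σ (q z) ∧ σ (q z) = z ∧
      (∀ᶠ y in 𝓝 (q z), q (σ y) = y) ∧ (∀ᶠ w in 𝓝 z, D.toDiag (σ (q w)) = D.toDiag w) ∧
      ∀ᶠ p in 𝓝 (z, z), D.toDiag p.1 = D.toDiag p.2 → q p.1 = q p.2 := by
  let _ := hD.cornerChartedSpace
  have := hD.isManifold_corner
  have : CompleteSpace hD.CoreModel := FiniteDimensional.complete ℝ _
  obtain ⟨α, γ, hc⟩ := hD.exists_isUnitChart (D.vert.tgt z.1.1)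
  let κ := chartAt hD.CornerModel z
  let u := κ z
  have hz : z ∈ κ.source := mem_chart_source _ z
  have hu : u ∈ κ.target := κ.map_source hz
  have hκu : κ.symm u = z := κ.left_inv hz
  have hκ : SmoothNear 𝓘(ℝ, hD.CornerModel) 𝓘(ℝ, hD.CornerModel) κ z := smoothNear_chartAt hz
  have hκs : SmoothNear 𝓘(ℝ, hD.CornerModel) 𝓘(ℝ, hD.CornerModel) κ.symm u :=
    smoothNear_chartAt_symm hu
  let ζ : hD.CornerModel × hD.CoreModel → P × hD.CoreModel := fun w =>
    (D.vert.tgt (κ.symm w.1).1.1, w.2)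
  have hκs1 : SmoothNear 𝓘(ℝ, hD.CornerModel × hD.CoreModel) 𝓘(ℝ, hD.CornerModel)
      (fun w : hD.CornerModel × hD.CoreModel => κ.symm w.1) (u, 0) :=
    hκs.comp_of_eq (contDiff_fst.smoothNear _) rfl
  have hζ : SmoothNear 𝓘(ℝ, hD.CornerModel × hD.CoreModel) (𝓘(ℝ, EP).prod 𝓘(ℝ, hD.CoreModel))
      ζ (u, 0) := ((hD.smoothNear_moment _).comp hκs1).prodMk (contDiff_snd.smoothNear _)
  have hζ0 : ζ (u, 0) = (D.vert.tgt z.1.1, 0) := by simp only [ζ, hκu]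
  have hζt : Tendsto ζ (𝓝 (u, 0)) (𝓝 (D.vert.tgt z.1.1, 0)) := by
    rw [← hζ0]; exact hζ.continuousAt
  have hcore := hζt.eventually hc.isCoreBox_param
  let A : hD.CornerModel × hD.CoreModel → D.CornerSpace := fun w => D.boxAct (α (ζ w)) (κ.symm w.1)
  have hA : SmoothNear 𝓘(ℝ, hD.CornerModel × hD.CoreModel) 𝓘(ℝ, hD.CornerModel) A (u, 0) :=
    hD.smoothNear_boxAct (hc.smoothNear_param.comp_of_eq hζ hζ0) hκs1 hcore
  have hA0 : A (u, 0) = z := by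
    simp only [A, hζ0, hκu, hc.param_self, boxAct_unitBox]
  have hAt : Tendsto A (𝓝 (u, 0)) (𝓝 z) := by
    have := hA.continuousAt.tendsto
    rwa [hA0] at this
  have hAs : ∀ᶠ w in 𝓝 (u, 0), A w ∈ κ.source := hAt.eventually (κ.open_source.mem_nhds hz)
  have hG : SmoothNear 𝓘(ℝ, hD.CornerModel × hD.CoreModel) 𝓘(ℝ, hD.CornerModel)
      (fun w => κ (A w)) (u, 0) := hκ.comp_of_eq hA hA0
  have hut : ∀ᶠ y in 𝓝 u, y ∈ κ.target := κ.open_target.mem_nhds hu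
  have hAy : ∀ᶠ y in 𝓝 u, A (y, 0) = κ.symm y := by
    have ht : Tendsto (fun y => D.vert.tgt (κ.symm y).1.1) (𝓝 u) (𝓝 (D.vert.tgt z.1.1)) := by
      have := ((hD.smoothNear_moment _).comp hκs).continuousAt.tendsto
      rwa [hκu] at this
    filter_upwards [ht.eventually hc.param_zero] with y hy
    simp only [A, ζ, hy, boxAct_unitBox]
  have hGy : ∀ᶠ y in 𝓝 u, κ (A (y, 0)) = y := by
    filter_upwards [hut, hAy] with y h1 h2
    rw [h2, κ.right_inv h1]
  have hinj : ∀ v : hD.CoreModel, HasDerivAt (fun τ : ℝ => κ (A (u, τ • v))) 0 0 → v = 0 := by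
    intro v hv
    refine hc.eq_zero_of_isStationaryAt_boxAct hD hs ?_
    have h3 : IsStationaryAt 𝓘(ℝ, hD.CornerModel) (fun τ : ℝ => κ (A (u, τ • v))) 0 := by
      have := hv.hasFDerivAt.hasMFDerivAt
      rwa [ContinuousLinearMap.toSpanSingleton_zero] at this
    have h4 : κ (A (u, (0 : ℝ) • v)) = u := by simp only [zero_smul, hA0, u]
    refine (h3.map hκs h4).congr ?_
    have h5 : Tendsto (fun τ : ℝ => (u, τ • v)) (𝓝 0) (𝓝 (u, 0)) := by
      have : Continuous fun τ : ℝ => (u, τ • v) :=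
        continuous_const.prodMk (continuous_id.smul continuous_const)
      simpa using this.tendsto 0
    filter_upwards [h5.eventually hAs] with τ h6
    rw [κ.left_inv h6]
    simp only [A, ζ, hκu]
  obtain ⟨q, c, σ, hq, hσ, hσq, hct, hqσ, hgq, hqg⟩ := exists_transversal hG hGy hinj
  have hqt : Tendsto q (𝓝 u) (𝓝 (q u)) := hq.continuousAt
  have hκt : Tendsto κ (𝓝 z) (𝓝 u) := hκ.continuousAt
  have hσt : Tendsto σ (𝓝 (q u)) (𝓝 u) := by
    have := hσ.continuousAt.tendsto
    rwa [hσq] at this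
  have hσqt : Tendsto (fun w => (σ (q (κ w)), c (κ w))) (𝓝 z) (𝓝 (u, 0)) := by
    rw [nhds_prod_eq]
    exact ((hσt.comp hqt).comp hκt).prodMk (hct.comp hκt)
  have hπ : ∀ᶠ w in 𝓝 z, D.toDiag (κ.symm (σ (q (κ w)))) = D.toDiag w := by
    filter_upwards [hσqt.eventually hAs, hσqt.eventually hcore, hκt.eventually hgq,
      κ.open_source.mem_nhds hz] with w h1 h2 h3 h4
    have h5 : D.toDiag w = D.toDiag (A (σ (q (κ w)), c (κ w))) :=
      congrArg _ (κ.injOn h4 h1 h3.symm)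
    exact (h5.trans (IsCoreBox.toDiag_boxAct h2)).symm
  refine ⟨fun w => q (κ w), fun s => κ.symm (σ s), hq.comp_of_eq hκ rfl, hκs.comp_of_eq hσ hσq, ?_, ?_, hπ,
    ?_⟩
  · change κ.symm (σ (q u)) = z
    rw [hσq, hκu]
  · filter_upwards [hqσ, hσt.eventually hut] with s h1 h2
    rw [κ.right_inv h2, h1]
  · rw [nhds_prod_eq] at hqg
    obtain ⟨pa, ha, pb, hb, hab⟩ := eventually_prod_iff.1 hqg
    have hγ0 : Tendsto γ (𝓝 (D.unitBox (D.vert.tgt z.1.1))) (𝓝 0) := by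
      have := hc.smoothNear_coord.continuousAt.tendsto
      rwa [hc.coord_unitBox] at this
    have hU := hp.eventually_mem hs (z := z) (hc.param_coord.and (hγ0.eventually hb))
    -- Both points are replaced by their representatives on the slice, which lie in the same orbits
    -- and are still close to z.
    have hpair : Tendsto (fun p : D.CornerSpace × D.CornerSpace =>
        (κ.symm (σ (q (κ p.1))), κ.symm (σ (q (κ p.2))))) (𝓝 (z, z)) (𝓝 (z, z)) := by
      have h1 : Tendsto (fun w => κ.symm (σ (q (κ w)))) (𝓝 z) (𝓝 z) := by
        have h2 := hκs.continuousAt.tendsto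
        rw [hκu] at h2
        exact h2.comp ((hσt.comp hqt).comp hκt)
      rw [nhds_prod_eq]
      exact (h1.comp tendsto_fst).prodMk (h1.comp tendsto_snd)
    have hgood : ∀ᶠ w in 𝓝 z, D.toDiag (κ.symm (σ (q (κ w)))) = D.toDiag w ∧
        q (σ (q (κ w))) = q (κ w) ∧ σ (q (κ w)) ∈ κ.target ∧ pa (q (κ w)) := by
      filter_upwards [hπ, (hqt.comp hκt).eventually hqσ,
        ((hσt.comp hqt).comp hκt).eventually hut, (hqt.comp hκt).eventually ha] with w h1 h2 h3 h4
        using ⟨h1, h2, h3, h4⟩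
    filter_upwards [hpair.eventually hU, hgood.prod_nhds hgood] with p h1 h2 h3
    obtain ⟨⟨h4, h5, h6, -⟩, h7, -, -, h10⟩ := h2
    rw [← h4, ← h7, D.toDiag_eq_iff hD.doubleSource_surjective] at h3
    obtain ⟨a, ha⟩ := exists_coreAnchor h3
    obtain ⟨hE, hEa⟩ := isCoreBox_of_coreAnchor ha
    obtain ⟨h11, h12⟩ := h1 a ha
    -- The first slice point is the second one moved by a core box with small coordinate, and such a
    -- move does not change `q`.
    have h13 : κ.symm (σ (q (κ p.1))) = A (σ (q (κ p.2)), γ a.1.1.1) := by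
      rw [hEa]
      simp only [A, ζ]
      rw [h11 _ hE]
    have h14 := hab h10 h12
    rw [← h13, κ.right_inv h6, h5] at h14
    exact h14

end Slices

end DoubleGroupoid

/-! ### Local sections, and normal forms of inverses and products -/

namespace Manifold

theorem IsSubmersion.exists_localSection {EM EN M N : Type*}
    [NormedAddCommGroup EM] [NormedSpace ℝ EM] [NormedAddCommGroup EN] [NormedSpace ℝ EN]
    [TopologicalSpace M] [ChartedSpace EM M] [IsManifold 𝓘(ℝ, EM) ∞ M]
    [TopologicalSpace N] [ChartedSpace EN N] [IsManifold 𝓘(ℝ, EN) ∞ N]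
    {s : M → N} (hs : IsSubmersion 𝓘(ℝ, EM) 𝓘(ℝ, EN) ∞ s) (m : M) :
    ∃ σ : N → M, SmoothNear 𝓘(ℝ, EN) 𝓘(ℝ, EM) σ (s m) ∧ σ (s m) = m ∧
      ∀ᶠ n in 𝓝 (s m), s (σ n) = n := by
  obtain ⟨γ, S, -, hS, hSs, hsS⟩ :=
    (hs.isSubmersionOfComplement_complement.isSubmersionAt m).exists_localInverse
  have hpair : SmoothNear 𝓘(ℝ, EN) (𝓘(ℝ, EN).prod 𝓘(ℝ, hs.complement))
      (fun n : N => (n, γ m)) (s m) := (smoothNear_id _).prodMk (smoothNear_const _ _)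
  exact ⟨fun n => S (n, γ m), SmoothNear.comp (g := S) hS hpair, hSs.self_of_nhds,
    (hpair.continuousAt.eventually hsS).mono fun n hn => hn.1⟩

end Manifold

namespace ArrowGroupoid

theorem inv_tmul_rev {P G : Type*} (𝒢 : ArrowGroupoid P G) {g h : G} (e : 𝒢.tgt g = 𝒢.src h) :
    𝒢.inv (𝒢.tmul g h) = 𝒢.tmul (𝒢.inv h) (𝒢.inv g) := by
  have e1 : 𝒢.tgt (𝒢.inv h) = 𝒢.src (𝒢.inv g) := by rw [tgt_inv, src_inv, e]
  refine (𝒢.eq_inv_of_tmul_eq_one (p := 𝒢.tgt h) ?_ ?_).symm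
  · rw [𝒢.tgt_tmul e1, src_tmul, tgt_inv]
  · rw [𝒢.tmul_assoc e1 (by rw [tgt_inv, src_tmul]), 𝒢.inv_tmul_cancel e, inv_tmul]

end ArrowGroupoid

namespace DoubleGroupoid

section NormalForm

variable {P V H B : Type*} (D : DoubleGroupoid P V H B)

/-- The normal form of an inverse. -/
theorem inv_diag_tmul {f : V} {x : H} {A : B} (e : D.vert.tgt f = D.horiz.src x)
    (ht : D.top A = D.horiz.inv x) (hr : D.right A = D.vert.inv f) :
    D.diagonal.inv (D.diagonal.tmul (D.diagV f) (D.diagH x)) =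
      D.diagonal.tmul (D.diagV (D.left A)) (D.diagH (D.bot A)) := by
  rw [← D.diag_box, ht, hr, diagH_inv, diagV_inv]
  exact D.diagonal.inv_tmul_rev (g := D.diagV f) (h := D.diagH x) e

/-- The normal form of a product. -/
theorem diag_tmul_tmul {f : V} {y : H} {A : B} (e : D.vert.tgt f = D.horiz.src (D.top A))
    (e' : D.vert.tgt (D.right A) = D.horiz.src y) :
    D.diagonal.tmul (D.diagonal.tmul (D.diagV f) (D.diagH (D.top A)))
        (D.diagonal.tmul (D.diagV (D.right A)) (D.diagH y)) =
      D.diagonal.tmul (D.diagV (D.vert.tmul f (D.left A)))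
        (D.diagH (D.horiz.tmul (D.bot A) y)) := by
  have e1 : D.vert.tgt f = D.vert.src (D.left A) := e.trans (D.top_left A).symm
  have e2 : D.horiz.tgt (D.bot A) = D.horiz.src y := (D.bot_right A).symm.trans e'
  rw [D.diagV_tmul e1, D.diagH_tmul e2,
    D.diagonal.tmul_assoc (g := D.diagV f) (h := D.diagH (D.top A))
      (k := D.diagonal.tmul (D.diagV (D.right A)) (D.diagH y)) e
      ((D.top_right A).symm.trans (D.diagonal.src_tmul (D.diagV (D.right A)) (D.diagH y)).symm),
    ← D.diagonal.tmul_assoc (g := D.diagH (D.top A)) (h := D.diagV (D.right A)) (k := D.diagH y)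
      (D.top_right A).symm e', diag_box,
    D.diagonal.tmul_assoc (g := D.diagV (D.left A)) (h := D.diagH (D.bot A)) (k := D.diagH y)
      (D.bot_left A) e2,
    D.diagonal.tmul_assoc (g := D.diagV f) (h := D.diagV (D.left A))
      (k := D.diagonal.tmul (D.diagH (D.bot A)) (D.diagH y)) e1
      (Eq.trans (D.bot_left A) (D.diagonal.src_tmul (D.diagH (D.bot A)) (D.diagH y)).symm)]

end NormalForm

/-! ### Smoothness of the structure maps of the diagonal groupoid -/

section DiagonalLie

open Manifold Filter

variable {EP EV EH EB P V H B : Type*} [NormedAddCommGroup EP] [NormedSpace ℝ EP]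
  [NormedAddCommGroup EV] [NormedSpace ℝ EV] [NormedAddCommGroup EH] [NormedSpace ℝ EH]
  [NormedAddCommGroup EB] [NormedSpace ℝ EB]
  [TopologicalSpace P] [ChartedSpace EP P] [IsManifold 𝓘(ℝ, EP) ∞ P]
  [TopologicalSpace V] [ChartedSpace EV V] [IsManifold 𝓘(ℝ, EV) ∞ V]
  [TopologicalSpace H] [ChartedSpace EH H] [IsManifold 𝓘(ℝ, EH) ∞ H]
  [TopologicalSpace B] [ChartedSpace EB B] [IsManifold 𝓘(ℝ, EB) ∞ B]
  {D : DoubleGroupoid P V H B} (hD : D.IsLie EP EV EH EB)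
  {EW HW W : Type*} [NormedAddCommGroup EW] [NormedSpace ℝ EW]
  [TopologicalSpace HW] {I : ModelWithCorners ℝ EW HW} [TopologicalSpace W] [ChartedSpace HW W]

include hD

/-- Boxes with given top and right sides can be chosen to depend smoothly on these sides. -/
theorem IsLie.exists_smooth_box {u : W → H} {w : W → V} {x : W}
    (hu : SmoothNear I 𝓘(ℝ, EH) u x) (hw : SmoothNear I 𝓘(ℝ, EV) w x)
    (h : ∀ᶠ y in 𝓝 x, D.horiz.tgt (u y) = D.vert.src (w y)) :
    ∃ A : W → B, SmoothNear I 𝓘(ℝ, EB) A x ∧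
      ∀ᶠ y in 𝓝 x, D.top (A y) = u y ∧ D.right (A y) = w y := by
  let _ := FiberProduct.chartedSpace hD.horiz_lie.src_submersion
    hD.vert_lie.src_submersion.contMDiff
  have := FiberProduct.isManifold hD.horiz_lie.src_submersion hD.vert_lie.src_submersion.contMDiff
  have hsrc : ∀ {y}, D.horiz.tgt (u y) = D.vert.src (w y) →
      D.horiz.src (D.horiz.inv (u y)) = D.vert.src (w y) := fun e => by rw [D.horiz.src_inv, e]
  obtain ⟨C, hC⟩ := hD.doubleSource_surjective ⟨(D.horiz.inv (u x), w x), hsrc h.self_of_nhds⟩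
  obtain ⟨S, hS, -, hSs⟩ := hD.doubleSource_submersion.exists_localSection C
  rw [hC] at hS hSs
  classical
  -- The box is the horizontal inverse of one with top `u⁻¹` and left side `w`. The value of `ψ` at
  -- points where the arrows do not match is immaterial.
  let ψ : W → FiberProduct D.horiz.src D.vert.src := fun y =>
    if e : D.horiz.tgt (u y) = D.vert.src (w y) then ⟨(D.horiz.inv (u y), w y), hsrc e⟩
    else D.doubleSource C
  have hψv : ∀ᶠ y in 𝓝 x, (ψ y).1 = (D.horiz.inv (u y), w y) := by
    filter_upwards [h] with y e
    simp only [ψ, dif_pos e]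
  have hψ : SmoothNear I 𝓘(ℝ, EV × hD.horiz_lie.src_submersion.complement) ψ x :=
    (FiberProduct.smoothNear_iff hD.horiz_lie.src_submersion
      hD.vert_lie.src_submersion.contMDiff ψ x).2
      ((((hD.horiz_lie.smoothNear_inv _).comp hu).prodMk hw).congr hψv)
  have hψx : ψ x = ⟨(D.horiz.inv (u x), w x), hsrc h.self_of_nhds⟩ := dif_pos h.self_of_nhds
  refine ⟨fun y => D.boxH.inv (S (ψ y)), (hD.boxH_lie.smoothNear_inv _).comp
    (hS.comp_of_eq hψ hψx), ?_⟩
  have ht := hψ.continuousAt.tendsto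
  rw [hψx] at ht
  filter_upwards [ht.eventually hSs, hψv] with y h1 h2
  have h3 : D.top (S (ψ y)) = D.horiz.inv (u y) :=
    (congrArg (fun z => z.1.1) h1).trans (congrArg Prod.fst h2)
  have h4 : D.left (S (ψ y)) = w y := (congrArg (fun z => z.1.2) h1).trans (congrArg Prod.snd h2)
  exact ⟨by rw [D.top_inv, h3, D.horiz.inv_inv], by rw [D.right_invH, h4]⟩

variable {ED : Type*} [NormedAddCommGroup ED] [NormedSpace ℝ ED] [TopologicalSpace D.Diag]
  [ChartedSpace ED D.Diag]
  (hπ : letI := hD.cornerChartedSpace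
    ∀ z, SmoothNear 𝓘(ℝ, hD.CornerModel) 𝓘(ℝ, ED) D.toDiag z)

include hπ

/-- The map factors through 𝒱 ×_{b,l} ℋ near x, and the projection from there is smooth. -/
theorem IsLie.smoothNear_diag {u : W → V} {w : W → H} {x : W}
    (hu : SmoothNear I 𝓘(ℝ, EV) u x) (hw : SmoothNear I 𝓘(ℝ, EH) w x)
    (h : ∀ᶠ y in 𝓝 x, D.vert.tgt (u y) = D.horiz.src (w y)) :
    SmoothNear I 𝓘(ℝ, ED) (fun y => D.diagonal.tmul (D.diagV (u y)) (D.diagH (w y))) x := by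
  let _ := hD.cornerChartedSpace
  classical
  let c : W → D.CornerSpace := fun y =>
    if e : D.vert.tgt (u y) = D.horiz.src (w y) then ⟨(u y, w y), e⟩
    else ⟨(u x, w x), h.self_of_nhds⟩
  have hc : ∀ᶠ y in 𝓝 x, (c y).1 = (u y, w y) := by
    filter_upwards [h] with y e
    simp only [c, dif_pos e]
  have hcs : SmoothNear I 𝓘(ℝ, hD.CornerModel) c x :=
    hD.smoothNear_corner_iff.2 ⟨hu.congr (hc.mono fun y hy => congrArg Prod.fst hy),
      hw.congr (hc.mono fun y hy => congrArg Prod.snd hy)⟩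
  refine ((hπ _).comp hcs).congr ?_
  filter_upwards [hc] with y hy
  rw [toDiag_eq, hy]

variable [IsManifold 𝓘(ℝ, ED) ∞ D.Diag]
  (hσ : letI := hD.cornerChartedSpace
    ∀ z, ∃ σ : D.Diag → D.CornerSpace,
      SmoothNear 𝓘(ℝ, ED) 𝓘(ℝ, hD.CornerModel) σ (D.toDiag z) ∧ σ (D.toDiag z) = z ∧
        ∀ᶠ a in 𝓝 (D.toDiag z), D.toDiag (σ a) = a)

include hσ

/-- Arrows of the diagonal groupoid have, locally, normal forms that depend smoothly on the
arrow. -/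
theorem IsLie.exists_normalForm (a : D.Diag) :
    ∃ (f : D.Diag → V) (x : D.Diag → H), SmoothNear 𝓘(ℝ, ED) 𝓘(ℝ, EV) f a ∧
      SmoothNear 𝓘(ℝ, ED) 𝓘(ℝ, EH) x a ∧ (∀ c, D.vert.tgt (f c) = D.horiz.src (x c)) ∧
      ∀ᶠ c in 𝓝 a, D.diagonal.tmul (D.diagV (f c)) (D.diagH (x c)) = c := by
  let _ := hD.cornerChartedSpace
  obtain ⟨z, rfl⟩ := D.toDiag_surjective hD.doubleSource_surjective a
  obtain ⟨σ, h1, -, h3⟩ := hσ z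
  obtain ⟨h4, h5⟩ := hD.smoothNear_corner_iff.1 h1
  refine ⟨fun c => (σ c).1.1, fun c => (σ c).1.2, h4, h5, fun c => (σ c).2, ?_⟩
  filter_upwards [h3] with c hc
  rw [← toDiag_eq, hc]

theorem IsLie.contMDiff_src_diagonal : ContMDiff 𝓘(ℝ, ED) 𝓘(ℝ, EP) ∞ D.diagonal.src := by
  intro a
  obtain ⟨f, x, hf, hx, e, h⟩ := hD.exists_normalForm hπ hσ a
  refine (((hD.vert_lie.smoothNear_src _).comp hf).congr ?_).contMDiffAt
  filter_upwards [h] with c hc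
  conv_lhs => rw [← hc]
  rw [D.diagonal.src_tmul]
  rfl

theorem IsLie.contMDiff_tgt_diagonal : ContMDiff 𝓘(ℝ, ED) 𝓘(ℝ, EP) ∞ D.diagonal.tgt := by
  intro a
  obtain ⟨f, x, hf, hx, e, h⟩ := hD.exists_normalForm hπ hσ a
  refine (((hD.horiz_lie.smoothNear_tgt _).comp hx).congr ?_).contMDiffAt
  filter_upwards [h] with c hc
  conv_lhs => rw [← hc]
  rw [D.diagonal.tgt_tmul (g := D.diagV (f c)) (h := D.diagH (x c)) (e c)]
  rfl

/-- A section of the source through j(f) i(x) is y ↦ j(s(y)) i(r(b(s(y)))), with s and r local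
sections of the sources of 𝒱 and ℋ through f and x. -/
theorem IsLie.src_submersion_diagonal [FiniteDimensional ℝ EP] [FiniteDimensional ℝ ED] :
    IsSubmersion 𝓘(ℝ, ED) 𝓘(ℝ, EP) ∞ D.diagonal.src := by
  refine isSubmersion_of_localSections (fun _ => inferInstance)
    (hD.contMDiff_src_diagonal hπ hσ) fun a => ?_
  obtain ⟨z, rfl⟩ := D.toDiag_surjective hD.doubleSource_surjective a
  rw [D.src_toDiag]
  obtain ⟨s, hs, hs0, hs1⟩ := hD.vert_lie.src_submersion.exists_localSection z.1.1
  obtain ⟨r, hr, hr0, hr1⟩ := hD.horiz_lie.src_submersion.exists_localSection z.1.2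
  have ht : SmoothNear 𝓘(ℝ, EP) 𝓘(ℝ, EP) (fun y => D.vert.tgt (s y)) (D.vert.src z.1.1) :=
    (hD.vert_lie.smoothNear_tgt _).comp hs
  have ht0 : D.vert.tgt (s (D.vert.src z.1.1)) = D.horiz.src z.1.2 := by rw [hs0, z.2]
  have htt := ht.continuousAt.tendsto
  rw [ht0] at htt
  refine ⟨fun y => D.diagonal.tmul (D.diagV (s y)) (D.diagH (r (D.vert.tgt (s y)))),
    hD.smoothNear_diag hπ hs (hr.comp_of_eq ht ht0)
      ((htt.eventually hr1).mono fun y hy => hy.symm), ?_, ?_⟩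
  · simp only [ht0, hr0, toDiag_eq]
    rw [hs0]
  · filter_upwards [hs1] with y hy
    rw [D.diagonal.src_tmul]
    exact hy

theorem IsLie.tgt_submersion_diagonal [FiniteDimensional ℝ EP] [FiniteDimensional ℝ ED] :
    IsSubmersion 𝓘(ℝ, ED) 𝓘(ℝ, EP) ∞ D.diagonal.tgt := by
  refine isSubmersion_of_localSections (fun _ => inferInstance)
    (hD.contMDiff_tgt_diagonal hπ hσ) fun a => ?_
  obtain ⟨z, rfl⟩ := D.toDiag_surjective hD.doubleSource_surjective a
  rw [D.tgt_toDiag]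
  obtain ⟨r, hr, hr0, hr1⟩ := hD.horiz_lie.tgt_submersion.exists_localSection z.1.2
  obtain ⟨s, hs, hs0, hs1⟩ := hD.vert_lie.tgt_submersion.exists_localSection z.1.1
  have ht : SmoothNear 𝓘(ℝ, EP) 𝓘(ℝ, EP) (fun y => D.horiz.src (r y)) (D.horiz.tgt z.1.2) :=
    (hD.horiz_lie.smoothNear_src _).comp hr
  have ht0 : D.horiz.src (r (D.horiz.tgt z.1.2)) = D.vert.tgt z.1.1 := by rw [hr0, z.2]
  have htt := ht.continuousAt.tendsto
  rw [ht0] at htt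
  refine ⟨fun y => D.diagonal.tmul (D.diagV (s (D.horiz.src (r y)))) (D.diagH (r y)),
    hD.smoothNear_diag hπ (hs.comp_of_eq ht ht0) hr (htt.eventually hs1), ?_, ?_⟩
  · simp only [ht0, hs0, toDiag_eq]
    rw [hr0]
  · filter_upwards [hr1, htt.eventually hs1] with y hy hy'
    rw [D.diagonal.tgt_tmul (g := D.diagV _) (h := D.diagH (r y)) hy']
    exact hy

theorem IsLie.contMDiff_one_diagonal : ContMDiff 𝓘(ℝ, EP) 𝓘(ℝ, ED) ∞ D.diagonal.one := by
  intro p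
  refine ((hD.smoothNear_diag hπ (hD.vert_lie.smoothNear_one p) (hD.horiz_lie.smoothNear_one p)
    (Eventually.of_forall fun y => by rw [D.vert.tgt_one, D.horiz.src_one])).congr
    (Eventually.of_forall fun y => ?_)).contMDiffAt
  change D.diagonal.one y = D.diagonal.tmul (D.diagV (D.vert.one y)) (D.diagH (D.horiz.one y))
  rw [D.diagV_one, D.diagH_one, D.diagonal.one_tmul (D.diagonal.src_one y).symm]

/-- The inverse i(x⁻¹) j(f⁻¹) is brought to normal form by a box with top x⁻¹ and right side f⁻¹,
chosen smoothly. -/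
theorem IsLie.contMDiff_inv_diagonal : ContMDiff 𝓘(ℝ, ED) 𝓘(ℝ, ED) ∞ D.diagonal.inv := by
  intro a
  obtain ⟨f, x, hf, hx, e, h⟩ := hD.exists_normalForm hπ hσ a
  have e1 : ∀ c, D.horiz.tgt (D.horiz.inv (x c)) = D.vert.src (D.vert.inv (f c)) := fun c => by
    rw [D.horiz.tgt_inv, D.vert.src_inv, e]
  obtain ⟨A, hA, hA'⟩ := hD.exists_smooth_box ((hD.horiz_lie.smoothNear_inv _).comp hx)
    ((hD.vert_lie.smoothNear_inv _).comp hf) (Eventually.of_forall e1)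
  refine ((hD.smoothNear_diag hπ ((hD.boxH_lie.smoothNear_src _).comp hA)
    ((hD.boxV_lie.smoothNear_tgt _).comp hA)
    (Eventually.of_forall fun c => D.bot_left (A c))).congr ?_).contMDiffAt
  filter_upwards [h, hA'] with c h1 h2
  conv_lhs => rw [← h1]
  exact D.inv_diag_tmul (e c) h2.1 h2.2

theorem IsLie.isLie_diagonal [FiniteDimensional ℝ EP] [FiniteDimensional ℝ ED] :
    D.diagonal.IsLie EP ED where
  src_surjective p := ⟨D.diagonal.one p, D.diagonal.src_one p⟩
  src_submersion := hD.src_submersion_diagonal hπ hσ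
  tgt_surjective p := ⟨D.diagonal.one p, D.diagonal.tgt_one p⟩
  tgt_submersion := hD.tgt_submersion_diagonal hπ hσ
  one_smooth := hD.contMDiff_one_diagonal hπ hσ
  inv_smooth := hD.contMDiff_inv_diagonal hπ hσ
  mul_smooth := by
    let _ := FiberProduct.chartedSpace (hD.tgt_submersion_diagonal hπ hσ)
      (hD.src_submersion_diagonal hπ hσ).contMDiff
    intro z
    have hval := (FiberProduct.contMDiff_val (hD.tgt_submersion_diagonal hπ hσ)
      (hD.src_submersion_diagonal hπ hσ).contMDiff).smoothNear z
    obtain ⟨f, x, hf, hx, e, h⟩ := hD.exists_normalForm hπ hσ z.1.1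
    obtain ⟨g, y, hg, hy, e', h'⟩ := hD.exists_normalForm hπ hσ z.1.2
    have hf' := SmoothNear.comp_of_eq hf hval.fst rfl
    have hx' := SmoothNear.comp_of_eq hx hval.fst rfl
    have hg' := SmoothNear.comp_of_eq hg hval.snd rfl
    have hy' := SmoothNear.comp_of_eq hy hval.snd rfl
    have h1 := hval.fst.continuousAt.eventually h
    have h1' := hval.snd.continuousAt.eventually h'
    have h2 : ∀ᶠ w : FiberProduct D.diagonal.tgt D.diagonal.src in 𝓝 z,
        D.horiz.tgt (x w.1.1) = D.vert.src (g w.1.2) := by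
      filter_upwards [h1, h1'] with w h3 h4
      have h5 := w.2
      rw [← h3, ← h4, D.diagonal.src_tmul] at h5
      exact (D.diagonal.tgt_tmul (g := D.diagV (f w.1.1)) (h := D.diagH (x w.1.1)) (e _)).symm.trans
        h5
    -- In j(f) i(x) j(g) i(y) the inner factors i(x) j(g) are rewritten by a box with top x and
    -- right side g.
    obtain ⟨A, hA, hA'⟩ := hD.exists_smooth_box hx' hg' h2
    refine ((hD.smoothNear_diag hπ
      (hD.vert_lie.smoothNear_tmul hf' ((hD.boxH_lie.smoothNear_src _).comp hA) ?_)
      (hD.horiz_lie.smoothNear_tmul ((hD.boxV_lie.smoothNear_tgt _).comp hA) hy' ?_)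
      ?_).congr ?_).contMDiffAt
    · filter_upwards [hA'] with w hw
      exact (e _).trans (by rw [← hw.1]; exact (D.top_left _).symm)
    · filter_upwards [hA'] with w hw
      exact (D.bot_right _).symm.trans ((congrArg D.vert.tgt hw.2).trans (e' _))
    · filter_upwards [hA'] with w hw
      have h3 : D.vert.tgt (f w.1.1) = D.vert.src (D.left (A w)) :=
        (e _).trans (by rw [← hw.1]; exact (D.top_left _).symm)
      exact (D.vert.tgt_tmul h3).trans
        ((D.bot_left _).trans (D.horiz.src_tmul (D.bot (A w)) (y w.1.2)).symm)
    · filter_upwards [h1, h1', hA'] with w h3 h4 hw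
      refine (D.diagonal.tmul_eq w.2).symm.trans ?_
      have h5 := D.diag_tmul_tmul (f := f w.1.1) (A := A w) (y := y w.1.2)
        (by rw [hw.1]; exact e _) ((congrArg D.vert.tgt hw.2).trans (e' _))
      rw [hw.1, hw.2, h3, h4] at h5
      exact h5

end DiagonalLie

end DoubleGroupoid

/-! ### Assembly: slices, closed orbit relation, homeomorphism and main theorem -/

namespace DoubleGroupoid

section Slices

open Manifold

variable {EP EV EH EB P V H B : Type*} [NormedAddCommGroup EP] [NormedSpace ℝ EP]
  [NormedAddCommGroup EV] [NormedSpace ℝ EV] [NormedAddCommGroup EH] [NormedSpace ℝ EH]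
  [NormedAddCommGroup EB] [NormedSpace ℝ EB]
  [TopologicalSpace P] [ChartedSpace EP P] [IsManifold 𝓘(ℝ, EP) ∞ P]
  [TopologicalSpace V] [ChartedSpace EV V] [IsManifold 𝓘(ℝ, EV) ∞ V]
  [TopologicalSpace H] [ChartedSpace EH H] [IsManifold 𝓘(ℝ, EH) ∞ H]
  [TopologicalSpace B] [ChartedSpace EB B] [IsManifold 𝓘(ℝ, EB) ∞ B]
  {D : DoubleGroupoid P V H B} (hD : D.IsLie EP EV EH EB)

include hD

theorem IsLie.finiteDimensional_cornerModel [FiniteDimensional ℝ EV] [FiniteDimensional ℝ EH]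
    (z : D.CornerSpace) : FiniteDimensional ℝ hD.CornerModel := by
  have := hD.vert_lie.tgt_submersion.finiteDimensional_complement z.1.1
  infer_instance

theorem IsLie.finiteDimensional_coreModel [FiniteDimensional ℝ EB] (A : B) :
    FiniteDimensional ℝ hD.CoreModel := by
  let _ := FiberProduct.chartedSpace hD.horiz_lie.src_submersion
    hD.vert_lie.src_submersion.contMDiff
  exact hD.doubleSource_submersion.finiteDimensional_complement A

theorem IsLie.hasSlices [FiniteDimensional ℝ EV] [FiniteDimensional ℝ EH] [FiniteDimensional ℝ EB]
    [TopologicalSpace D.Diag] (hq : Topology.IsQuotientMap D.toDiag) (hs : D.IsSlim)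
    (hp : D.IsCoreProper) :
    letI := hD.cornerChartedSpace
    HasSlices hD.CornerModel hD.SliceModel D.toDiag := by
  let _ := hD.cornerChartedSpace
  refine ⟨hq, fun z z' h => hD.exists_translation
    ((D.toDiag_eq_iff hD.doubleSource_surjective).1 h.symm), fun z => ?_⟩
  have := hD.finiteDimensional_cornerModel z
  have := hD.finiteDimensional_coreModel (D.unitBox (D.vert.tgt z.1.1))
  exact hD.exists_slice hs hp z

/-- Expresses the orbit relation as the range of the anchor map, which is closed when the action is
proper. -/
theorem range_coreAnchor (hfill : Function.Surjective D.doubleSource) :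
    Set.range D.coreAnchor = {p | D.toDiag p.1 = D.toDiag p.2} := by
  ext ⟨w, z⟩
  constructor
  · rintro ⟨a, ha⟩
    obtain ⟨h, rfl⟩ := isCoreBox_of_coreAnchor ha
    exact h.toDiag_boxAct
  · exact fun h => exists_coreAnchor ((D.toDiag_eq_iff hfill).1 h)

end Slices

section Homeomorph

variable {P V H B : Type*} [TopologicalSpace V] [TopologicalSpace H] {D : DoubleGroupoid P V H B}

/-- The arrows of the diagonal groupoid are the orbits of the core action. -/
noncomputable def quotientHomeomorph [TopologicalSpace D.Diag] (hq : Topology.IsQuotientMap D.toDiag)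
    (hfill : Function.Surjective D.doubleSource) : D.CoreQuotient ≃ₜ D.Diag :=
  (Equiv.ofBijective (Quotient.lift D.toDiag fun _ _ => D.toDiag_eq_of_coreOrbit)
    ⟨by
      rintro ⟨w⟩ ⟨z⟩ h
      exact Quotient.sound ((D.toDiag_eq_iff hfill).1 h), fun a => by
      obtain ⟨z, rfl⟩ := hq.surjective a
      exact ⟨Quotient.mk _ z, rfl⟩⟩).toHomeomorphOfContinuousOpen
    (hq.continuous.quotient_lift _) fun U hU => by
      rw [← hq.isOpen_preimage]
      convert hU.preimage (continuous_quotient_mk' (s := D.coreOrbit)) using 1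
      ext z
      constructor
      · rintro ⟨⟨w⟩, hw, h⟩
        have h' := Quotient.sound (s := D.coreOrbit) ((D.toDiag_eq_iff hfill).1 h)
        exact (h' ▸ hw : Quotient.mk _ z ∈ U)
      · exact fun h => ⟨_, h, rfl⟩

end Homeomorph

end DoubleGroupoid

theorem theorem3 {p v h b : ℕ} {P V H B : Type*}
    [TopologicalSpace P] [T2Space P] [SecondCountableTopology P]
    [ChartedSpace (EuclideanSpace ℝ (Fin p)) P] [IsManifold (𝓡 p) ∞ P]
    [TopologicalSpace V] [T2Space V] [SecondCountableTopology V]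
    [ChartedSpace (EuclideanSpace ℝ (Fin v)) V] [IsManifold (𝓡 v) ∞ V]
    [TopologicalSpace H] [T2Space H] [SecondCountableTopology H]
    [ChartedSpace (EuclideanSpace ℝ (Fin h)) H] [IsManifold (𝓡 h) ∞ H]
    [TopologicalSpace B] [T2Space B] [SecondCountableTopology B]
    [ChartedSpace (EuclideanSpace ℝ (Fin b)) B] [IsManifold (𝓡 b) ∞ B]
    (D : DoubleGroupoid P V H B)
    (hLie : D.IsLie (EuclideanSpace ℝ (Fin p)) (EuclideanSpace ℝ (Fin v))
      (EuclideanSpace ℝ (Fin h)) (EuclideanSpace ℝ (Fin b)))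
    (hslim : D.IsSlim) (hproper : D.IsCoreProper) :
    ∃ (_ : TopologicalSpace D.Diag) (d : ℕ)
      (_ : ChartedSpace (EuclideanSpace ℝ (Fin d)) D.Diag),
      T2Space D.Diag ∧ SecondCountableTopology D.Diag ∧ IsManifold (𝓡 d) ∞ D.Diag ∧
      D.diagonal.IsLie (EuclideanSpace ℝ (Fin p)) (EuclideanSpace ℝ (Fin d)) ∧
      ∃ φ : D.CoreQuotient ≃ₜ D.Diag,
        (∀ z : D.CornerSpace, φ (Quotient.mk D.coreOrbit z) = D.toDiag z) ∧
        Function.Surjective (fun z : D.CornerSpace => φ (Quotient.mk D.coreOrbit z)) ∧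
        letI := FiberProduct.chartedSpace hLie.vert_lie.tgt_submersion
          hLie.horiz_lie.src_submersion.contMDiff
        Manifold.IsSubmersion
          𝓘(ℝ, EuclideanSpace ℝ (Fin h) × hLie.vert_lie.tgt_submersion.complement) (𝓡 d) ∞
          (fun z : D.CornerSpace => φ (Quotient.mk D.coreOrbit z)) := by
  -- This topology makes the comparison with the orbit space a homeomorphism, so that slices of the
  -- core action become charts of 𝒟(B).
  let _ : TopologicalSpace D.Diag := TopologicalSpace.coinduced D.toDiag inferInstance
  have hfill := hLie.doubleSource_surjective
  have hq : Topology.IsQuotientMap D.toDiag := ⟨⟨rfl⟩, D.toDiag_surjective hfill⟩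
  let _ := hLie.cornerChartedSpace
  have hc := hLie.isManifold_corner
  have : SecondCountableTopology D.CornerSpace :=
    TopologicalSpace.Subtype.secondCountableTopology _
  have hs := hLie.hasSlices hq hslim hproper
  let _ := hs.chartedSpace
  have hM := hs.isManifold
  have hT := hs.t2Space (by
    rw [← DoubleGroupoid.range_coreAnchor hLie hfill]
    exact hproper.isClosedMap.isClosed_range)
  have hL := hLie.isLie_diagonal (fun z => hs.contMDiff.smoothNear z) hs.exists_localSection
  -- The dimension d is that of `SliceModel`: the dimension of the model of 𝒱 ×_{b,l} ℋ minus the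
  -- fibre dimension of the double source map.
  refine ⟨inferInstance, _, hs.chartedSpace, hT, hs.secondCountableTopology, hM, hL,
    DoubleGroupoid.quotientHomeomorph hq hfill, fun _ => rfl, hq.surjective, ?_⟩
  exact hs.isSubmersion hLie.finiteDimensional_cornerModel
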